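/- Let $\mathbb{T}=\mathbb{R}/2\pi\mathbb{Z}$. For a Lipschitz function $f:\mathbb{T}\to\mathbb{R}$ put $\Omega_f=\{(x,y)\in\mathbb{T}\times\mathbb{R}: y<f(x)\}$, and let $\dot H^1(\Omega_f)$ be the space of $u\in L^1_{\mathrm{loc}}(\Omega_f)$ whose weak gradient lies in $L^2(\Omega_f)$. For Lipschitz $g:\mathbb{T}\to\mathbb{R}$, the harmonic extension of $g$ to $\Omega_f$ is the variational solution $\phi$ of $\Delta\phi=0$ in $\Omega_f$, $\phi(x,f(x))=g(x)$, that is, the $\phi\in\dot H^1(\Omega_f)$ with trace $g$ on the graph of $f$ (in the sense that $\frac1h\int_{\mathbb{T}}\int_{f(x)-h}^{f(x)}|\phi(x,y)-g(x)|\,dy\,dx\to0$ as $h\to0^+$) such that $\int_{\Omega_f}\nabla\phi\cdot\nabla\varphi\,dx\,dy=0$ for all $\varphi\in\dot H^1(\Omega_f)$ with zero trace; $\phi$ is taken to be the representative that is continuous in $\Omega_f$, and is given the values $g$ on the graph. If $f$ is differentiable at $x$ and $N(x)=(-f'(x),1)$, then $G(f)g$ is said to be classically well-defined at $x$ if the harmonic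 extension $\phi$ exists, and the limit $$\big(G(f)g\big)(x)=\lim_{h\to0^-}\frac1h\Big[\phi\big((x,f(x))+hN(x)\big)-\phi(x,f(x))\Big]$$ exists in $\mathbb{R}$ and does not depend on the choice of $\phi$. Finally, $f$ is $C^{1,1}$ at $x_0$ if there are $v\in\mathbb{R}$ and $M,\gamma>0$ with $|f(x)-f(x_0)-v(x-x_0)|\le M|x-x_0|^2$ whenever $|x-x_0|<\gamma$. **Proposition.** Let $f_1,f_2\in W^{1,\infty}(\mathbb{T})$ (that is, Lipschitz) be $C^{1,1}$ at $x_0$. If $f_1(x)\le f_2(x)$ for all $x\in\mathbb{T}$ and $f_1(x_0)=f_2(x_0)$, then $G(f_1)f_1$ and $G(f_2)f_2$ are classically well-defined at $x_0$, and $$\big(G(f_1)f_1\big)(x_0)\ge\big(G(f_2)f_2\big)(x_0).$$ -/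

import Mathlib

/-!
The plane is `ℂ`, the point `(x, y)` being `x + i y`, with Lebesgue measure and the real inner
product of `ℂ`. A function on the torus `ℝ / 2πℤ` is a `2π`-periodic function on `ℝ`, and a function
on `{(x, y) : x ∈ ℝ / 2πℤ, y < f x}` is a function on the lifted domain that is `2π`-periodic in `x`.
-/

namespace DirichletNeumann

open MeasureTheory Filter Topology

/-- `f` is `C^{1,1}` at the point `x₀`: it is within `M |x - x₀|²` of an affine function near `x₀`. -/
def IsC11At (f : ℝ → ℝ) (x₀ : ℝ) : Prop :=
  ∃ v M γ : ℝ, 0 < M ∧ 0 < γ ∧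
    ∀ x : ℝ, |x - x₀| < γ → |f x - f x₀ - v * (x - x₀)| ≤ M * |x - x₀| ^ 2

/-- The domain `{y < f x}` below the graph of `f`. -/
def domain (f : ℝ → ℝ) : Set ℂ := {z | z.im < f z.re}

/-- One period of the domain below the graph. -/
def cell (f : ℝ → ℝ) : Set ℂ := {z | z ∈ domain f ∧ 0 ≤ z.re ∧ z.re < 2 * Real.pi}

/-- The part of one period of the domain that lies above the graph of `f - h`. -/
def strip (f : ℝ → ℝ) (h : ℝ) : Set ℂ := {z | z ∈ cell f ∧ f z.re - h < z.im}

/-- `V` is the weak (distributional) gradient of `u` in the open set `U`; both are in `L¹_loc(U)`. -/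
structure HasWeakGradientOn (u : ℂ → ℝ) (V : ℂ → ℂ) (U : Set ℂ) : Prop where
  locallyIntegrable : LocallyIntegrableOn u U volume
  locallyIntegrable_grad : LocallyIntegrableOn V U volume
  integral_eq : ∀ ψ : ℂ → ℝ, ContDiff ℝ ((⊤ : ℕ∞) : WithTop ℕ∞) ψ → HasCompactSupport ψ →
    tsupport ψ ⊆ U → ∀ e : ℂ,
      ∫ z in U, u z * fderiv ℝ ψ z e = -∫ z in U, ψ z * inner ℝ (V z) e

/-- `u` belongs to the homogeneous Sobolev space `Ḣ¹` of the (horizontally periodic) domain below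
the graph of `f`, with weak gradient `V`: `u` is periodic, `u ∈ L¹_loc` and `V ∈ L²` (over a period).
Functions are kept, rather than classes modulo constants. -/
structure MemHdot1 (f : ℝ → ℝ) (u : ℂ → ℝ) (V : ℂ → ℂ) : Prop where
  periodic : ∀ z ∈ domain f, u (z + ((2 * Real.pi : ℝ) : ℂ)) = u z
  weakGradient : HasWeakGradientOn u V (domain f)
  memLp_grad : MemLp V 2 (volume.restrict (cell f))

/-- `u` has trace `g` on the graph of `f`: the mean of `|u(x, y) - g(x)|` over the strip
`f x - h < y < f x` tends to zero with its thickness `h`. -/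
def HasTrace (f : ℝ → ℝ) (u : ℂ → ℝ) (g : ℝ → ℝ) : Prop :=
  Tendsto (fun h : ℝ => (∫⁻ z in strip f h, ‖u z - g z.re‖ₑ) / ENNReal.ofReal h)
    (𝓝[>] 0) (𝓝 0)

/-- `φ` is the harmonic extension of `g` to the domain below the graph of `f`, i.e. the variational
solution of `Δφ = 0`, `φ = g` on the graph, `∇φ ∈ L²`. Among the representatives, which differ on
null sets, `φ` is the one that is continuous in the domain, and it takes the values `g` on the
graph. The test functions are all elements of `Ḣ¹` with zero trace. -/
structure IsHarmonicExtension (f g : ℝ → ℝ) (φ : ℂ → ℝ) : Prop where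
  continuousOn : ContinuousOn φ (domain f)
  boundary_eq : ∀ x : ℝ, φ ⟨x, f x⟩ = g x
  trace_eq : HasTrace f φ g
  variational : ∃ W : ℂ → ℂ, MemHdot1 f φ W ∧
    ∀ (u : ℂ → ℝ) (V : ℂ → ℂ), MemHdot1 f u V → HasTrace f u 0 →
      ∫ z in cell f, inner ℝ (W z) (V z) = 0

/-- The upward normal `N(x) = (-f'(x), 1)` to the graph of `f`. -/
noncomputable def normal (f : ℝ → ℝ) (x : ℝ) : ℂ := ⟨-deriv f x, 1⟩

/-- The difference quotient of `φ` at `(x, f x)` in the direction of the normal. -/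
noncomputable def normalQuotient (f : ℝ → ℝ) (φ : ℂ → ℝ) (x h : ℝ) : ℝ :=
  1 / h * (φ ((⟨x, f x⟩ : ℂ) + h • normal f x) - φ ⟨x, f x⟩)

/-- `G(f)g` is classically well-defined at `x` with value `a`: the normal at `x` makes sense,
`g` has a harmonic extension `φ`, and `∂_N φ (x, f x)`, the limit of the normal difference
quotients as `h → 0⁻`, exists and is `a` (whichever harmonic extension is taken). -/
structure HasDNValueAt (f g : ℝ → ℝ) (x a : ℝ) : Prop where
  differentiableAt : DifferentiableAt ℝ f x
  exists_extension : ∃ φ : ℂ → ℝ, IsHarmonicExtension f g φ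
  tendsto : ∀ φ : ℂ → ℝ, IsHarmonicExtension f g φ →
    Tendsto (normalQuotient f φ x) (𝓝[<] 0) (𝓝 a)

end DirichletNeumann

/-! The map `toDisc`, z ↦ exp(-iz), sends the periodic domain below the graph onto a bounded domain
punctured at 0, the puncture being the point y = -∞. Filled in, this domain is star-shaped about 0.
If g is its Riemann map with g(0) = 0, the Green function -log|g|, pulled back to z (`green`), is
nonnegative, harmonic below the graph, zero on the graph, and asymptotic to a constant minus y far
down. Hence `green` + y is the real part of a holomorphic function, has finite Dirichlet energy and
equals f on the graph: it is the harmonic extension of f. As the vertical component of N is 1,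
(G(f)f)(x₀) is 1 plus the normal derivative of the Green function at x₀.

Comparison is then the Schwarz lemma (`IsRiemannMap.norm_le_norm`). If f₁ ≤ f₂, the Riemann map of
the larger domain competes on the smaller one, so the two Green functions are ordered
(`green_le_green`). Both vanish at the common boundary point and the two normals there coincide;
difference quotients with h < 0 reverse the order.

The normal derivative exists because of the `C^{1,1}` condition. It gives a disc outside the image
domain touching its boundary at the image of the point; comparison with the exterior of that disc
makes the Green function O(|ζ|²) on a circle tangent to the graph from below (`exists_green_le_sq`).
In the Poisson formula on that circle the factor h comes out of the kernel, and the quadratic bound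
dominates the rest (`exists_tendsto_div_of_le_sq`).

It remains to identify the variational solution. The gradient of the potential need not be bounded
at the graph, so it is first translated downwards by δ. The translate is approximated by smooth
divergence-free fields vanishing far down, which are orthogonal to gradients of zero-trace functions
(`integral_cell_eq_zero_of_div_eq_zero`). Continuity of translations in L² gives δ → 0
(`integral_inner_eq_zero`). Uniqueness (`eq_potential`) is the usual energy argument: the difference
of two solutions has zero gradient, so it is a constant, and the trace forces that constant to be 0.
-/

namespace DirichletNeumann

open MeasureTheory Filter Topology Metric Set ComplexConjugate ENNReal

/-! ### Normal families, Hurwitz's theorem and holomorphic logarithms -/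

section

/-- A pointwise limit of a uniformly bounded sequence of holomorphic functions
is a locally uniform limit. -/
theorem tendstoLocallyUniformlyOn_of_pointwise {ι : Type*} {l : Filter ι} [l.NeBot] {U : Set ℂ}
    (hU : IsOpen U) {F : ι → ℂ → ℂ} {g : ℂ → ℂ} (hF : ∀ i, DifferentiableOn ℂ (F i) U)
    (hb : ∀ i, ∀ z ∈ U, ‖F i z‖ ≤ 1) (hg : ∀ z ∈ U, Tendsto (fun i => F i z) l (𝓝 (g z))) :
    TendstoLocallyUniformlyOn F g l U := by
  rw [Metric.tendstoLocallyUniformlyOn_iff]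
  intro ε hε x hx
  obtain ⟨r, hr, hrU⟩ := Metric.isOpen_iff.1 hU x hx
  -- The oscillation on the ball is at most 2, so the Schwarz lemma gives a Lipschitz bound at x
  -- independent of i. This equicontinuity upgrades pointwise to locally uniform convergence.
  have key : ∀ i, ∀ y ∈ ball x r, dist (F i y) (F i x) ≤ 2 / r * dist y x := by
    intro i y hy
    refine Complex.dist_le_div_mul_dist_of_mapsTo_ball ((hF i).mono hrU) ?_ hy
    intro z hz
    rw [mem_closedBall, dist_eq_norm]
    calc ‖F i z - F i x‖ ≤ ‖F i z‖ + ‖F i x‖ := norm_sub_le _ _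
      _ ≤ 2 := by linarith [hb i z (hrU hz), hb i x hx]
  have keyg : ∀ y ∈ ball x r, dist (g y) (g x) ≤ 2 / r * dist y x := fun y hy =>
    le_of_tendsto ((hg y (hrU hy)).dist (hg x hx)) (Eventually.of_forall fun i => key i y hy)
  refine ⟨ball x (min r (ε * r / 6)), mem_nhdsWithin_of_mem_nhds
    (ball_mem_nhds _ (by positivity)), ?_⟩
  filter_upwards [Metric.tendsto_nhds.1 (hg x hx) (ε / 3) (by positivity)] with i hi y hy
  have hy1 : y ∈ ball x r := ball_subset_ball (min_le_left _ _) hy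
  have hy2 : dist y x < ε * r / 6 := lt_of_lt_of_le hy (min_le_right _ _)
  have h3 : 2 / r * dist y x < ε / 3 := by
    calc 2 / r * dist y x < 2 / r * (ε * r / 6) := by gcongr
      _ = ε / 3 := by field_simp; norm_num
  calc dist (g y) (F i y) ≤ dist (g y) (g x) + dist (g x) (F i x) + dist (F i x) (F i y) :=
        dist_triangle4 _ _ _ _
    _ < ε / 3 + ε / 3 + ε / 3 := by
        linarith [key i y hy1, keyg y hy1, dist_comm (g x) (F i x), dist_comm (F i x) (F i y)]
    _ = ε := by ring

/-- **Montel's theorem** along an ultrafilter. -/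
theorem exists_tendstoLocallyUniformlyOn_ultrafilter {ι : Type*} (l : Ultrafilter ι) {U : Set ℂ}
    (hU : IsOpen U) {F : ι → ℂ → ℂ} (hF : ∀ i, DifferentiableOn ℂ (F i) U)
    (hb : ∀ i, ∀ z ∈ U, ‖F i z‖ ≤ 1) :
    ∃ g : ℂ → ℂ, TendstoLocallyUniformlyOn F g l U := by
  have h : ∀ z : ℂ, ∃ w : ℂ, z ∈ U → Tendsto (fun i => F i z) l (𝓝 w) := by
    intro z
    -- The values lie in the compact closed unit disc, so along an ultrafilter they converge at all
    -- points at once; no diagonal subsequence is extracted.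
    by_cases hz : z ∈ U
    · obtain ⟨w, -, hw⟩ := (isCompact_closedBall (0 : ℂ) 1).ultrafilter_le_nhds
        (l.map fun i => F i z) (by
          rw [Ultrafilter.coe_map, le_principal_iff]
          exact mem_map.2 (univ_mem' fun i => by simpa using hb i z hz))
      exact ⟨w, fun _ => hw⟩
    · exact ⟨0, fun h => absurd h hz⟩
  choose g hg using h
  exact ⟨g, tendstoLocallyUniformlyOn_of_pointwise hU hF hb hg⟩

/-- **Hurwitz's theorem**: a locally uniform limit of injective holomorphic functions on a
connected open set is injective as soon as its derivative is somewhere nonzero. -/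
theorem injOn_of_tendstoLocallyUniformlyOn {ι : Type*} {l : Filter ι} [l.NeBot] {U : Set ℂ}
    (hU : IsOpen U) (hUc : IsPreconnected U) {F : ι → ℂ → ℂ} {g : ℂ → ℂ}
    (hF : ∀ i, DifferentiableOn ℂ (F i) U) (hinj : ∀ i, InjOn (F i) U)
    (hg : TendstoLocallyUniformlyOn F g l U) {c : ℂ} (hc : c ∈ U) (hd : deriv g c ≠ 0) :
    InjOn g U := by
  intro a ha b hb hab
  by_contra hne
  have hgd : DifferentiableOn ℂ g U := hg.differentiableOn (Eventually.of_forall hF) hU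
  have han : AnalyticOnNhd ℂ (fun z => g z - g a) U :=
    ((hgd.sub_const _).analyticOnNhd hU)
  -- Either g - g(a) vanishes identically, which the nonzero derivative excludes, or b is an
  -- isolated zero.
  rcases (han b hb).eventually_eq_zero_or_eventually_ne_zero with h0 | h0
  · have := han.eqOn_zero_of_preconnected_of_eventuallyEq_zero hUc hb h0
    apply hd
    have h1 : g =ᶠ[𝓝 c] fun _ => g a := by
      filter_upwards [hU.mem_nhds hc] with z hz
      exact sub_eq_zero.1 (this hz)
    rw [h1.deriv_eq, deriv_const]
  rw [eventually_nhdsWithin_iff, Metric.eventually_nhds_iff_ball] at h0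
  obtain ⟨r₁, hr₁, h1⟩ := h0
  obtain ⟨r₂, hr₂, h2⟩ := Metric.isOpen_iff.1 hU b hb
  set r := min (min (r₁ / 2) (r₂ / 2)) (dist a b / 2) with hr
  have hdab : 0 < dist a b := dist_pos.2 hne
  have hr0 : 0 < r := by positivity
  have hrr₁ : r < r₁ := lt_of_le_of_lt ((min_le_left _ _).trans (min_le_left _ _)) (by linarith)
  have hrr₂ : r < r₂ := lt_of_le_of_lt ((min_le_left _ _).trans (min_le_right _ _)) (by linarith)
  have hrab : r < dist a b := lt_of_le_of_lt (min_le_right _ _) (by linarith)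
  have hsub : closedBall b r ⊆ U := (closedBall_subset_ball hrr₂).trans h2
  have hsph : sphere b r ⊆ U := sphere_subset_closedBall.trans hsub
  have hcomp : IsCompact (sphere b r) := isCompact_sphere b r
  obtain ⟨x, hx, hxmin⟩ := hcomp.exists_isMinOn (f := fun z => ‖g z - g a‖)
    (NormedSpace.sphere_nonempty.2 hr0.le) ((hgd.continuousOn.mono hsph).sub continuousOn_const).norm
  set m := ‖g x - g a‖ with hm
  have hm0 : 0 < m := by
    rw [hm, norm_pos_iff]
    refine h1 x (sphere_subset_ball hrr₁ hx) ?_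
    rintro rfl
    simp at hx
    exact hr0.ne hx
  have hga : Tendsto (fun i => F i a) l (𝓝 (g a)) := hg.tendsto_at ha
  have hgb : Tendsto (fun i => F i b) l (𝓝 (g b)) := hg.tendsto_at hb
  have hunif : TendstoUniformlyOn F g l (sphere b r) :=
    (tendstoLocallyUniformlyOn_iff_forall_isCompact hU).1 hg _ hsph hcomp
  -- Minimum principle in place of Rouché: a lies outside the closed ball, so by injectivity the
  -- reciprocal of F i - F i a is holomorphic there, and the lower bound on the circle passes to the
  -- centre b. In the limit it contradicts g(a) = g(b).
  have hev : ∀ᶠ i in l, m / 2 ≤ ‖F i b - F i a‖ := by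
    filter_upwards [Metric.tendstoUniformlyOn_iff.1 hunif (m / 4) (by positivity),
      Metric.tendsto_nhds.1 hga (m / 4) (by positivity)] with i hi hia
    have hlow : ∀ z ∈ sphere b r, m / 2 ≤ ‖F i z - F i a‖ := by
      intro z hz
      have h5 : m ≤ ‖g z - g a‖ := hxmin hz
      have h6 := hi z hz
      rw [dist_eq_norm] at h6 hia
      have : ‖g z - g a‖ ≤ ‖g z - F i z‖ + ‖F i z - F i a‖ + ‖F i a - g a‖ := by
        calc _ = ‖(g z - F i z) + (F i z - F i a) + (F i a - g a)‖ := by congr 1; ring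
          _ ≤ _ := norm_add₃_le
      linarith
    have hne0 : ∀ z ∈ closedBall b r, F i z - F i a ≠ 0 := by
      intro z hz h
      have : z = a := hinj i (hsub hz) ha (sub_eq_zero.1 h)
      rw [this, mem_closedBall] at hz
      linarith
    have hdiff : DiffContOnCl ℂ (fun z => (F i z - F i a)⁻¹) (ball b r) := by
      refine DifferentiableOn.diffContOnCl ?_
      rw [closure_ball b hr0.ne']
      exact (((hF i).mono hsub).sub_const _).inv hne0
    have := Complex.norm_le_of_forall_mem_frontier_norm_le isBounded_ball hdiff (C := (m / 2)⁻¹)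
      (by
        intro z hz
        rw [frontier_ball b hr0.ne'] at hz
        rw [norm_inv]
        exact inv_anti₀ (by positivity) (hlow z hz)) (subset_closure (mem_ball_self hr0))
    rw [norm_inv] at this
    exact (inv_le_inv₀ (norm_pos_iff.2 (hne0 b (mem_closedBall_self hr0.le))) (by positivity)).1 this
  have := ge_of_tendsto (hgb.sub hga).norm hev
  rw [hab, sub_self, norm_zero] at this
  linarith

/-- A continuous branch of the logarithm of a holomorphic function is holomorphic. -/
theorem differentiableOn_of_exp_eq {U : Set ℂ} (hU : IsOpen U) {f g : ℂ → ℂ}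
    (hf : ContinuousOn f U) (hg : DifferentiableOn ℂ g U) (h : ∀ z ∈ U, Complex.exp (f z) = g z) :
    DifferentiableOn ℂ f U := by
  intro x hx
  refine DifferentiableAt.differentiableWithinAt ?_
  have hc : ContinuousAt f x := hf.continuousAt (hU.mem_nhds hx)
  have hgx : DifferentiableAt ℂ g x := hg.differentiableAt (hU.mem_nhds hx)
  have hgx0 : g x ≠ 0 := by rw [← h x hx]; exact Complex.exp_ne_zero _
  -- Near x the imaginary part of f y - f x is below π in absolute value, so the principal logarithm
  -- recovers this difference.
  have hev : ∀ᶠ y in 𝓝 x, f y = f x + Complex.log (g y / g x) := by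
    have h1 : ∀ᶠ y in 𝓝 x, dist (f y) (f x) < Real.pi := Metric.tendsto_nhds.1 hc _ Real.pi_pos
    filter_upwards [h1, hU.mem_nhds hx] with y hy hyU
    rw [← h y hyU, ← h x hx, ← Complex.exp_sub]
    have h2 : |(f y - f x).im| < Real.pi :=
      lt_of_le_of_lt (Complex.abs_im_le_norm _) (by rwa [dist_eq_norm] at hy)
    rw [Complex.log_exp (abs_lt.1 h2).1 (abs_lt.1 h2).2.le]
    ring
  refine DifferentiableAt.congr_of_eventuallyEq ?_ hev
  refine (differentiableAt_const _).add ?_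
  refine DifferentiableAt.clog (hgx.div_const _) ?_
  rw [div_self hgx0]
  exact Complex.one_mem_slitPlane

theorem exists_differentiableOn_log {U : Set ℂ} (hU : IsOpen U) (hUc : IsSimplyConnected U)
    {g : ℂ → ℂ} (hg : DifferentiableOn ℂ g U) (h0 : ∀ z ∈ U, g z ≠ 0) :
    ∃ f : ℂ → ℂ, DifferentiableOn ℂ f U ∧ ∀ z ∈ U, Complex.exp (f z) = g z := by
  obtain ⟨f, hf, he⟩ := Complex.exists_continuousOn_eqOn_exp_comp hUc hU hg.continuousOn
    (by rintro ⟨z, hz, h⟩; exact h0 z hz h)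
  exact ⟨f, differentiableOn_of_exp_eq hU hf hg fun z hz => he hz, fun z hz => he hz⟩

end

/-! ### Möbius maps and the Riemann mapping theorem -/

section

/-- The Möbius transformation of the unit disc that sends `a` to `0`. -/
noncomputable def moebius (a z : ℂ) : ℂ := (z - a) / (1 - conj a * z)

theorem moebius_self (a : ℂ) : moebius a a = 0 := by simp [moebius]

theorem moebius_denom_ne_zero {a z : ℂ} (ha : ‖a‖ < 1) (hz : ‖z‖ ≤ 1) : 1 - conj a * z ≠ 0 := by
  intro h
  have h1 : ‖conj a * z‖ = 1 := by rw [← sub_eq_zero.1 h, norm_one]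
  rw [norm_mul, RCLike.norm_conj] at h1
  nlinarith [norm_nonneg a, norm_nonneg z]

/-- The identity |1 - āz|² - |z - a|² = (1 - |a|²)(1 - |z|²). It shows that the disc is preserved,
and later turns the Schwarz lemma into a quantitative bound near the boundary. -/
theorem one_sub_norm_moebius_sq {a z : ℂ} (ha : ‖a‖ < 1) (hz : ‖z‖ ≤ 1) :
    1 - ‖moebius a z‖ ^ 2 = (1 - ‖a‖ ^ 2) * (1 - ‖z‖ ^ 2) / ‖1 - conj a * z‖ ^ 2 := by
  have h := norm_ne_zero_iff.2 (moebius_denom_ne_zero ha hz)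
  rw [moebius, norm_div, div_pow, eq_div_iff (pow_ne_zero 2 h), sub_mul, one_mul,
    div_mul_cancel₀ _ (pow_ne_zero 2 h)]
  simp only [← Complex.normSq_eq_norm_sq, Complex.normSq_apply]
  simp
  ring

theorem norm_moebius_lt_one {a z : ℂ} (ha : ‖a‖ < 1) (hz : ‖z‖ < 1) : ‖moebius a z‖ < 1 := by
  have h := one_sub_norm_moebius_sq ha hz.le
  have hd := norm_pos_iff.2 (moebius_denom_ne_zero ha hz.le)
  have h1 : 0 < (1 - ‖a‖ ^ 2) * (1 - ‖z‖ ^ 2) / ‖1 - conj a * z‖ ^ 2 := by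
    have : 0 < 1 - ‖a‖ ^ 2 := by nlinarith [norm_nonneg a]
    have : 0 < 1 - ‖z‖ ^ 2 := by nlinarith [norm_nonneg z]
    positivity
  nlinarith [norm_nonneg (moebius a z)]

theorem moebius_injective {a z w : ℂ} (ha : ‖a‖ < 1) (hz : ‖z‖ < 1) (hw : ‖w‖ < 1)
    (h : moebius a z = moebius a w) : z = w := by
  rw [moebius, moebius, div_eq_div_iff (moebius_denom_ne_zero ha hz.le)
    (moebius_denom_ne_zero ha hw.le)] at h
  have h1 : (z - w) * (1 - conj a * a) = 0 := by linear_combination h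
  rcases mul_eq_zero.1 h1 with h2 | h2
  · exact sub_eq_zero.1 h2
  · exact absurd h2 (moebius_denom_ne_zero ha ha.le)

theorem hasDerivAt_moebius {a z : ℂ} (ha : ‖a‖ < 1) (hz : ‖z‖ ≤ 1) :
    HasDerivAt (moebius a) ((1 - conj a * a) / (1 - conj a * z) ^ 2) z := by
  have h1 : HasDerivAt (fun z : ℂ => z - a) 1 z := (hasDerivAt_id z).sub_const a
  have h2 : HasDerivAt (fun z : ℂ => 1 - conj a * z) (-(conj a)) z := by
    simpa using ((hasDerivAt_id z).const_mul (conj a)).const_sub 1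
  refine (h1.div h2 (moebius_denom_ne_zero ha hz)).congr_deriv ?_
  congr 1
  ring

theorem moebius_eq_zero_iff {a z : ℂ} (ha : ‖a‖ < 1) (hz : ‖z‖ < 1) :
    moebius a z = 0 ↔ z = a := by
  constructor
  · intro h
    exact moebius_injective ha hz ha (h.trans (moebius_self a).symm)
  · rintro rfl
    exact moebius_self _

/-- Injective holomorphic maps of `U` to the unit disc that fix `0`. -/
structure IsDiscEmbedding (U : Set ℂ) (g : ℂ → ℂ) : Prop where
  differentiableOn : DifferentiableOn ℂ g U
  injOn : InjOn g U
  norm_lt_one : ∀ z ∈ U, ‖g z‖ < 1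
  map_zero : g 0 = 0

/-- Cauchy's estimate; it makes the extremal problem for the derivative at 0 bounded. -/
theorem IsDiscEmbedding.norm_deriv_le {U : Set ℂ} {g : ℂ → ℂ} (hg : IsDiscEmbedding U g)
    {r : ℝ} (hr : 0 < r) (hrU : ball 0 r ⊆ U) : ‖deriv g 0‖ ≤ 1 / r := by
  refine Complex.norm_deriv_le_div_of_mapsTo_ball (hg.differentiableOn.mono hrU) ?_ hr
  intro z hz
  rw [hg.map_zero, mem_closedBall_zero_iff]
  exact (hg.norm_lt_one z (hrU hz)).le

/-- If a disc embedding omits a value, then some disc embedding has a larger derivative at `0`. -/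
theorem IsDiscEmbedding.exists_norm_deriv_lt {U : Set ℂ} (hU : IsOpen U)
    (hUc : IsSimplyConnected U) (h0 : (0 : ℂ) ∈ U) {g : ℂ → ℂ} (hg : IsDiscEmbedding U g)
    (hd : deriv g 0 ≠ 0) {a : ℂ} (ha : ‖a‖ < 1) (hag : ∀ z ∈ U, g z ≠ a) :
    ∃ k, IsDiscEmbedding U k ∧ ‖deriv g 0‖ < ‖deriv k 0‖ := by
  have hTd : DifferentiableOn ℂ (fun z => moebius a (g z)) U := fun z hz =>
    ((hasDerivAt_moebius ha (hg.norm_lt_one z hz).le).differentiableAt.comp_differentiableWithinAt z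
      (hg.differentiableOn z hz))
  obtain ⟨f, hf, hfe⟩ := exists_differentiableOn_log hU hUc hTd fun z hz h =>
    hag z hz ((moebius_eq_zero_iff ha (hg.norm_lt_one z hz)).1 h)
  -- Koebe's square root trick: as g omits a, the composite with the Möbius map has no zeros and so
  -- has a holomorphic square root, again injective.
  set q : ℂ → ℂ := fun z => Complex.exp (f z / 2) with hq
  have hqd : DifferentiableOn ℂ q U := (hf.div_const 2).cexp
  have hq2 : ∀ z ∈ U, q z ^ 2 = moebius a (g z) := by
    intro z hz
    rw [hq, ← hfe z hz, ← Complex.exp_nat_mul]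
    congr 1
    push_cast
    ring
  have hq1 : ∀ z ∈ U, ‖q z‖ < 1 := by
    intro z hz
    have h1 := norm_moebius_lt_one ha (hg.norm_lt_one z hz)
    rw [← hq2 z hz, norm_pow] at h1
    nlinarith [norm_nonneg (q z)]
  set b := q 0 with hb
  have hb1 : ‖b‖ < 1 := hq1 0 h0
  have hb0 : b ≠ 0 := Complex.exp_ne_zero _
  have hgd : HasDerivAt g (deriv g 0) 0 :=
    (hg.differentiableOn.differentiableAt (hU.mem_nhds h0)).hasDerivAt
  have hqd0 : HasDerivAt q (deriv q 0) 0 := (hqd.differentiableAt (hU.mem_nhds h0)).hasDerivAt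
  have hba : b ^ 2 = -a := by
    rw [hb, hq2 0 h0, hg.map_zero, moebius]
    simp
  have hq' : 2 * b * deriv q 0 = (1 - conj a * a) * deriv g 0 := by
    have e1 : HasDerivAt (fun z => q z ^ 2) (2 * b * deriv q 0) 0 := by
      refine (hqd0.fun_pow 2).congr_deriv ?_
      simp [hb]
    have e2 : HasDerivAt (fun z => moebius a (g z)) ((1 - conj a * a) * deriv g 0) 0 := by
      have := (hasDerivAt_moebius (z := g 0) ha (hg.norm_lt_one 0 h0).le).comp 0 hgd
      simpa [hg.map_zero, Function.comp_def] using this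
    refine e1.unique (e2.congr_of_eventuallyEq ?_)
    filter_upwards [hU.mem_nhds h0] with z hz using hq2 z hz
  refine ⟨fun z => moebius b (q z), ⟨?_, ?_, ?_, moebius_self b⟩, ?_⟩
  · exact fun z hz => ((hasDerivAt_moebius hb1 (hq1 z hz).le).differentiableAt.comp_differentiableWithinAt
      z (hqd z hz))
  · intro z hz w hw h
    have h1 := moebius_injective hb1 (hq1 z hz) (hq1 w hw) h
    have h2 : moebius a (g z) = moebius a (g w) := by rw [← hq2 z hz, ← hq2 w hw, h1]
    exact hg.injOn hz hw (moebius_injective ha (hg.norm_lt_one z hz) (hg.norm_lt_one w hw) h2)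
  · exact fun z hz => norm_moebius_lt_one hb1 (hq1 z hz)
  · have hk : HasDerivAt (fun z => moebius b (q z)) ((1 - conj b * b)⁻¹ * deriv q 0) 0 := by
      have := (hasDerivAt_moebius (z := q 0) hb1 hb1.le).comp 0 hqd0
      have hne := moebius_denom_ne_zero hb1 hb1.le
      refine this.congr_deriv ?_
      rw [← hb]
      field_simp
    rw [hk.deriv, norm_mul, norm_inv]
    have hcb : ∀ c : ℂ, ‖c‖ < 1 → ‖1 - conj c * c‖ = 1 - ‖c‖ ^ 2 := by
      intro c hc
      rw [mul_comm, Complex.mul_conj, Complex.normSq_eq_norm_sq, ← Complex.ofReal_one,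
        ← Complex.ofReal_sub, Complex.norm_real, Real.norm_of_nonneg]
      nlinarith [norm_nonneg c]
    have hna : ‖a‖ = ‖b‖ ^ 2 := by rw [← norm_neg a, ← hba, norm_pow]
    have h2 := congrArg norm hq'
    rw [norm_mul, norm_mul, norm_mul, hcb a ha, hna, Complex.norm_two] at h2
    rw [hcb b hb1]
    have hbpos : 0 < ‖b‖ := norm_pos_iff.2 hb0
    have hgpos : 0 < ‖deriv g 0‖ := norm_pos_iff.2 hd
    have hpos : 0 < 1 - ‖b‖ ^ 2 := by nlinarith
    rw [← div_eq_inv_mul, lt_div_iff₀ hpos]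
    -- With |a| = |b|², differentiating q² at 0 gives 2|b||q'(0)| = (1 - |b|⁴)|g'(0)|. The gain
    -- factor (1 + |b|²)/(2|b|) exceeds 1 because (1 - |b|)² > 0.
    have h3 : 2 * ‖b‖ * (‖deriv q 0‖ - ‖deriv g 0‖ * (1 - ‖b‖ ^ 2)) =
        ‖deriv g 0‖ * (1 - ‖b‖ ^ 2) * (1 - ‖b‖) ^ 2 := by linear_combination h2
    have h4 : 0 < ‖deriv g 0‖ * (1 - ‖b‖ ^ 2) * (1 - ‖b‖) ^ 2 := by
      have : 0 < 1 - ‖b‖ := by linarith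
      positivity
    rw [← h3] at h4
    have h5 : 0 < 2 * ‖b‖ := by positivity
    linarith [(pos_iff_pos_of_mul_pos h4).1 h5]

/-- `g` is the Riemann map of `U` onto the unit disc, up to a rotation. -/
structure IsRiemannMap (U : Set ℂ) (g : ℂ → ℂ) : Prop extends IsDiscEmbedding U g where
  deriv_ne_zero : deriv g 0 ≠ 0
  image_eq : g '' U = ball 0 1

/-- **Riemann mapping theorem** for bounded domains that contain the origin. -/
theorem exists_riemannMap {U : Set ℂ} (hU : IsOpen U) (hUc : IsSimplyConnected U)
    (h0 : (0 : ℂ) ∈ U) (hUb : Bornology.IsBounded U) :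
    ∃ g, IsRiemannMap U g := by
  obtain ⟨r, hr, hrU⟩ := Metric.isOpen_iff.1 hU 0 h0
  -- The Riemann map maximizes |g'(0)| among disc embeddings. The scaling z/M is a competitor with
  -- nonzero derivative, so the supremum is positive and the limit map is not constant.
  set D : Set ℝ := {d | ∃ g, IsDiscEmbedding U g ∧ ‖deriv g 0‖ = d} with hD
  have hDb : BddAbove D := ⟨1 / r, by rintro _ ⟨g, hg, rfl⟩; exact hg.norm_deriv_le hr hrU⟩
  obtain ⟨M, hM, hUM⟩ := hUb.exists_pos_norm_lt
  have hid : IsDiscEmbedding U fun z => z / M := by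
    refine ⟨by fun_prop, ?_, ?_, by simp⟩
    · intro z _ w _ h
      have : (M : ℂ) ≠ 0 := by exact_mod_cast hM.ne'
      field_simp at h
      exact h
    · intro z hz
      rw [norm_div, Complex.norm_real, Real.norm_of_nonneg hM.le, div_lt_one hM]
      exact hUM z hz
  have hidD : M⁻¹ ∈ D := by
    refine ⟨_, hid, ?_⟩
    rw [deriv_div_const, deriv_id'', norm_div, norm_one, Complex.norm_real,
      Real.norm_of_nonneg hM.le, one_div]
  obtain ⟨d, -, hdt, hdD⟩ := exists_seq_tendsto_sSup ⟨_, hidD⟩ hDb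
  choose F hF hFd using hdD
  have hS0 : 0 < sSup D := lt_of_lt_of_le (by positivity) (le_csSup hDb hidD)
  obtain ⟨g, hg⟩ := exists_tendstoLocallyUniformlyOn_ultrafilter (hyperfilter ℕ) hU
    (fun n => (hF n).differentiableOn) (fun n z hz => ((hF n).norm_lt_one z hz).le)
  have hgd : DifferentiableOn ℂ g U :=
    hg.differentiableOn (Eventually.of_forall fun n => (hF n).differentiableOn) hU
  have hle : (hyperfilter ℕ : Filter ℕ) ≤ atTop := Nat.hyperfilter_le_atTop
  have hdg : ‖deriv g 0‖ = sSup D := by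
    have h1 := ((hg.deriv (Eventually.of_forall fun n => (hF n).differentiableOn) hU).tendsto_at
      h0).norm
    have h2 := hdt.mono_left hle
    refine tendsto_nhds_unique h1 (h2.congr fun n => ?_)
    rw [← hFd n, Function.comp_apply]
  have hg0 : g 0 = 0 :=
    tendsto_nhds_unique (hg.tendsto_at h0) (by simpa only [(hF _).map_zero] using tendsto_const_nhds)
  have hdg0 : deriv g 0 ≠ 0 := norm_pos_iff.1 (hdg ▸ hS0)
  have hinj : InjOn g U := injOn_of_tendstoLocallyUniformlyOn hU
    hUc.isPathConnected.isConnected.isPreconnected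
    (fun n => (hF n).differentiableOn) (fun n => (hF n).injOn) hg h0 hdg0
  have hg1 : ∀ z ∈ U, ‖g z‖ ≤ 1 := fun z hz => le_of_tendsto (hg.tendsto_at hz).norm
    (Eventually.of_forall fun n => ((hF n).norm_lt_one z hz).le)
  have hemb : IsDiscEmbedding U g := by
    -- The limit only inherits |g| ≤ 1; attaining 1 inside would make g constant by the maximum
    -- principle.
    refine ⟨hgd, hinj, fun z hz => lt_of_le_of_ne (hg1 z hz) fun h => hdg0 ?_, hg0⟩
    have hmax : IsMaxOn (norm ∘ g) U z := fun y hy => by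
      simpa [h] using hg1 y hy
    have := Complex.eqOn_of_isPreconnected_of_isMaxOn_norm
      hUc.isPathConnected.isConnected.isPreconnected hU hgd hz hmax
    have h1 : g =ᶠ[𝓝 0] fun _ => g z := by
      filter_upwards [hU.mem_nhds h0] with y hy using this hy
    rw [h1.deriv_eq, deriv_const]
  refine ⟨g, hemb, hdg0, Subset.antisymm ?_ ?_⟩
  · rintro _ ⟨z, hz, rfl⟩
    simpa using hemb.norm_lt_one z hz
  -- An omitted value would yield a disc embedding with a derivative beyond the supremum.
  · intro a ha
    by_contra hna
    obtain ⟨k, hk, hlt⟩ := hemb.exists_norm_deriv_lt hU hUc h0 hdg0 (by simpa using ha)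
      fun z hz h => hna ⟨z, hz, h⟩
    have := le_csSup hDb ⟨k, hk, rfl⟩
    linarith

end

/-! ### Schwarz lemma and Dirichlet energy on a simply connected domain -/

section

namespace IsRiemannMap

variable {U : Set ℂ} {g : ℂ → ℂ}

/-- The inverse of g is continuous by the open mapping theorem, so the sublevel set is the image of
a closed disc. This says that |g| → 1 at the boundary, whatever the boundary looks like. -/
theorem isCompact_sublevel (hg : IsRiemannMap U g) (hU : IsOpen U) (hUc : IsPreconnected U)
    (h0 : (0 : ℂ) ∈ U) {r : ℝ} (hr : r < 1) : IsCompact {z ∈ U | ‖g z‖ ≤ r} := by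
  have hbij : BijOn g U (ball 0 1) := hg.image_eq ▸ hg.injOn.bijOn_image
  set k := Function.invFunOn g U with hk
  have hinv : InvOn k g U (ball 0 1) := hbij.invOn_invFunOn
  have hmaps : MapsTo k (ball 0 1) U := hbij.surjOn.mapsTo_invFunOn
  have hopen : ∀ s ⊆ U, IsOpen s → IsOpen (g '' s) := by
    rcases (hg.differentiableOn.analyticOnNhd hU).is_constant_or_isOpen hUc with ⟨w, hw⟩ | h
    · exfalso
      apply hg.deriv_ne_zero
      have h1 : g =ᶠ[𝓝 0] fun _ => w := by
        filter_upwards [hU.mem_nhds h0] with z hz using hw z hz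
      rw [h1.deriv_eq, deriv_const]
    · exact h
  have hkc : ContinuousOn k (ball 0 1) := by
    rw [continuousOn_open_iff isOpen_ball]
    intro t ht
    have : ball 0 1 ∩ k ⁻¹' t = g '' (t ∩ U) := by
      ext w
      constructor
      · rintro ⟨hw, hwt⟩
        exact ⟨k w, ⟨hwt, hmaps hw⟩, hinv.2 hw⟩
      · rintro ⟨z, ⟨hzt, hzU⟩, rfl⟩
        exact ⟨hbij.mapsTo hzU, by rwa [mem_preimage, hinv.1 hzU]⟩
    rw [this]
    exact hopen _ inter_subset_right (ht.inter hU)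
  have hsub : closedBall (0 : ℂ) r ⊆ ball 0 1 := closedBall_subset_ball hr
  have : {z ∈ U | ‖g z‖ ≤ r} = k '' closedBall 0 r := by
    ext z
    constructor
    · rintro ⟨hz, hzr⟩
      exact ⟨g z, by simpa using hzr, hinv.1 hz⟩
    · rintro ⟨w, hw, rfl⟩
      refine ⟨hmaps (hsub hw), ?_⟩
      rw [hinv.2 (hsub hw)]
      simpa using hw
  rw [this]
  exact (isCompact_closedBall 0 r).image_of_continuousOn (hkc.mono hsub)

theorem ne_zero (hg : IsRiemannMap U g) (h0 : (0 : ℂ) ∈ U) {z : ℂ} (hz : z ∈ U) (hz0 : z ≠ 0) :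
    g z ≠ 0 := fun h => hz0 (hg.injOn hz h0 (h.trans hg.map_zero.symm))

theorem mul_dslope (hg : IsRiemannMap U g) (z : ℂ) : z * dslope g 0 z = g z := by
  have := sub_smul_dslope g 0 z
  simpa [hg.map_zero] using this

/-- Injectivity excludes zeros away from 0, and g'(0) ≠ 0 excludes the origin. Consequently g(z)/z
has a holomorphic logarithm. -/
theorem dslope_ne_zero (hg : IsRiemannMap U g) (h0 : (0 : ℂ) ∈ U) {z : ℂ} (hz : z ∈ U) :
    dslope g 0 z ≠ 0 := by
  by_cases hz0 : z = 0
  · rw [hz0, dslope_same]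
    exact hg.deriv_ne_zero
  · intro h
    apply hg.ne_zero h0 hz hz0
    rw [← hg.mul_dslope, h, mul_zero]

/-- **Schwarz lemma** on a simply connected domain. -/
theorem norm_le_norm (hg : IsRiemannMap U g) (hU : IsOpen U) (hUc : IsPreconnected U)
    (hUb : Bornology.IsBounded U)
    (h0 : (0 : ℂ) ∈ U) {k : ℂ → ℂ} (hk : DifferentiableOn ℂ k U) (hk1 : ∀ z ∈ U, ‖k z‖ ≤ 1)
    (hk0 : k 0 = 0) {z : ℂ} (hz : z ∈ U) : ‖k z‖ ≤ ‖g z‖ := by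
  have hkd : DifferentiableOn ℂ (dslope k 0) U :=
    (Complex.differentiableOn_dslope (hU.mem_nhds h0)).2 hk
  have hgd : DifferentiableOn ℂ (dslope g 0) U :=
    (Complex.differentiableOn_dslope (hU.mem_nhds h0)).2 hg.differentiableOn
  -- The quotient k/g with its singularity at 0 removed.
  set q : ℂ → ℂ := fun z => dslope k 0 z / dslope g 0 z with hq
  have hqd : DifferentiableOn ℂ q U := hkd.div hgd fun z hz => hg.dslope_ne_zero h0 hz
  have hqk : ∀ z ∈ U, q z * g z = k z := by
    intro z hz
    have h1 : z * dslope k 0 z = k z := by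
      have := sub_smul_dslope k 0 z
      simpa [hk0] using this
    rw [← hg.mul_dslope, ← h1, hq]
    field_simp [hg.dslope_ne_zero h0 hz]
  have hgc : ContinuousOn (fun z => ‖g z‖) U := hg.differentiableOn.continuousOn.norm
  -- On the frontier of {|g| < r} one has |g| = r, hence |q| ≤ 1/r there; the maximum principle
  -- carries this inside, and then r → 1.
  have key : ∀ r, ‖g z‖ < r → r < 1 → ‖q z‖ ≤ r⁻¹ := by
    intro r hr hr1
    have hr0 : 0 < r := (norm_nonneg _).trans_lt hr
    set V : Set ℂ := {w ∈ U | ‖g w‖ < r} with hV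
    have hVo : IsOpen V := hgc.isOpen_inter_preimage hU isOpen_Iio
    have hcl : closure V ⊆ {z ∈ U | ‖g z‖ ≤ r} :=
      closure_minimal (fun w hw => ⟨hw.1, hw.2.le⟩)
        (hg.isCompact_sublevel hU hUc h0 hr1).isClosed
    refine Complex.norm_le_of_forall_mem_frontier_norm_le (hUb.subset fun w hw => hw.1)
      (hqd.mono fun w hw => (hcl hw).1).diffContOnCl ?_ (subset_closure ⟨hz, hr⟩)
    intro w hw
    have hwU : w ∈ U := (hcl hw.1).1
    have hgw : ‖g w‖ = r := by
      refine le_antisymm (hcl hw.1).2 (not_lt.1 fun h => hw.2 ?_)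
      rw [hVo.interior_eq]
      exact ⟨hwU, h⟩
    have h2 := hk1 w hwU
    rw [← hqk w hwU, norm_mul, hgw] at h2
    rwa [← one_div, le_div_iff₀ hr0]
  have hq1 : ‖q z‖ ≤ 1 := by
    have hlt := hg.norm_lt_one z hz
    have ht : Tendsto (fun r : ℝ => r⁻¹) (𝓝[<] 1) (𝓝 1) := by
      have : ContinuousAt (fun r : ℝ => r⁻¹) 1 := continuousAt_inv₀ one_ne_zero
      simpa using this.tendsto.mono_left nhdsWithin_le_nhds
    refine ge_of_tendsto ht ?_
    filter_upwards [Ioo_mem_nhdsLT hlt] with r hr using key r hr.1 hr.2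
  rw [← hqk z hz, norm_mul]
  exact mul_le_of_le_one_left (norm_nonneg _) hq1

end IsRiemannMap

theorem abs_det_smul_one (a : ℂ) : |(a • (1 : ℂ →L[ℝ] ℂ)).det| = ‖a‖ ^ 2 := by
  have : (a • (1 : ℂ →L[ℝ] ℂ)).det = Algebra.norm ℝ a := by
    rw [Algebra.norm_apply]
    rfl
  rw [this, Algebra.norm_complex_apply, Complex.normSq_eq_norm_sq, abs_of_nonneg (by positivity)]

/-- Change of variables under an injective holomorphic map. -/
theorem lintegral_image_eq_of_injOn {s : Set ℂ} (hs : MeasurableSet s) {g : ℂ → ℂ}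
    (hg : ∀ z ∈ s, DifferentiableAt ℂ g z) (hinj : InjOn g s) (F : ℂ → ℝ≥0∞) :
    ∫⁻ w in g '' s, F w = ∫⁻ z in s, ‖deriv g z‖ₑ ^ 2 * F (g z) := by
  rw [lintegral_image_eq_lintegral_abs_det_fderiv_mul volume hs
    (f' := fun z => deriv g z • (1 : ℂ →L[ℝ] ℂ))
    (fun z hz => (hg z hz).hasDerivAt.complexToReal_fderiv.hasFDerivWithinAt) hinj]
  refine lintegral_congr fun z => ?_
  rw [abs_det_smul_one, ENNReal.ofReal_pow (norm_nonneg _), ofReal_norm]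

namespace IsRiemannMap

variable {U : Set ℂ} {g L : ℂ → ℂ}

/-- The integral is the area of the image, the unit disc. -/
theorem lintegral_deriv_sq_lt_top (hg : IsRiemannMap U g) (hU : IsOpen U) :
    ∫⁻ z in U, ‖deriv g z‖ₑ ^ 2 < ∞ := by
  have := lintegral_image_eq_of_injOn hU.measurableSet
    (fun z hz => hg.differentiableOn.differentiableAt (hU.mem_nhds hz)) hg.injOn (fun _ => 1)
  simp only [mul_one, lintegral_one, hg.image_eq] at this
  rw [← this, Measure.restrict_apply_univ]
  exact measure_ball_lt_top

/-- The logarithm of `g z / z` has finite Dirichlet energy. -/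
theorem lintegral_deriv_log_sq_lt_top (hg : IsRiemannMap U g) (hU : IsOpen U)
    (hUc : IsPreconnected U) (hUb : Bornology.IsBounded U) (h0 : (0 : ℂ) ∈ U)
    (hL : DifferentiableOn ℂ L U) (hexp : ∀ z ∈ U, Complex.exp (L z) = dslope g 0 z) :
    ∫⁻ z in U, ‖deriv L z‖ₑ ^ 2 < ∞ := by
  set K : Set ℂ := {z ∈ U | ‖g z‖ ≤ 1 / 2} with hK
  have hKc : IsCompact K := hg.isCompact_sublevel hU hUc h0 (by norm_num)
  have hKU : K ⊆ U := fun z hz => hz.1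
  obtain ⟨C, hC⟩ := hKc.exists_bound_of_continuousOn
    ((hL.analyticOnNhd hU).deriv.continuousOn.mono hKU)
  have hKnhds : K ∈ 𝓝 (0 : ℂ) := by
    have h1 : ContinuousAt (fun z => ‖g z‖) 0 :=
      (hg.differentiableOn.continuousOn.continuousAt (hU.mem_nhds h0)).norm
    have h2 : ∀ᶠ z in 𝓝 (0 : ℂ), ‖g z‖ < 1 / 2 :=
      h1.eventually_lt_const (by simp [hg.map_zero])
    filter_upwards [h2, hU.mem_nhds h0] with z h3 h4 using ⟨h4, h3.le⟩
  obtain ⟨ρ, hρ, hρK⟩ := Metric.mem_nhds_iff.1 hKnhds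
  -- On the compact set |g| ≤ 1/2 the derivative of L is bounded by C. Off it L' = g'/g - 1/z with
  -- |g| > 1/2 and |z| ≥ ρ, so |L'| ≤ 2|g'| + 1/ρ.
  have hbound : ∀ z ∈ U, ‖deriv L z‖ ^ 2 ≤ C ^ 2 + 2 * (1 / ρ ^ 2) + 8 * ‖deriv g z‖ ^ 2 := by
    intro z hz
    by_cases hzK : z ∈ K
    · have h1 := hC z hzK
      have : ‖deriv L z‖ ^ 2 ≤ C ^ 2 := by gcongr
      have : 0 ≤ 2 * (1 / ρ ^ 2) + 8 * ‖deriv g z‖ ^ 2 := by positivity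
      linarith
    · have hgz : 1 / 2 < ‖g z‖ := not_le.1 fun h => hzK ⟨hz, h⟩
      have hzρ : ρ ≤ ‖z‖ := not_lt.1 fun h => hzK (hρK (by simpa using h))
      have hz0 : z ≠ 0 := norm_pos_iff.1 (hρ.trans_le hzρ)
      have hLd := (hL.differentiableAt (hU.mem_nhds hz)).hasDerivAt
      have e1 : HasDerivAt (fun z => z * Complex.exp (L z))
          (1 * Complex.exp (L z) + z * (Complex.exp (L z) * deriv L z)) z :=
        (hasDerivAt_id z).mul hLd.cexp
      have e2 : deriv g z = 1 * Complex.exp (L z) + z * (Complex.exp (L z) * deriv L z) := by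
        refine (e1.congr_of_eventuallyEq ?_).deriv
        filter_upwards [hU.mem_nhds hz] with y hy
        rw [hexp y hy, hg.mul_dslope]
      have e3 : z * Complex.exp (L z) = g z := by rw [hexp z hz, hg.mul_dslope]
      have hg0 := hg.ne_zero h0 hz hz0
      have e4 : deriv L z = deriv g z / g z - 1 / z := by
        rw [e2, ← e3]
        have := Complex.exp_ne_zero (L z)
        field_simp
        ring
      have h5 : ‖deriv g z / g z‖ ≤ 2 * ‖deriv g z‖ := by
        rw [norm_div, div_le_iff₀ (by linarith)]
        nlinarith [norm_nonneg (deriv g z)]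
      have h6 : ‖1 / z‖ ≤ 1 / ρ := by
        rw [norm_div, norm_one]
        exact one_div_le_one_div_of_le hρ hzρ
      have h7 : ‖deriv L z‖ ≤ 2 * ‖deriv g z‖ + 1 / ρ := by
        rw [e4]
        exact (norm_sub_le _ _).trans (add_le_add h5 h6)
      have h8 : ‖deriv L z‖ ^ 2 ≤ (2 * ‖deriv g z‖ + 1 / ρ) ^ 2 := by gcongr
      have h9 : 1 / ρ ^ 2 = (1 / ρ) ^ 2 := by rw [one_div_pow]
      rw [h9]
      nlinarith [sq_nonneg (2 * ‖deriv g z‖ - 1 / ρ), sq_nonneg C]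
  have hbound' : ∀ z ∈ U, ‖deriv L z‖ₑ ^ 2 ≤
      ENNReal.ofReal (C ^ 2 + 2 * (1 / ρ ^ 2)) + 8 * ‖deriv g z‖ₑ ^ 2 := by
    intro z hz
    have h1 := ENNReal.ofReal_le_ofReal (hbound z hz)
    rw [ENNReal.ofReal_add (by positivity) (by positivity), ENNReal.ofReal_mul (by norm_num),
      ENNReal.ofReal_pow (norm_nonneg _), ENNReal.ofReal_pow (norm_nonneg _),
      ofReal_norm, ofReal_norm] at h1
    simpa using h1
  calc ∫⁻ z in U, ‖deriv L z‖ₑ ^ 2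
      ≤ ∫⁻ z in U, (ENNReal.ofReal (C ^ 2 + 2 * (1 / ρ ^ 2)) + 8 * ‖deriv g z‖ₑ ^ 2) :=
        setLIntegral_mono' hU.measurableSet hbound'
    _ = ENNReal.ofReal (C ^ 2 + 2 * (1 / ρ ^ 2)) * volume U
        + 8 * ∫⁻ z in U, ‖deriv g z‖ₑ ^ 2 := by
        rw [lintegral_add_left measurable_const, lintegral_const, Measure.restrict_apply_univ,
          lintegral_const_mul' _ _ (by norm_num)]
    _ < ∞ := ENNReal.add_lt_top.2 ⟨ENNReal.mul_lt_top ENNReal.ofReal_lt_top hUb.measure_lt_top,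
        ENNReal.mul_lt_top (by norm_num) (hg.lintegral_deriv_sq_lt_top hU)⟩

end IsRiemannMap

end

/-! ### From the periodic domain to a bounded star-shaped domain -/

section

/-- The covering `z ↦ exp (-i z)` of the punctured plane. -/
noncomputable def toDisc (z : ℂ) : ℂ := Complex.exp (-(Complex.I * z))

theorem norm_toDisc (z : ℂ) : ‖toDisc z‖ = Real.exp z.im := by
  simp [toDisc, Complex.norm_exp]

theorem toDisc_ne_zero (z : ℂ) : toDisc z ≠ 0 := Complex.exp_ne_zero _

theorem toDisc_eq_iff {z w : ℂ} :
    toDisc z = toDisc w ↔ ∃ n : ℤ, z = w + n * ((2 * Real.pi : ℝ) : ℂ) := by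
  rw [toDisc, toDisc, Complex.exp_eq_exp_iff_exists_int]
  constructor
  · rintro ⟨n, hn⟩
    refine ⟨-n, ?_⟩
    have h : Complex.I * (z - (w - n * (2 * Real.pi))) = 0 := by linear_combination -hn
    rcases mul_eq_zero.1 h with h | h
    · exact absurd h Complex.I_ne_zero
    · push_cast
      linear_combination h
  · rintro ⟨n, rfl⟩
    refine ⟨-n, ?_⟩
    push_cast
    ring

theorem toDisc_add_period (z : ℂ) : toDisc (z + ((2 * Real.pi : ℝ) : ℂ)) = toDisc z :=
  toDisc_eq_iff.2 ⟨1, by simp⟩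

theorem hasDerivAt_toDisc (z : ℂ) : HasDerivAt toDisc (-Complex.I * toDisc z) z := by
  have h : HasDerivAt (fun z => -(Complex.I * z)) (-Complex.I) z := by
    simpa using ((hasDerivAt_id' z).const_mul Complex.I).fun_neg
  exact h.cexp.congr_deriv (by rw [toDisc]; ring)

theorem continuous_toDisc : Continuous toDisc := by unfold toDisc; fun_prop

/-- The image of the domain below the graph of `f` under `z ↦ exp (-i z)`, with the origin. -/
def discDomain (f : ℝ → ℝ) : Set ℂ := insert 0 (toDisc '' domain f)

theorem zero_mem_discDomain (f : ℝ → ℝ) : (0 : ℂ) ∈ discDomain f := mem_insert _ _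

section periodic

variable {f : ℝ → ℝ}

theorem exists_bounds (hf : Continuous f) (hper : Function.Periodic f (2 * Real.pi)) :
    ∃ M, ∀ x, |f x| ≤ M := by
  obtain ⟨M, hM⟩ := (isCompact_Icc (a := 0) (b := 2 * Real.pi)).exists_bound_of_continuousOn
    hf.continuousOn
  refine ⟨M, fun x => ?_⟩
  obtain ⟨y, hy, hxy⟩ := hper.exists_mem_Ico₀ Real.two_pi_pos x
  rw [hxy]
  exact hM y (Ico_subset_Icc_self hy)

theorem isOpen_domain (hf : Continuous f) : IsOpen (domain f) :=
  isOpen_lt Complex.continuous_im (hf.comp Complex.continuous_re)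

theorem add_int_period_mem_domain (hper : Function.Periodic f (2 * Real.pi)) (z : ℂ) (n : ℤ) :
    z + n * ((2 * Real.pi : ℝ) : ℂ) ∈ domain f ↔ z ∈ domain f := by
  have h1 : (z + n * ((2 * Real.pi : ℝ) : ℂ)).re = z.re + n * (2 * Real.pi) := by
    simp
  have h2 : (z + n * ((2 * Real.pi : ℝ) : ℂ)).im = z.im := by
    simp
  simp only [domain, mem_ofPred_eq, h1, h2, hper.int_mul n z.re]

theorem add_period_mem_domain (hper : Function.Periodic f (2 * Real.pi)) (z : ℂ) :
    z + ((2 * Real.pi : ℝ) : ℂ) ∈ domain f ↔ z ∈ domain f := by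
  simpa using add_int_period_mem_domain hper z 1

theorem toDisc_mem_discDomain (hper : Function.Periodic f (2 * Real.pi)) {z : ℂ} :
    toDisc z ∈ discDomain f ↔ z ∈ domain f := by
  refine ⟨?_, fun h => mem_insert_of_mem _ (mem_image_of_mem _ h)⟩
  rintro (h | ⟨w, hw, h⟩)
  · exact absurd h (toDisc_ne_zero z)
  · obtain ⟨n, rfl⟩ := toDisc_eq_iff.1 h
    exact (add_int_period_mem_domain hper z n).1 hw

theorem toDisc_surj {w : ℂ} (hw : w ≠ 0) : ∃ z, toDisc z = w := by
  refine ⟨Complex.I * Complex.log w, ?_⟩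
  rw [toDisc, ← mul_assoc, Complex.I_mul_I, neg_one_mul, neg_neg, Complex.exp_log hw]

theorem ball_subset_discDomain {m : ℝ} (hm : ∀ x, m ≤ f x) :
    ball 0 (Real.exp m) ⊆ discDomain f := by
  intro w hw
  by_cases h0 : w = 0
  · rw [h0]; exact zero_mem_discDomain f
  · obtain ⟨z, rfl⟩ := toDisc_surj h0
    rw [mem_ball_zero_iff, norm_toDisc, Real.exp_lt_exp] at hw
    exact mem_insert_of_mem _ (mem_image_of_mem _ (hw.trans_le (hm _)))

/-- At the added origin a whole disc is contained, because f is bounded below; elsewhere the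
exponential is an open map. -/
theorem isOpen_discDomain (hf : Continuous f) (hper : Function.Periodic f (2 * Real.pi)) :
    IsOpen (discDomain f) := by
  obtain ⟨M, hM⟩ := exists_bounds hf hper
  have h1 : ball 0 (Real.exp (-M)) ⊆ discDomain f :=
    ball_subset_discDomain fun x => (abs_le.1 (hM x)).1
  have h2 : IsOpen (toDisc '' domain f) := by
    have : toDisc = Complex.exp ∘ fun z => (-Complex.I) * z := by
      ext z; simp [toDisc]
    rw [this, image_comp]
    apply Complex.isOpenMap_exp
    exact (Homeomorph.mulLeft₀ (-Complex.I) (by simp)).isOpenMap _ (isOpen_domain hf)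
  have h3 : discDomain f = ball 0 (Real.exp (-M)) ∪ toDisc '' domain f := by
    apply Subset.antisymm
    · rintro w (rfl | hw)
      · exact Or.inl (mem_ball_self (Real.exp_pos _))
      · exact Or.inr hw
    · exact union_subset h1 (subset_insert _ _)
  rw [h3]
  exact isOpen_ball.union h2

/-- Scaling by t in (0, 1] is the image of the translation by i log t, which points downwards and so
preserves the domain below a graph. -/
theorem starConvex_discDomain : StarConvex ℝ 0 (discDomain f) := by
  rw [starConvex_zero_iff]
  rintro w hw t ht0 ht1
  rcases ht0.eq_or_lt with rfl | ht0
  · rw [zero_smul]; exact zero_mem_discDomain f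
  rcases hw with rfl | ⟨z, hz, rfl⟩
  · rw [smul_zero]; exact zero_mem_discDomain f
  refine mem_insert_of_mem _ ⟨z + Real.log t * Complex.I, ?_, ?_⟩
  · have : Real.log t ≤ 0 := Real.log_nonpos ht0.le ht1
    have hz' : z.im < f z.re := hz
    simp only [domain, mem_ofPred_eq]
    simp
    linarith
  · rw [toDisc, toDisc, Complex.real_smul]
    have : -(Complex.I * (z + Real.log t * Complex.I)) = Real.log t + -(Complex.I * z) := by
      linear_combination -(Real.log t : ℂ) * Complex.I_mul_I
    rw [this, Complex.exp_add, ← Complex.ofReal_exp, Real.exp_log ht0]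

theorem isSimplyConnected_discDomain : IsSimplyConnected (discDomain f) := by
  have := (starConvex_discDomain (f := f)).contractibleSpace ⟨0, zero_mem_discDomain f⟩
  exact SimplyConnectedSpace.ofContractible _

theorem isPreconnected_discDomain : IsPreconnected (discDomain f) :=
  (isSimplyConnected_discDomain (f := f)).isPathConnected.isConnected.isPreconnected

theorem isBounded_discDomain (hf : Continuous f) (hper : Function.Periodic f (2 * Real.pi)) :
    Bornology.IsBounded (discDomain f) := by
  obtain ⟨M, hM⟩ := exists_bounds hf hper
  refine (isBounded_ball (x := (0 : ℂ)) (r := Real.exp M)).subset ?_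
  rintro w (rfl | ⟨z, hz, rfl⟩)
  · exact mem_ball_self (Real.exp_pos _)
  · rw [mem_ball_zero_iff, norm_toDisc, Real.exp_lt_exp]
    exact lt_of_lt_of_le hz ((le_abs_self _).trans (hM _))

/-- A continuous function on `discDomain f` is bounded away from the boundary. -/
theorem exists_bound_comp_toDisc (hf : Continuous f) (hper : Function.Periodic f (2 * Real.pi))
    {B : ℂ → ℂ} (hB : ContinuousOn B (discDomain f)) {δ : ℝ} (hδ : 0 < δ) :
    ∃ C, ∀ z : ℂ, z.im ≤ f z.re - δ → ‖B (toDisc z)‖ ≤ C := by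
  have h0 : ∀ᶠ w in 𝓝 (0 : ℂ), ‖B w‖ < ‖B 0‖ + 1 :=
    (hB.continuousAt ((isOpen_discDomain hf hper).mem_nhds
      (zero_mem_discDomain f))).norm.eventually_lt_const (by linarith)
  obtain ⟨ρ, hρ, hρB⟩ := Metric.eventually_nhds_iff_ball.1 h0
  -- Outside the disc of radius ρ about 0 a single period suffices, and there the admissible points
  -- form a compact set.
  set K : Set ℂ := ((uIcc 0 (2 * Real.pi)) ×ℂ uIcc (Real.log ρ) (sSup (f '' uIcc 0 (2 * Real.pi)))) ∩
    {z | z.im ≤ f z.re - δ} with hK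
  have hKc : IsCompact K := by
    refine (isCompact_uIcc.reProdIm isCompact_uIcc).inter_right ?_
    exact isClosed_le Complex.continuous_im ((hf.comp Complex.continuous_re).sub continuous_const)
  obtain ⟨C, hC⟩ := hKc.exists_bound_of_continuousOn (f := fun z => B (toDisc z))
    (hB.comp continuous_toDisc.continuousOn fun z hz => (toDisc_mem_discDomain hper).2 (by
      have h1 : z.im ≤ f z.re - δ := hz.2
      change z.im < f z.re
      linarith))
  refine ⟨max C (‖B 0‖ + 1), fun z hz => ?_⟩
  by_cases hzρ : Real.exp z.im < ρ
  · exact (hρB _ (by rwa [mem_ball_zero_iff, norm_toDisc])).le.trans (le_max_right _ _)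
  · obtain ⟨n, hn, -⟩ := existsUnique_add_zsmul_mem_Ico Real.two_pi_pos z.re 0
    rw [zero_add] at hn
    set z' : ℂ := z + n * ((2 * Real.pi : ℝ) : ℂ) with hz'
    have hre : z'.re = z.re + n • (2 * Real.pi) := by simp [hz']
    have him : z'.im = z.im := by simp [hz']
    have hT : toDisc z' = toDisc z := toDisc_eq_iff.2 ⟨n, rfl⟩
    rw [← hT]
    refine (hC z' ?_).trans (le_max_left _ _)
    have hf' : f z'.re = f z.re := by
      rw [hre, zsmul_eq_mul]
      exact hper.int_mul n z.re
    have hmem : z'.re ∈ uIcc 0 (2 * Real.pi) := by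
      rw [uIcc_of_le Real.two_pi_pos.le, hre]
      exact Ico_subset_Icc_self hn
    have hle : z'.im ≤ f z'.re - δ := by rw [him, hf']; exact hz
    refine ⟨⟨hmem, ?_⟩, hle⟩
    have h1 : Real.log ρ ≤ z'.im := by
      rw [him, ← Real.log_exp z.im]
      exact Real.log_le_log hρ (not_lt.1 hzρ)
    have h2 : f z'.re ≤ sSup (f '' uIcc 0 (2 * Real.pi)) :=
      le_csSup (isCompact_uIcc.image hf).bddAbove (mem_image_of_mem _ hmem)
    rw [uIcc_of_le (by linarith)]
    exact ⟨h1, by linarith⟩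

end periodic

end

/-! ### Green function and complex potential -/

section

/-- `g` is the Riemann map of the disc domain of `f` and `L` is a logarithm of `g w / w`. -/
structure IsUniformization (f : ℝ → ℝ) (g L : ℂ → ℂ) : Prop where
  riemann : IsRiemannMap (discDomain f) g
  differentiableOn_log : DifferentiableOn ℂ L (discDomain f)
  exp_log : ∀ w ∈ discDomain f, Complex.exp (L w) = dslope g 0 w

/-- The Green function of the disc domain with pole at the origin, lifted to the domain below the
graph of `f` and extended by zero. -/
noncomputable def green (f : ℝ → ℝ) (g : ℂ → ℂ) : ℂ → ℝ :=
  (domain f).indicator fun z => -Real.log ‖g (toDisc z)‖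

/-- The holomorphic function whose real part is the harmonic extension of `f`. -/
noncomputable def complexPotential (L : ℂ → ℂ) (z : ℂ) : ℂ := -L (toDisc z)

variable {f : ℝ → ℝ} {g L : ℂ → ℂ}

theorem exists_isUniformization (hf : Continuous f) (hper : Function.Periodic f (2 * Real.pi)) :
    ∃ g L, IsUniformization f g L := by
  have hU := isOpen_discDomain hf hper
  have h0 := zero_mem_discDomain f
  obtain ⟨g, hg⟩ := exists_riemannMap hU isSimplyConnected_discDomain h0
    (isBounded_discDomain hf hper)
  obtain ⟨L, hL, he⟩ := exists_differentiableOn_log hU isSimplyConnected_discDomain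
    ((Complex.differentiableOn_dslope (hU.mem_nhds h0)).2 hg.differentiableOn)
    fun z hz => hg.dslope_ne_zero h0 hz
  exact ⟨g, L, hg, hL, he⟩

theorem green_of_notMem {z : ℂ} (hz : z ∉ domain f) : green f g z = 0 := indicator_of_notMem hz _

theorem green_of_mem {z : ℂ} (hz : z ∈ domain f) : green f g z = -Real.log ‖g (toDisc z)‖ :=
  indicator_of_mem hz _

theorem complexPotential_add_period (z : ℂ) :
    complexPotential L (z + ((2 * Real.pi : ℝ) : ℂ)) = complexPotential L z := by
  rw [complexPotential, toDisc_add_period, complexPotential]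

theorem cell_subset_domain : cell f ⊆ domain f := fun _ hz => hz.1

theorem measurableSet_cell (hf : Continuous f) : MeasurableSet (cell f) := by
  have h1 := (isOpen_domain hf).measurableSet
  have h2 : MeasurableSet {z : ℂ | 0 ≤ z.re} :=
    (isClosed_le continuous_const Complex.continuous_re).measurableSet
  have h3 : MeasurableSet {z : ℂ | z.re < 2 * Real.pi} :=
    (isOpen_lt Complex.continuous_re continuous_const).measurableSet
  exact h1.inter (h2.inter h3)

theorem injOn_toDisc_cell : InjOn toDisc (cell f) := by
  rintro z ⟨-, hz0, hz1⟩ w ⟨-, hw0, hw1⟩ h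
  obtain ⟨n, rfl⟩ := toDisc_eq_iff.1 h
  have h1 : (w + n * ((2 * Real.pi : ℝ) : ℂ)).re = w.re + n * (2 * Real.pi) := by simp
  rw [h1] at hz0 hz1
  have hpi := Real.two_pi_pos
  have h2 : (-1 : ℝ) < n := by nlinarith
  have h3 : (n : ℝ) < 1 := by nlinarith
  have h4 : n = 0 := by
    have : (-1 : ℤ) < n := by exact_mod_cast h2
    have : n < 1 := by exact_mod_cast h3
    omega
  simp [h4]

namespace IsUniformization

theorem norm_lt_one (h : IsUniformization f g L) {z : ℂ} (hz : z ∈ domain f) :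
    ‖g (toDisc z)‖ < 1 :=
  h.riemann.norm_lt_one _ (mem_insert_of_mem _ (mem_image_of_mem _ hz))

theorem norm_pos (h : IsUniformization f g L) {z : ℂ} (hz : z ∈ domain f) :
    0 < ‖g (toDisc z)‖ :=
  norm_pos_iff.2 (h.riemann.ne_zero (zero_mem_discDomain f)
    (mem_insert_of_mem _ (mem_image_of_mem _ hz)) (toDisc_ne_zero z))

theorem green_nonneg (h : IsUniformization f g L) (z : ℂ) : 0 ≤ green f g z := by
  by_cases hz : z ∈ domain f
  · rw [green_of_mem hz]
    linarith [Real.log_nonpos (h.norm_pos hz).le (h.norm_lt_one hz).le]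
  · rw [green_of_notMem hz]

/-- Write g(w) = w exp(L w) with log|w| = Im z. Adding y cancels the logarithmic pole, which leaves
the real part of a holomorphic function. -/
theorem green_eq (h : IsUniformization f g L) {z : ℂ} (hz : z ∈ domain f) :
    green f g z = (complexPotential L z).re - z.im := by
  have hw : toDisc z ∈ discDomain f := mem_insert_of_mem _ (mem_image_of_mem _ hz)
  rw [green_of_mem hz, ← h.riemann.mul_dslope, ← h.exp_log _ hw, norm_mul, norm_toDisc,
    Complex.norm_exp, ← Real.exp_add, Real.log_exp, complexPotential, Complex.neg_re]
  ring

theorem green_add_period (hper : Function.Periodic f (2 * Real.pi)) (z : ℂ) :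
    green f g (z + ((2 * Real.pi : ℝ) : ℂ)) = green f g z := by
  by_cases hz : z ∈ domain f
  · rw [green_of_mem hz, green_of_mem ((add_period_mem_domain hper z).2 hz), toDisc_add_period]
  · rw [green_of_notMem hz, green_of_notMem (mt (add_period_mem_domain hper z).1 hz)]

theorem differentiableOn_complexPotential (h : IsUniformization f g L) (hf : Continuous f)
    (hper : Function.Periodic f (2 * Real.pi)) :
    DifferentiableOn ℂ (complexPotential L) (domain f) := by
  intro z hz
  have hw : toDisc z ∈ discDomain f := mem_insert_of_mem _ (mem_image_of_mem _ hz)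
  have h1 := h.differentiableOn_log.differentiableAt ((isOpen_discDomain hf hper).mem_nhds hw)
  exact ((h1.comp z (hasDerivAt_toDisc z).differentiableAt).neg).differentiableWithinAt

theorem deriv_complexPotential (h : IsUniformization f g L) (hf : Continuous f)
    (hper : Function.Periodic f (2 * Real.pi)) {z : ℂ} (hz : z ∈ domain f) :
    deriv (complexPotential L) z = -(deriv L (toDisc z) * (-Complex.I * toDisc z)) := by
  have hw : toDisc z ∈ discDomain f := mem_insert_of_mem _ (mem_image_of_mem _ hz)
  have h1 := h.differentiableOn_log.differentiableAt ((isOpen_discDomain hf hper).mem_nhds hw)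
  exact (h1.hasDerivAt.comp z (hasDerivAt_toDisc z)).neg.deriv

theorem harmonicAt_green (h : IsUniformization f g L) (hf : Continuous f)
    (hper : Function.Periodic f (2 * Real.pi)) {z : ℂ} (hz : z ∈ domain f) :
    InnerProductSpace.HarmonicAt (green f g) z := by
  have hn := (isOpen_domain hf).mem_nhds hz
  have h1 : AnalyticAt ℂ (fun z => complexPotential L z + Complex.I * z) z :=
    ((h.differentiableOn_complexPotential hf hper).analyticAt hn).add
      (analyticAt_const.mul analyticAt_id)
  refine (InnerProductSpace.harmonicAt_congr_nhds ?_).1 h1.harmonicAt_re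
  filter_upwards [hn] with w hw
  rw [h.green_eq hw]
  simp
  ring

theorem continuous_green (h : IsUniformization f g L) (hf : Continuous f)
    (hper : Function.Periodic f (2 * Real.pi)) : Continuous (green f g) := by
  rw [continuous_iff_continuousAt]
  intro z
  by_cases hz : z ∈ domain f
  · have hn := (isOpen_domain hf).mem_nhds hz
    have h1 := ((h.differentiableOn_complexPotential hf hper).continuousOn.continuousAt hn)
    have h2 : ContinuousAt (fun z => (complexPotential L z).re - z.im) z :=
      (Complex.continuous_re.continuousAt.comp h1).sub Complex.continuous_im.continuousAt
    refine h2.congr ?_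
    filter_upwards [hn] with w hw using (h.green_eq hw).symm
  · rw [ContinuousAt, green_of_notMem hz, Metric.tendsto_nhds]
    intro ε hε
    -- This sublevel set is compact, hence closed in the plane, and does not contain the image of z.
    -- Off it the Green function is below ε/2, so continuity across the graph needs no regularity of
    -- the boundary.
    set K : Set ℂ := {w ∈ discDomain f | ‖g w‖ ≤ Real.exp (-(ε / 2))} with hK
    have hKc : IsClosed K := (h.riemann.isCompact_sublevel (isOpen_discDomain hf hper)
      isPreconnected_discDomain (zero_mem_discDomain f) (by simpa using hε)).isClosed
    have hmem : z ∈ toDisc ⁻¹' Kᶜ := fun hk => hz ((toDisc_mem_discDomain hper).1 hk.1)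
    filter_upwards [(hKc.isOpen_compl.preimage continuous_toDisc).mem_nhds hmem] with w hw
    rw [Real.dist_0_eq_abs, abs_of_nonneg (h.green_nonneg w)]
    by_cases hwd : w ∈ domain f
    · have h3 : Real.exp (-(ε / 2)) < ‖g (toDisc w)‖ :=
        not_le.1 fun h4 => hw ⟨mem_insert_of_mem _ (mem_image_of_mem _ hwd), h4⟩
      rw [green_of_mem hwd]
      have := Real.log_lt_log (Real.exp_pos _) h3
      rw [Real.log_exp] at this
      linarith
    · rw [green_of_notMem hwd]
      exact hε

/-- Dirichlet energy is conformally invariant and one period injects into the disc domain, so the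
energy of L bounds it. -/
theorem lintegral_deriv_sq_lt_top (h : IsUniformization f g L) (hf : Continuous f)
    (hper : Function.Periodic f (2 * Real.pi)) :
    ∫⁻ z in cell f, ‖deriv (complexPotential L) z‖ₑ ^ 2 < ∞ := by
  have h1 := lintegral_image_eq_of_injOn (measurableSet_cell hf)
    (fun z _ => (hasDerivAt_toDisc z).differentiableAt) injOn_toDisc_cell
    (fun w => ‖deriv L w‖ₑ ^ 2)
  have h2 : ∫⁻ z in cell f, ‖deriv (complexPotential L) z‖ₑ ^ 2 =
      ∫⁻ w in toDisc '' cell f, ‖deriv L w‖ₑ ^ 2 := by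
    rw [h1]
    refine setLIntegral_congr_fun (measurableSet_cell hf) fun z hz => ?_
    rw [h.deriv_complexPotential hf hper hz.1, (hasDerivAt_toDisc z).deriv, enorm_neg, enorm_mul,
      mul_pow, mul_comm]
  rw [h2]
  refine (lintegral_mono_set ?_).trans_lt (h.riemann.lintegral_deriv_log_sq_lt_top
    (isOpen_discDomain hf hper) isPreconnected_discDomain (isBounded_discDomain hf hper)
    (zero_mem_discDomain f) h.differentiableOn_log h.exp_log)
  exact (image_mono cell_subset_domain).trans (subset_insert _ _)

/-- Exponential decay of the complex potential, minus its limit, and of its derivative. -/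
theorem exists_decay (h : IsUniformization f g L) (hf : Continuous f)
    (hper : Function.Periodic f (2 * Real.pi)) {δ : ℝ} (hδ : 0 < δ) :
    ∃ C, 0 ≤ C ∧ ∀ z : ℂ, z.im ≤ f z.re - δ →
      ‖complexPotential L z + L 0‖ ≤ C * Real.exp z.im ∧
      ‖deriv (complexPotential L) z‖ ≤ C * Real.exp z.im := by
  have hU := isOpen_discDomain hf hper
  have hn := hU.mem_nhds (zero_mem_discDomain f)
  obtain ⟨C₁, hC₁⟩ := exists_bound_comp_toDisc hf hper
    ((Complex.differentiableOn_dslope hn).2 h.differentiableOn_log).continuousOn hδ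
  obtain ⟨C₂, hC₂⟩ := exists_bound_comp_toDisc hf hper
    (h.differentiableOn_log.analyticOnNhd hU).deriv.continuousOn hδ
  refine ⟨max 0 (max C₁ C₂), le_max_left _ _, fun z hz => ⟨?_, ?_⟩⟩
  -- L(w) - L(0) is w times a function bounded away from the graph, and |w| = exp(Im z) supplies the
  -- decay.
  · have h1 := sub_smul_dslope L 0 (toDisc z)
    rw [sub_zero, smul_eq_mul] at h1
    have h2 : complexPotential L z + L 0 = -(toDisc z * dslope L 0 (toDisc z)) := by
      rw [h1, complexPotential]; ring
    rw [h2, norm_neg, norm_mul, norm_toDisc, mul_comm]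
    gcongr
    exact (hC₁ z hz).trans ((le_max_left _ _).trans (le_max_right _ _))
  · have hzd : z ∈ domain f := by change z.im < f z.re; linarith
    rw [h.deriv_complexPotential hf hper hzd, norm_neg, norm_mul, norm_mul, norm_neg,
      Complex.norm_I, one_mul, norm_toDisc]
    gcongr
    exact (hC₂ z hz).trans ((le_max_right _ _).trans (le_max_right _ _))

/-- The Green function tends to zero uniformly at the graph. -/
theorem exists_green_le (h : IsUniformization f g L) (hf : Continuous f)
    (hper : Function.Periodic f (2 * Real.pi)) {ε : ℝ} (hε : 0 < ε) :
    ∃ η > 0, ∀ z ∈ cell f, f z.re - η < z.im → green f g z ≤ ε := by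
  obtain ⟨M, hM⟩ := exists_bounds hf hper
  have hK : IsCompact ((uIcc 0 (2 * Real.pi)) ×ℂ (uIcc (-M - 1) M)) :=
    isCompact_uIcc.reProdIm isCompact_uIcc
  have huc := hK.uniformContinuousOn_of_continuous (h.continuous_green hf hper).continuousOn
  rw [Metric.uniformContinuousOn_iff_le] at huc
  obtain ⟨η, hη, hu⟩ := huc ε hε
  refine ⟨min η 1, by positivity, fun z hz hzim => ?_⟩
  have hzf : z.im < f z.re := hz.1
  have hb := abs_le.1 (hM z.re)
  have h1 : min η 1 ≤ η := min_le_left _ _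
  have h2 : min η 1 ≤ 1 := min_le_right _ _
  -- The point of the graph above z, where the Green function is zero; uniform continuity on a
  -- rectangle compares the two values.
  set w : ℂ := ⟨z.re, f z.re⟩ with hw
  have hre : z.re ∈ uIcc 0 (2 * Real.pi) := by
    rw [uIcc_of_le Real.two_pi_pos.le]
    exact ⟨hz.2.1, hz.2.2.le⟩
  have hle : -M - 1 ≤ M := by linarith
  have hdist : dist z w ≤ η := by
    rw [Complex.dist_of_re_eq (by rfl), Real.dist_eq, abs_le]
    constructor <;> simp only [hw] <;> linarith
  have := hu z ⟨hre, by rw [uIcc_of_le hle]; constructor <;> linarith⟩ w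
    ⟨hre, by rw [uIcc_of_le hle]; constructor <;> simp only [hw] <;> linarith⟩ hdist
  have hwz : green f g w = 0 := green_of_notMem (by simp [domain, hw])
  rw [hwz, Real.dist_0_eq_abs] at this
  exact (le_abs_self _).trans this

end IsUniformization

end

/-! ### Energy class and trace of the potential -/

section

variable {f : ℝ → ℝ} {g L : ℂ → ℂ}

theorem integrable_mul_of_tsupport_subset {U : Set ℂ} {a ψ : ℂ → ℝ} (ha : ContinuousOn a U)
    (hψ : Continuous ψ) (hc : HasCompactSupport ψ) (hs : tsupport ψ ⊆ U) :
    Integrable (fun z => a z * ψ z) := by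
  have h1 : IntegrableOn (fun z => a z * ψ z) (tsupport ψ) :=
    ((ha.mono hs).mul hψ.continuousOn).integrableOn_compact hc
  refine (integrableOn_iff_integrable_of_support_subset fun z hz => subset_tsupport ψ ?_).1 h1
  exact right_ne_zero_of_mul hz

theorem hasCompactSupport_fderiv_apply {ψ : ℂ → ℝ} (hc : HasCompactSupport ψ) (e : ℂ) :
    HasCompactSupport fun z => fderiv ℝ ψ z e := hc.fderiv_apply (𝕜 := ℝ) e

theorem tsupport_fderiv_apply {ψ : ℂ → ℝ} (e : ℂ) :
    tsupport (fun z => fderiv ℝ ψ z e) ⊆ tsupport ψ := tsupport_fderiv_apply_subset ℝ e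

theorem continuous_fderiv_apply {ψ : ℂ → ℝ} (hψ : ContDiff ℝ ((⊤ : ℕ∞) : WithTop ℕ∞) ψ) (e : ℂ) :
    Continuous fun z => fderiv ℝ ψ z e :=
  (hψ.continuous_fderiv (by simp)).clm_apply continuous_const

/-- The real part of a holomorphic function has a weak gradient. -/
theorem hasWeakGradientOn_re {U : Set ℂ} (hU : IsOpen U) {H : ℂ → ℂ} (hH : DifferentiableOn ℂ H U)
    {u : ℂ → ℝ} (hu : ∀ z ∈ U, u z = (H z).re) :
    HasWeakGradientOn u (fun z => conj (deriv H z)) U := by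
  have huc : ContinuousOn u U :=
    (Complex.continuous_re.comp_continuousOn hH.continuousOn).congr hu
  have hHd : ContinuousOn (deriv H) U := (hH.analyticOnNhd hU).deriv.continuousOn
  have hder : ∀ z ∈ U, HasFDerivAt u (Complex.reCLM.comp (deriv H z • (1 : ℂ →L[ℝ] ℂ))) z := by
    intro z hz
    have h1 := (hH.differentiableAt (hU.mem_nhds hz)).hasDerivAt.complexToReal_fderiv
    refine (Complex.reCLM.hasFDerivAt.comp z h1).congr_of_eventuallyEq ?_
    filter_upwards [hU.mem_nhds hz] with w hw using hu w hw
  refine ⟨huc.locallyIntegrableOn hU.measurableSet,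
    (Complex.continuous_conj.comp_continuousOn hHd).locallyIntegrableOn hU.measurableSet, ?_⟩
  intro ψ hψ hψc hψs e
  have hψs' := (tsupport_fderiv_apply (ψ := ψ) e).trans hψs
  have hdc : ContinuousOn (fun z => fderiv ℝ u z e) U := by
    refine ContinuousOn.congr (f := fun z => (deriv H z * e).re) ?_ fun z hz => ?_
    · exact Complex.continuous_re.comp_continuousOn (hHd.mul continuousOn_const)
    · rw [(hder z hz).fderiv]
      simp
  have key := integral_mul_fderiv_eq_neg_fderiv_mul_of_integrable (μ := volume) (f := u) (g := ψ)
    (v := e) (integrable_mul_of_tsupport_subset hdc hψ.continuous hψc hψs)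
    (integrable_mul_of_tsupport_subset huc (continuous_fderiv_apply hψ e)
      (hasCompactSupport_fderiv_apply hψc e) hψs')
    (integrable_mul_of_tsupport_subset huc hψ.continuous hψc hψs)
    (fun z hz => (hder z (hψs hz)).differentiableAt)
    (fun z _ => (hψ.differentiable (by simp)).differentiableAt)
  rw [setIntegral_eq_integral_of_forall_compl_eq_zero, key,
    setIntegral_eq_integral_of_forall_compl_eq_zero]
  · congr 1
    refine integral_congr_ae (Eventually.of_forall fun z => ?_)
    by_cases hz : z ∈ U
    · dsimp only
      rw [(hder z hz).fderiv, Complex.inner]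
      simp [mul_comm]
    · have : ψ z = 0 := image_eq_zero_of_notMem_tsupport fun h => hz (hψs h)
      simp [this]
  · intro z hz
    rw [image_eq_zero_of_notMem_tsupport fun h => hz (hψs h), zero_mul]
  · intro z hz
    have : fderiv ℝ ψ z e = 0 :=
      image_eq_zero_of_notMem_tsupport (f := fun z => fderiv ℝ ψ z e) fun h => hz (hψs' h)
    rw [this, mul_zero]

theorem volume_strip (hf : Continuous f) (h : ℝ) :
    volume (strip f h) = ENNReal.ofReal (2 * Real.pi) * ENNReal.ofReal h := by
  have h1 : strip f h = Complex.measurableEquivRealProd ⁻¹'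
      regionBetween (fun x => f x - h) f (Ico 0 (2 * Real.pi)) := by
    ext z
    simp only [strip, cell, domain, regionBetween, mem_ofPred_eq, mem_preimage,
      Complex.measurableEquivRealProd_apply, mem_Ico, mem_Ioo]
    tauto
  have h2 : MeasurableSet (regionBetween (fun x => f x - h) f (Ico 0 (2 * Real.pi))) :=
    measurableSet_regionBetween (hf.sub continuous_const).measurable hf.measurable
      measurableSet_Ico
  rw [h1, Complex.volume_preserving_equiv_real_prod.measure_preimage h2.nullMeasurableSet,
    Measure.volume_eq_prod, volume_regionBetween_eq_lintegral
      (by fun_prop : Continuous fun x => f x - h).measurable.aemeasurable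
      hf.measurable.aemeasurable measurableSet_Ico]
  simp [mul_comm]

theorem strip_subset_cell (h : ℝ) : strip f h ⊆ cell f := fun _ hz => hz.1

theorem measurableSet_strip (hf : Continuous f) (h : ℝ) : MeasurableSet (strip f h) :=
  (measurableSet_cell hf).inter (isOpen_lt ((hf.comp Complex.continuous_re).sub
    continuous_const) Complex.continuous_im).measurableSet

/-- The harmonic extension of `f` to the domain below its graph. -/
noncomputable def potential (f : ℝ → ℝ) (g : ℂ → ℂ) (z : ℂ) : ℝ := green f g z + z.im

namespace IsUniformization

theorem continuous_potential (h : IsUniformization f g L) (hf : Continuous f)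
    (hper : Function.Periodic f (2 * Real.pi)) : Continuous (potential f g) :=
  (h.continuous_green hf hper).add Complex.continuous_im

theorem memHdot1_potential (h : IsUniformization f g L) (hf : Continuous f)
    (hper : Function.Periodic f (2 * Real.pi)) :
    MemHdot1 f (potential f g) (fun z => conj (deriv (complexPotential L) z)) := by
  have hd := h.differentiableOn_complexPotential hf hper
  have hU := isOpen_domain hf
  refine ⟨fun z _ => ?_, hasWeakGradientOn_re hU hd fun z hz => ?_, ?_, ?_⟩
  · rw [potential, green_add_period hper, potential]
    simp
  · rw [potential, h.green_eq hz]
    ring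
  · refine (ContinuousOn.mono ?_ cell_subset_domain).aestronglyMeasurable (measurableSet_cell hf)
    exact Complex.continuous_conj.comp_continuousOn (hd.analyticOnNhd hU).deriv.continuousOn
  · rw [eLpNorm_lt_top_iff_lintegral_rpow_enorm_lt_top (by norm_num) (by norm_num)]
    simpa using h.lintegral_deriv_sq_lt_top hf hper

/-- In a thin strip the deviation from f is at most the Green function plus the depth below the
graph. Both are uniformly small, and the strip of thickness t has area 2πt. -/
theorem hasTrace_potential (h : IsUniformization f g L) (hf : Continuous f)
    (hper : Function.Periodic f (2 * Real.pi)) : HasTrace f (potential f g) f := by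
  rw [HasTrace, ENNReal.tendsto_nhds_zero]
  intro ε hε
  obtain ⟨r, hr0, hrε⟩ : ∃ r : ℝ, 0 < r ∧
      ENNReal.ofReal (r + r) * ENNReal.ofReal (2 * Real.pi) ≤ ε := by
    have ht : Tendsto (fun r : ℝ => ENNReal.ofReal (r + r) * ENNReal.ofReal (2 * Real.pi))
        (𝓝[>] 0) (𝓝 0) := by
      have : Continuous fun r : ℝ => ENNReal.ofReal ((r + r) * (2 * Real.pi)) :=
        ENNReal.continuous_ofReal.comp (by fun_prop)
      have h2 := (this.tendsto 0).mono_left (nhdsWithin_le_nhds (s := Ioi 0))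
      simp only [add_zero, zero_mul, ENNReal.ofReal_zero] at h2
      exact h2.congr fun r => ENNReal.ofReal_mul' Real.two_pi_pos.le
    obtain ⟨r, hr, hr0⟩ := ((ENNReal.tendsto_nhds_zero.1 ht ε hε).and self_mem_nhdsWithin).exists
    exact ⟨r, hr0, hr⟩
  obtain ⟨η, hη, hη'⟩ := h.exists_green_le hf hper hr0
  filter_upwards [Ioo_mem_nhdsGT (lt_min hη hr0)] with t ht
  have ht0 : 0 < t := ht.1
  have htη : t < η := ht.2.trans_le (min_le_left _ _)
  have htr : t < r := ht.2.trans_le (min_le_right _ _)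
  have hb : ∀ z ∈ strip f t, ‖potential f g z - f z.re‖ₑ ≤ ENNReal.ofReal (r + r) := by
    rintro z ⟨hz, hzt⟩
    have hz1 : z.im < f z.re := hz.1
    rw [← ofReal_norm]
    refine ENNReal.ofReal_le_ofReal ?_
    have h3 := hη' z hz (by linarith)
    have h4 := h.green_nonneg z
    rw [Real.norm_eq_abs, abs_le, potential]
    constructor <;> linarith
  have hle : ∫⁻ z in strip f t, ‖potential f g z - f z.re‖ₑ ≤
      ENNReal.ofReal (r + r) * (ENNReal.ofReal (2 * Real.pi) * ENNReal.ofReal t) := by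
    refine (setLIntegral_mono' (measurableSet_strip hf t) hb).trans ?_
    rw [setLIntegral_const, volume_strip hf]
  refine (ENNReal.div_le_div_right hle _).trans ?_
  rw [← mul_assoc, ENNReal.mul_div_cancel_right (by simpa using ht0) ENNReal.ofReal_ne_top]
  exact hrε

end IsUniformization

end

/-! ### Calculus of weak gradients -/

section

namespace HasWeakGradientOn

variable {U : Set ℂ} {u u' : ℂ → ℝ} {V V' : ℂ → ℂ}

theorem integrable_smul {E : Type*} [NormedAddCommGroup E] [NormedSpace ℝ E] {a : ℂ → E}
    (ha : LocallyIntegrableOn a U)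
    {ψ : ℂ → ℝ} (hψ : Continuous ψ) (hc : HasCompactSupport ψ) (hs : tsupport ψ ⊆ U) :
    Integrable (fun z => ψ z • a z) := by
  have h1 : IntegrableOn (fun z => ψ z • a z) (tsupport ψ) :=
    (ha.integrableOn_compact_subset hs hc).continuousOn_smul hψ.continuousOn hc
  refine (integrableOn_iff_integrable_of_support_subset fun z hz => subset_tsupport ψ ?_).1 h1
  exact left_ne_zero_of_smul hz

theorem integral_univ (h : HasWeakGradientOn u V U) {ψ : ℂ → ℝ}
    (hψ : ContDiff ℝ ((⊤ : ℕ∞) : WithTop ℕ∞) ψ) (hc : HasCompactSupport ψ)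
    (hs : tsupport ψ ⊆ U) (e : ℂ) :
    ∫ z, u z * fderiv ℝ ψ z e = -∫ z, ψ z * inner ℝ (V z) e := by
  rw [← setIntegral_eq_integral_of_forall_compl_eq_zero (s := U), h.integral_eq ψ hψ hc hs e,
    setIntegral_eq_integral_of_forall_compl_eq_zero]
  · intro z hz
    rw [image_eq_zero_of_notMem_tsupport fun h => hz (hs h), zero_mul]
  · intro z hz
    have : fderiv ℝ ψ z e = 0 := image_eq_zero_of_notMem_tsupport (f := fun z => fderiv ℝ ψ z e)
      fun h => hz (hs (tsupport_fderiv_apply e h))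
    rw [this, mul_zero]

theorem integrable_mul_inner (h : HasWeakGradientOn u V U) {ψ : ℂ → ℝ}
    (hψ : Continuous ψ) (hc : HasCompactSupport ψ) (hs : tsupport ψ ⊆ U) (e : ℂ) :
    Integrable (fun z => ψ z * inner ℝ (V z) e) := by
  have h1 := (integrable_smul h.locallyIntegrable_grad hψ hc hs).inner_const (𝕜 := ℝ) e
  simpa only [real_inner_smul_left] using h1

theorem integrable_mul (h : HasWeakGradientOn u V U) {ψ : ℂ → ℝ}
    (hψ : Continuous ψ) (hc : HasCompactSupport ψ) (hs : tsupport ψ ⊆ U) :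
    Integrable (fun z => u z * ψ z) := by
  simpa only [smul_eq_mul, mul_comm] using integrable_smul h.locallyIntegrable hψ hc hs

theorem sub (h : HasWeakGradientOn u V U) (h' : HasWeakGradientOn u' V' U) :
    HasWeakGradientOn (fun z => u z - u' z) (fun z => V z - V' z) U := by
  refine ⟨h.locallyIntegrable.sub h'.locallyIntegrable,
    h.locallyIntegrable_grad.sub h'.locallyIntegrable_grad, fun ψ hψ hc hs e => ?_⟩
  have hs' := (tsupport_fderiv_apply (ψ := ψ) e).trans hs
  have hc' := hasCompactSupport_fderiv_apply hc e
  have hψ' := continuous_fderiv_apply hψ e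
  simp only [sub_mul, inner_sub_left, mul_sub]
  rw [integral_sub (h.integrable_mul hψ' hc' hs').integrableOn
    (h'.integrable_mul hψ' hc' hs').integrableOn,
    integral_sub (h.integrable_mul_inner hψ.continuous hc hs e).integrableOn
    (h'.integrable_mul_inner hψ.continuous hc hs e).integrableOn,
    h.integral_eq ψ hψ hc hs, h'.integral_eq ψ hψ hc hs]
  ring

theorem congr (h : HasWeakGradientOn u V U) (hU : IsOpen U) (he : ∀ z ∈ U, u' z = u z) :
    HasWeakGradientOn u' V U := by
  refine ⟨?_, h.locallyIntegrable_grad, fun ψ hψ hc hs e => ?_⟩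
  · intro z hz
    obtain ⟨s, hs, hi⟩ := h.locallyIntegrable z hz
    refine ⟨s ∩ U, inter_mem hs self_mem_nhdsWithin, ?_⟩
    refine (hi.mono_set inter_subset_left).congr_fun_ae ?_
    filter_upwards [ae_restrict_of_ae_restrict_of_subset inter_subset_right
      (ae_restrict_mem hU.measurableSet)] with w hw using (he w hw).symm
  · rw [← h.integral_eq ψ hψ hc hs e]
    exact setIntegral_congr_fun hU.measurableSet fun z hz => by
      rw [he z hz]

/-- The weak gradient is unique. -/
theorem ae_eq (h : HasWeakGradientOn u V U) (h' : HasWeakGradientOn u V' U) (hU : IsOpen U) :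
    ∀ᵐ z, z ∈ U → V z = V' z := by
  -- The fundamental lemma of the calculus of variations, applied componentwise; e = 1 and e = i
  -- determine the vector.
  have key : ∀ e : ℂ, ∀ᵐ z, z ∈ U → (inner ℝ (V z - V' z) e : ℝ) = 0 := by
    intro e
    have hd : LocallyIntegrableOn (fun z => V z - V' z) U :=
      h.locallyIntegrable_grad.sub h'.locallyIntegrable_grad
    refine hU.ae_eq_zero_of_integral_contDiff_smul_eq_zero ?_ fun ψ hψ hc hs => ?_
    · intro z hz
      obtain ⟨s, hs, hi⟩ := hd z hz
      exact ⟨s, hs, Integrable.inner_const (𝕜 := ℝ) hi e⟩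
    · simp only [smul_eq_mul, inner_sub_left, mul_sub]
      rw [integral_sub (h.integrable_mul_inner hψ.continuous hc hs e)
        (h'.integrable_mul_inner hψ.continuous hc hs e), sub_eq_zero, ← neg_inj,
        ← h.integral_univ hψ hc hs, ← h'.integral_univ hψ hc hs]
  filter_upwards [key 1, key Complex.I] with z h1 h2 hz
  have h3 := h1 hz
  have h4 := h2 hz
  simp only [Complex.inner] at h3 h4
  apply Complex.ext
  · simp at h3
    linarith
  · simp at h4
    linarith

theorem _root_.DirichletNeumann.locallyIntegrableOn_comp_add {E : Type*} [NormedAddCommGroup E]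
    {a : ℂ → E} {τ : ℂ} (ha : LocallyIntegrableOn a U) (hτ : ∀ z, z + τ ∈ U ↔ z ∈ U) :
    LocallyIntegrableOn (fun z => a (z + τ)) U := by
  intro z hz
  obtain ⟨s, hs, hi⟩ := ha (z + τ) ((hτ z).2 hz)
  refine ⟨(· + τ) ⁻¹' s, ?_, ?_⟩
  · have ht : Tendsto (· + τ) (𝓝[U] z) (𝓝[U] (z + τ)) :=
      (continuous_add_const τ).continuousWithinAt.tendsto_nhdsWithin fun w hw => (hτ w).2 hw
    exact ht hs
  · exact ((measurePreserving_add_right volume τ).integrableOn_comp_preimage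
      (measurableEmbedding_addRight τ)).2 hi

theorem comp_add {τ : ℂ} (h : HasWeakGradientOn u V U) (hτ : ∀ z, z + τ ∈ U ↔ z ∈ U) :
    HasWeakGradientOn (fun z => u (z + τ)) (fun z => V (z + τ)) U := by
  refine ⟨locallyIntegrableOn_comp_add h.locallyIntegrable hτ,
    locallyIntegrableOn_comp_add h.locallyIntegrable_grad hτ, fun ψ hψ hc hs e => ?_⟩
  set ρ : ℂ → ℝ := fun z => ψ (z - τ) with hρ
  have hρd : ContDiff ℝ ((⊤ : ℕ∞) : WithTop ℕ∞) ρ := hψ.comp (contDiff_id.sub contDiff_const)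
  have hρc : HasCompactSupport ρ := hc.comp_homeomorph (Homeomorph.subRight τ)
  have hρs : tsupport ρ ⊆ U := by
    intro z hz
    have h1 : tsupport ρ = (Homeomorph.subRight τ) ⁻¹' tsupport ψ :=
      tsupport_comp_eq_preimage ψ (Homeomorph.subRight τ)
    rw [h1] at hz
    have h2 := (hτ (z - τ)).2 (hs hz)
    rwa [sub_add_cancel] at h2
  have key := h.integral_univ hρd hρc hρs e
  rw [← integral_add_right_eq_self (μ := volume) _ τ,
    ← integral_add_right_eq_self (μ := volume) (fun z => ρ z * inner ℝ (V z) e) τ] at key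
  have hfd : ∀ z, fderiv ℝ ρ (z + τ) = fderiv ℝ ψ z := by
    intro z
    rw [hρ, fderiv_comp_sub, add_sub_cancel_right]
  simp only [hfd] at key
  simp only [hρ, add_sub_cancel_right] at key
  rw [setIntegral_eq_integral_of_forall_compl_eq_zero, key,
    setIntegral_eq_integral_of_forall_compl_eq_zero]
  · intro z hz
    rw [image_eq_zero_of_notMem_tsupport fun h => hz (hs h), zero_mul]
  · intro z hz
    have : fderiv ℝ ψ z e = 0 := image_eq_zero_of_notMem_tsupport (f := fun z => fderiv ℝ ψ z e)
      fun h => hz (hs (tsupport_fderiv_apply e h))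
    rw [this, mul_zero]

end HasWeakGradientOn

variable {f : ℝ → ℝ} {u : ℂ → ℝ} {V : ℂ → ℂ}

/-- The weak gradient of a periodic function is periodic almost everywhere. -/
theorem MemHdot1.ae_periodic (h : MemHdot1 f u V) (hf : Continuous f)
    (hper : Function.Periodic f (2 * Real.pi)) :
    ∀ᵐ z, z ∈ domain f → V (z + ((2 * Real.pi : ℝ) : ℂ)) = V z :=
  ((h.weakGradient.comp_add (add_period_mem_domain hper)).congr (isOpen_domain hf)
    fun z hz => (h.periodic z hz).symm).ae_eq h.weakGradient (isOpen_domain hf)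

end

/-! ### Unfolding of periods and smooth cutoffs -/

section

variable {f : ℝ → ℝ}

/-- Unfolding: the integral over the domain of a periodic function times a function of the abscissa
supported in two periods. -/
theorem setIntegral_domain_eq_cell (hf : Continuous f) (hper : Function.Periodic f (2 * Real.pi))
    {q : ℝ → ℝ} (hq : Continuous q) (hq0 : ∀ x, x < 0 → q x = 0)
    (hq1 : ∀ x, 2 * (2 * Real.pi) ≤ x → q x = 0) {G : ℂ → ℝ}
    (hG : ∀ᵐ z, z ∈ domain f → G (z + ((2 * Real.pi : ℝ) : ℂ)) = G z)
    (hGi : IntegrableOn G (cell f)) :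
    ∫ z in domain f, q z.re * G z = ∫ z in cell f, (q z.re + q (z.re + 2 * Real.pi)) * G z := by
  set τ : ℂ := ((2 * Real.pi : ℝ) : ℂ) with hτ
  have hτre : ∀ z : ℂ, (z + τ).re = z.re + 2 * Real.pi := fun z => by simp [hτ]
  have hmc := measurableSet_cell hf
  -- The cell translated by one period to the right; with the cell itself it covers the support of q
  -- in the domain.
  set T' : Set ℂ := (fun z => z + -τ) ⁻¹' (cell f) with hT'
  have hmT' : MeasurableSet T' := measurable_add_const (-τ) hmc
  have hpre : (· + τ) ⁻¹' T' = cell f := by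
    ext z
    simp [hT']
  have hmp := measurePreserving_add_right (volume : Measure ℂ) τ
  have hme := measurableEmbedding_addRight τ
  obtain ⟨B, hB⟩ := (isCompact_Icc (a := (0 : ℝ)) (b := 2 * (2 * Real.pi))).exists_bound_of_continuousOn
    hq.continuousOn
  have hB' : ∀ x, ‖q x‖ ≤ max B 0 := by
    intro x
    by_cases hx : x ∈ Icc 0 (2 * (2 * Real.pi))
    · exact (hB x hx).trans (le_max_left _ _)
    · have : q x = 0 := by
        by_cases h0 : x < 0
        · exact hq0 x h0
        · exact hq1 x (not_le.1 fun h => hx ⟨not_lt.1 h0, h⟩).le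
      rw [this, norm_zero]
      exact le_max_right _ _
  have hGae : ∀ᵐ z ∂volume.restrict (cell f), G (z + τ) = G z := by
    rw [ae_restrict_iff' hmc]
    filter_upwards [hG] with z hz hzc using hz hzc.1
  have hGT : IntegrableOn G T' := by
    rw [← hmp.integrableOn_comp_preimage hme, hpre]
    exact hGi.congr_fun_ae (hGae.mono fun z hz => hz.symm)
  have hqm : ∀ ν : Measure ℂ, AEStronglyMeasurable (fun z : ℂ => q z.re) ν := fun ν =>
    (hq.comp Complex.continuous_re).aestronglyMeasurable
  have hi1 : IntegrableOn (fun z => q z.re * G z) (cell f) :=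
    Integrable.bdd_mul hGi (hqm _) (Eventually.of_forall fun z => hB' z.re)
  have hi2 : IntegrableOn (fun z => q z.re * G z) T' :=
    Integrable.bdd_mul hGT (hqm _) (Eventually.of_forall fun z => hB' z.re)
  have hi3 : IntegrableOn (fun z : ℂ => q (z.re + 2 * Real.pi) * G z) (cell f) :=
    Integrable.bdd_mul hGi ((hq.comp (Complex.continuous_re.add
      continuous_const)).aestronglyMeasurable) (Eventually.of_forall fun z => hB' _)
  have hdisj : Disjoint (cell f) T' := by
    rw [Set.disjoint_left]
    rintro z hz hz'
    have h1 := hz'.2.1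
    have h2 := hz.2.2
    simp [hτ] at h1
    linarith
  have hsub : cell f ∪ T' ⊆ domain f := by
    rintro z (hz | hz)
    · exact hz.1
    · have h1 : z + -τ ∈ domain f := hz.1
      have h2 := (add_period_mem_domain hper (z + -τ)).2 h1
      rwa [neg_add_cancel_right] at h2
  have e1 : ∫ z in domain f, q z.re * G z = ∫ z in cell f ∪ T', q z.re * G z := by
    refine setIntegral_eq_of_subset_of_forall_sdiff_eq_zero (isOpen_domain hf).measurableSet hsub ?_
    rintro z ⟨hz, hzn⟩
    rw [mem_union, not_or] at hzn
    have : q z.re = 0 := by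
      by_cases h0 : z.re < 0
      · exact hq0 _ h0
      · by_cases h1 : 2 * (2 * Real.pi) ≤ z.re
        · exact hq1 _ h1
        · exfalso
          have h2 : 2 * Real.pi ≤ z.re := not_lt.1 fun h => hzn.1 ⟨hz, not_lt.1 h0, h⟩
          refine hzn.2 ⟨?_, ?_, ?_⟩
          · have := add_period_mem_domain hper (z + -τ)
            rw [neg_add_cancel_right] at this
            exact this.1 hz
          · simp [hτ]; linarith
          · simp [hτ]; linarith
    rw [this, zero_mul]
  have e2 : ∫ z in T', q z.re * G z = ∫ z in cell f, q (z.re + 2 * Real.pi) * G z := by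
    rw [← hmp.setIntegral_preimage_emb hme, hpre]
    refine setIntegral_congr_ae hmc ?_
    filter_upwards [hG] with z hz hzc
    rw [hτre, hz hzc.1]
  rw [e1, setIntegral_union hdisj hmT' hi1 hi2, e2, ← integral_add hi1 hi3]
  exact integral_congr_ae (Eventually.of_forall fun z => by ring)

/-- A smooth function on the line whose translates by the period sum up to `1`. -/
noncomputable def periodCutoff (x : ℝ) : ℝ :=
  Real.smoothTransition x - Real.smoothTransition (x - 2 * Real.pi)

theorem contDiff_periodCutoff {n : ℕ∞} : ContDiff ℝ n periodCutoff :=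
  Real.smoothTransition.contDiff.sub (Real.smoothTransition.contDiff.comp
    (contDiff_id.sub contDiff_const))

theorem periodCutoff_of_nonpos {x : ℝ} (hx : x ≤ 0) : periodCutoff x = 0 := by
  have := Real.two_pi_pos
  rw [periodCutoff, Real.smoothTransition.zero_of_nonpos hx,
    Real.smoothTransition.zero_of_nonpos (by linarith), sub_zero]

theorem periodCutoff_of_le {x : ℝ} (hx : 2 * Real.pi + 1 ≤ x) : periodCutoff x = 0 := by
  have := Real.two_pi_pos
  rw [periodCutoff, Real.smoothTransition.one_of_one_le (by linarith),
    Real.smoothTransition.one_of_one_le (by linarith), sub_self]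

theorem periodCutoff_add {x : ℝ} (hx0 : 0 ≤ x) (hx1 : x < 2 * Real.pi) :
    periodCutoff x + periodCutoff (x + 2 * Real.pi) = 1 := by
  have := Real.pi_gt_three
  rw [periodCutoff, periodCutoff, Real.smoothTransition.zero_of_nonpos (x := x - 2 * Real.pi)
    (by linarith), add_sub_cancel_right,
    Real.smoothTransition.one_of_one_le (x := x + 2 * Real.pi) (by linarith)]
  ring

theorem deriv_periodCutoff_of_neg {x : ℝ} (hx : x < 0) : deriv periodCutoff x = 0 := by
  have : periodCutoff =ᶠ[𝓝 x] fun _ => 0 := by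
    filter_upwards [Iio_mem_nhds hx] with y hy using periodCutoff_of_nonpos (le_of_lt hy)
  rw [this.deriv_eq, deriv_const]

theorem deriv_periodCutoff_of_lt {x : ℝ} (hx : 2 * Real.pi + 1 < x) :
    deriv periodCutoff x = 0 := by
  have : periodCutoff =ᶠ[𝓝 x] fun _ => 0 := by
    filter_upwards [Ioi_mem_nhds hx] with y hy using periodCutoff_of_le (le_of_lt hy)
  rw [this.deriv_eq, deriv_const]

/-- The translates sum to the constant 1. This cancels the terms in which the horizontal cutoff is
differentiated. -/
theorem deriv_periodCutoff_add {x : ℝ} (hx0 : 0 ≤ x) (hx1 : x < 2 * Real.pi) :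
    deriv periodCutoff x + deriv periodCutoff (x + 2 * Real.pi) = 0 := by
  have hpi := Real.pi_gt_three
  have hd : Differentiable ℝ periodCutoff :=
    (contDiff_periodCutoff (n := 1)).differentiable (by simp)
  have e1 : HasDerivAt (fun x => periodCutoff x + periodCutoff (x + 2 * Real.pi))
      (deriv periodCutoff x + deriv periodCutoff (x + 2 * Real.pi)) x :=
    (hd x).hasDerivAt.add ((hd (x + 2 * Real.pi)).hasDerivAt.comp_add_const x _)
  have e2 : (fun x => periodCutoff x + periodCutoff (x + 2 * Real.pi)) =ᶠ[𝓝 x] fun _ => 1 := by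
    -- At x = 0 a two-sided neighbourhood is needed; the sum is still 1 for y > -1, since then y +
    -- 2π ≥ 1.
    filter_upwards [Ioo_mem_nhds (show -1 < x by linarith) hx1] with y hy
    rw [periodCutoff, periodCutoff, Real.smoothTransition.zero_of_nonpos (x := y - 2 * Real.pi)
      (by linarith [hy.2]), add_sub_cancel_right,
      Real.smoothTransition.one_of_one_le (x := y + 2 * Real.pi) (by linarith [hy.1])]
    ring
  rw [← e1.deriv, e2.deriv_eq, deriv_const]

/-- The smooth transition function is Lipschitz. -/
theorem exists_lipschitzWith_smoothTransition :
    ∃ C : NNReal, LipschitzWith C Real.smoothTransition := by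
  have hd : Differentiable ℝ Real.smoothTransition :=
    (Real.smoothTransition.contDiff (n := 1)).differentiable (by simp)
  obtain ⟨C, hC⟩ := (isCompact_Icc (a := (0 : ℝ)) (b := 1)).exists_bound_of_continuousOn
    ((Real.smoothTransition.contDiff (n := 1)).continuous_deriv (by simp)).continuousOn
  refine ⟨C.toNNReal, lipschitzWith_of_nnnorm_deriv_le hd fun x => ?_⟩
  rw [← NNReal.coe_le_coe, coe_nnnorm, Real.coe_toNNReal']
  by_cases hx : x ∈ Icc (0 : ℝ) 1
  · exact (hC x hx).trans (le_max_left _ _)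
  · have : deriv Real.smoothTransition x = 0 := by
      by_cases h0 : x < 0
      · have : Real.smoothTransition =ᶠ[𝓝 x] fun _ => 0 := by
          filter_upwards [Iio_mem_nhds h0] with y hy
            using Real.smoothTransition.zero_of_nonpos (le_of_lt hy)
        rw [this.deriv_eq, deriv_const]
      · have h1 : 1 < x := not_le.1 fun h => hx ⟨not_lt.1 h0, h⟩
        have : Real.smoothTransition =ᶠ[𝓝 x] fun _ => 1 := by
          filter_upwards [Ioi_mem_nhds h1] with y hy
            using Real.smoothTransition.one_of_one_le (le_of_lt hy)
        rw [this.deriv_eq, deriv_const]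
    rw [this, norm_zero]
    exact le_max_right _ _

/-- Smooth periodic approximation of a Lipschitz function with the same Lipschitz constant. -/
theorem exists_smooth_approx {K : NNReal} (hK : LipschitzWith K f)
    (hper : Function.Periodic f (2 * Real.pi)) {ε : ℝ} (hε : 0 < ε) :
    ∃ k : ℝ → ℝ, ContDiff ℝ ((⊤ : ℕ∞) : WithTop ℕ∞) k ∧ LipschitzWith K k ∧
      Function.Periodic k (2 * Real.pi) ∧ ∀ x, |k x - f x| ≤ ε := by
  -- Mollifying at scale r moves the function by at most Kr ≤ ε; K + 1 avoids dividing by zero when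
  -- K = 0.
  set r : ℝ := ε / (K + 1) with hr
  have hK1 : (0 : ℝ) < K + 1 := by positivity
  have hr0 : 0 < r := by positivity
  let φ : ContDiffBump (0 : ℝ) := ⟨r / 2, r, by positivity, by linarith⟩
  have hφi : Integrable (φ.normed volume) := φ.integrable_normed
  have hconv : ∀ x, Integrable (fun t => φ.normed volume t * f (x - t)) := fun x =>
    (φ.continuous_normed.mul (hK.continuous.comp (continuous_const.sub
      continuous_id))).integrable_of_hasCompactSupport φ.hasCompactSupport_normed.mul_right
  set k : ℝ → ℝ := fun x => ∫ t, φ.normed volume t * f (x - t) with hk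
  have hkc : k = convolution (φ.normed volume) f (ContinuousLinearMap.lsmul ℝ ℝ) volume := by
    ext x
    simp [hk, convolution_def]
  refine ⟨k, ?_, ?_, ?_, ?_⟩
  · rw [hkc]
    exact φ.hasCompactSupport_normed.contDiff_convolution_left _ φ.contDiff_normed
      hK.continuous.locallyIntegrable
  · refine LipschitzWith.of_dist_le_mul fun x y => ?_
    rw [Real.dist_eq, hk]
    dsimp only
    rw [← integral_sub (hconv x) (hconv y)]
    calc |∫ t, (φ.normed volume t * f (x - t) - φ.normed volume t * f (y - t))|
        ≤ ∫ t, φ.normed volume t * (K * dist x y) := by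
          rw [← Real.norm_eq_abs]
          refine norm_integral_le_of_norm_le (hφi.mul_const _) (Eventually.of_forall fun t => ?_)
          rw [← mul_sub, norm_mul, Real.norm_of_nonneg (φ.nonneg_normed t)]
          refine mul_le_mul_of_nonneg_left ?_ (φ.nonneg_normed t)
          have := hK.dist_le_mul (x - t) (y - t)
          rwa [dist_sub_right, Real.dist_eq] at this
      _ = K * dist x y := by
          rw [integral_mul_const, φ.integral_normed, one_mul]
  · intro x
    simp only [hk]
    refine integral_congr_ae (Eventually.of_forall fun t => ?_)
    dsimp only
    rw [show x + 2 * Real.pi - t = x - t + 2 * Real.pi by ring, hper]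
  · intro x
    rw [hkc, ← Real.dist_eq]
    refine φ.dist_normed_convolution_le hK.continuous.aestronglyMeasurable fun y hy => ?_
    have hy' : dist y x < r := hy
    calc dist (f y) (f x) ≤ K * dist y x := hK.dist_le_mul y x
      _ ≤ K * r := by gcongr
      _ ≤ (K + 1) * r := by nlinarith
      _ = ε := by rw [hr]; field_simp

/-- Smooth cutoff functions near the graph of a Lipschitz function. -/
theorem exists_cutoff {K : NNReal} (hK : LipschitzWith K f)
    (hper : Function.Periodic f (2 * Real.pi)) :
    ∃ C : ℝ, 0 ≤ C ∧ ∀ h : ℝ, 0 < h → ∃ χ : ℂ → ℝ, ContDiff ℝ ((⊤ : ℕ∞) : WithTop ℕ∞) χ ∧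
      (∀ z, χ (z + ((2 * Real.pi : ℝ) : ℂ)) = χ z) ∧ (∀ z, 0 ≤ χ z) ∧ (∀ z, χ z ≤ 1) ∧
      (∀ z, f z.re - h / 4 ≤ z.im → χ z = 0) ∧ (∀ z, z.im ≤ f z.re - h → χ z = 1) ∧
      ∀ z, ‖fderiv ℝ χ z‖ ≤ C / h := by
  obtain ⟨C, hC⟩ := exists_lipschitzWith_smoothTransition
  refine ⟨C * (4 * (K + 1)), by positivity, fun h hh => ?_⟩
  obtain ⟨k, hk, hkL, hkp, hkf⟩ := exists_smooth_approx hK hper (show 0 < h / 4 by positivity)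
  have hin : ∀ z : ℂ, |k z.re - f z.re| ≤ h / 4 := fun z => hkf z.re
  -- As f is only Lipschitz, a smooth k within h/4 of it is used. The argument is nonpositive at
  -- depth at most h/4 and at least 1 at depth at least h, since h - h/4 - h/2 = h/4.
  refine ⟨fun z => Real.smoothTransition ((k z.re - z.im - h / 2) / (h / 4)), ?_, ?_,
    fun z => Real.smoothTransition.nonneg _, fun z => Real.smoothTransition.le_one _, ?_, ?_, ?_⟩
  · have h1 : ContDiff ℝ ((⊤ : ℕ∞) : WithTop ℕ∞) fun z : ℂ => k z.re :=
      hk.comp Complex.reCLM.contDiff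
    have h2 : ContDiff ℝ ((⊤ : ℕ∞) : WithTop ℕ∞) fun z : ℂ => z.im := Complex.imCLM.contDiff
    exact Real.smoothTransition.contDiff.comp (((h1.sub h2).sub contDiff_const).div_const _)
  · intro z
    have h1 : (z + ((2 * Real.pi : ℝ) : ℂ)).re = z.re + 2 * Real.pi := by simp
    have h2 : (z + ((2 * Real.pi : ℝ) : ℂ)).im = z.im := by simp
    simp only [h1, h2, hkp z.re]
  · intro z hz
    refine Real.smoothTransition.zero_of_nonpos (div_nonpos_of_nonpos_of_nonneg ?_ (by positivity))
    have := abs_le.1 (hin z)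
    linarith
  · intro z hz
    refine Real.smoothTransition.one_of_one_le ?_
    rw [one_le_div (by positivity)]
    have := abs_le.1 (hin z)
    linarith
  · intro z
    have hL : LipschitzWith (C * (4 * (K + 1)) / h).toNNReal
        (fun z : ℂ => Real.smoothTransition ((k z.re - z.im - h / 2) / (h / 4))) := by
      refine LipschitzWith.of_dist_le_mul fun z w => ?_
      rw [Real.coe_toNNReal _ (by positivity)]
      refine (hC.dist_le_mul _ _).trans ?_
      have h1 := hkL.dist_le_mul z.re w.re
      have h2 : dist z.re w.re ≤ dist z w := by
        rw [Real.dist_eq, dist_eq_norm, ← Complex.sub_re]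
        exact Complex.abs_re_le_norm _
      have h3 : dist z.im w.im ≤ dist z w := by
        rw [Real.dist_eq, dist_eq_norm, ← Complex.sub_im]
        exact Complex.abs_im_le_norm _
      have h4 : dist ((k z.re - z.im - h / 2) / (h / 4)) ((k w.re - w.im - h / 2) / (h / 4)) ≤
          4 * (K + 1) / h * dist z w := by
        have e : (k z.re - z.im - h / 2) / (h / 4) - (k w.re - w.im - h / 2) / (h / 4) =
            4 / h * ((k z.re - k w.re) - (z.im - w.im)) := by
          field_simp
          ring
        rw [Real.dist_eq, e, abs_mul, abs_of_pos (by positivity : 0 < 4 / h)]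
        rw [Real.dist_eq] at h1 h3
        have h5 : |(k z.re - k w.re) - (z.im - w.im)| ≤ (K + 1) * dist z w := by
          calc _ ≤ |k z.re - k w.re| + |z.im - w.im| := abs_sub _ _
            _ ≤ K * dist z w + dist z w := by
                refine add_le_add (h1.trans ?_) h3
                gcongr
            _ = _ := by ring
        calc 4 / h * |(k z.re - k w.re) - (z.im - w.im)| ≤ 4 / h * ((K + 1) * dist z w) := by
              gcongr
          _ = _ := by ring
      calc (C : ℝ) * dist ((k z.re - z.im - h / 2) / (h / 4)) ((k w.re - w.im - h / 2) / (h / 4))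
          ≤ C * (4 * (K + 1) / h * dist z w) := by gcongr
        _ = _ := by ring
    have := norm_fderiv_le_of_lipschitz ℝ hL (x₀ := z)
    rwa [Real.coe_toNNReal _ (by positivity)] at this

end

/-! ### Integration by parts over one period -/

section

variable {f : ℝ → ℝ}

theorem contDiff_mul_of_tsupport_subset {U : Set ℂ} (hU : IsOpen U) {ρ a : ℂ → ℝ}
    (hρ : ContDiff ℝ ((⊤ : ℕ∞) : WithTop ℕ∞) ρ)
    (ha : ContDiffOn ℝ ((⊤ : ℕ∞) : WithTop ℕ∞) a U) (hs : tsupport ρ ⊆ U) :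
    ContDiff ℝ ((⊤ : ℕ∞) : WithTop ℕ∞) (fun z => ρ z * a z) := by
  rw [contDiff_iff_contDiffAt]
  intro z
  by_cases hz : z ∈ tsupport ρ
  · exact hρ.contDiffAt.mul (ha.contDiffAt (hU.mem_nhds (hs hz)))
  · refine (contDiffAt_const (c := (0 : ℝ))).congr_of_eventuallyEq ?_
    filter_upwards [(isClosed_tsupport ρ).isOpen_compl.mem_nhds hz] with w hw
    rw [image_eq_zero_of_notMem_tsupport hw, zero_mul]

/-- The compact part of the domain where a test field is supported. -/
def testRegion (f : ℝ → ℝ) (R η : ℝ) : Set ℂ :=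
  ((Icc 0 (2 * Real.pi + 1)) ×ℂ (Ici (-R))) ∩ {z | z.im ≤ f z.re - η}

theorem isCompact_testRegion (hf : Continuous f) (hper : Function.Periodic f (2 * Real.pi))
    (R η : ℝ) : IsCompact (testRegion f R η) := by
  obtain ⟨M, hM⟩ := exists_bounds hf hper
  have h1 : IsCompact ((Icc 0 (2 * Real.pi + 1)) ×ℂ (Icc (-R) (M - η))) :=
    isCompact_Icc.reProdIm isCompact_Icc
  have h2 : IsClosed {z : ℂ | z.im ≤ f z.re - η} :=
    isClosed_le Complex.continuous_im ((hf.comp Complex.continuous_re).sub continuous_const)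
  convert h1.inter_right h2 using 1
  ext z
  constructor
  · rintro ⟨⟨h3, h4⟩, h5⟩
    have h6 : z.im ≤ f z.re - η := h5
    have := (abs_le.1 (hM z.re)).2
    exact ⟨⟨h3, h4, by linarith⟩, h5⟩
  · rintro ⟨⟨h3, h4⟩, h5⟩
    exact ⟨⟨h3, h4.1⟩, h5⟩

theorem testRegion_subset_domain {R η : ℝ} (hη : 0 < η) : testRegion f R η ⊆ domain f := by
  rintro z ⟨-, hz⟩
  have h1 : z.im ≤ f z.re - η := hz
  change z.im < f z.re
  linarith

/-- Products of a cutoff near the graph, a cutoff in the abscissa and a function that vanishes far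
down are admissible test functions. -/
theorem test_mul {R η : ℝ} (hf : Continuous f) (hper : Function.Periodic f (2 * Real.pi))
    (hη : 0 < η) {χ F : ℂ → ℝ} {q : ℝ → ℝ}
    (hχ : ContDiff ℝ ((⊤ : ℕ∞) : WithTop ℕ∞) χ) (hχ0 : ∀ z, f z.re - η ≤ z.im → χ z = 0)
    (hq : ContDiff ℝ ((⊤ : ℕ∞) : WithTop ℕ∞) q) (hq0 : ∀ x, x < 0 → q x = 0)
    (hq1 : ∀ x, 2 * Real.pi + 1 < x → q x = 0)
    (hF : ContDiffOn ℝ ((⊤ : ℕ∞) : WithTop ℕ∞) F (domain f)) (hFR : ∀ z, z.im < -R → F z = 0) :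
    ContDiff ℝ ((⊤ : ℕ∞) : WithTop ℕ∞) (fun z => χ z * q z.re * F z) ∧
      HasCompactSupport (fun z => χ z * q z.re * F z) ∧
      tsupport (fun z => χ z * q z.re * F z) ⊆ domain f := by
  have hcl : IsClosed {z : ℂ | z.im ≤ f z.re - η} :=
    isClosed_le Complex.continuous_im ((hf.comp Complex.continuous_re).sub continuous_const)
  have hsup : Function.support (fun z => χ z * q z.re * F z) ⊆ testRegion f R η := by
    intro z hz
    have h1 : χ z ≠ 0 := left_ne_zero_of_mul (left_ne_zero_of_mul hz)
    have h2 : q z.re ≠ 0 := right_ne_zero_of_mul (left_ne_zero_of_mul hz)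
    have h3 : F z ≠ 0 := right_ne_zero_of_mul hz
    exact ⟨⟨⟨not_lt.1 fun h => h2 (hq0 _ h), not_lt.1 fun h => h2 (hq1 _ h)⟩,
      not_lt.1 fun h => h3 (hFR _ h)⟩, (not_le.1 fun h => h1 (hχ0 _ h)).le⟩
  have hK := isCompact_testRegion hf hper R η
  refine ⟨?_, HasCompactSupport.of_support_subset_isCompact hK hsup,
    (closure_minimal hsup hK.isClosed).trans (testRegion_subset_domain hη)⟩
  refine contDiff_mul_of_tsupport_subset (isOpen_domain hf)
    (hχ.mul (hq.comp Complex.reCLM.contDiff)) hF ?_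
  refine (closure_minimal (t := {z : ℂ | z.im ≤ f z.re - η}) ?_ hcl).trans ?_
  · intro z hz
    exact (not_le.1 fun h => left_ne_zero_of_mul hz (hχ0 _ h)).le
  · intro z hz
    have h1 : z.im ≤ f z.re - η := hz
    change z.im < f z.re
    linarith

theorem integrableOn_cell_of_testRegion {R η : ℝ} (hf : Continuous f) {G : ℂ → ℝ}
    (hG : IntegrableOn G (testRegion f R η))
    (h0 : ∀ z ∈ cell f, f z.re - η < z.im → G z = 0) (hR : ∀ z, z.im < -R → G z = 0) :
    IntegrableOn G (cell f) := by
  refine IntegrableOn.of_forall_sdiff_eq_zero hG (measurableSet_cell hf) ?_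
  rintro z ⟨hz, hzn⟩
  by_cases h1 : z.im < -R
  · exact hR z h1
  · refine h0 z hz (not_le.1 fun h => hzn ⟨⟨⟨hz.2.1, ?_⟩, not_lt.1 h1⟩, h⟩)
    linarith [hz.2.2]

/-- Integration by parts over a period of a divergence-free field times a cutoff. -/
theorem integral_cell_cutoff (hf : Continuous f) (hper : Function.Periodic f (2 * Real.pi))
    {v : ℂ → ℝ} {V : ℂ → ℂ} (hv : MemHdot1 f v V) {R η : ℝ} (hη : 0 < η) {χ F₁ F₂ : ℂ → ℝ}
    (hχ : ContDiff ℝ ((⊤ : ℕ∞) : WithTop ℕ∞) χ)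
    (hχp : ∀ z, χ (z + ((2 * Real.pi : ℝ) : ℂ)) = χ z)
    (hχ0 : ∀ z, f z.re - η ≤ z.im → χ z = 0)
    (hF₁ : ContDiffOn ℝ ((⊤ : ℕ∞) : WithTop ℕ∞) F₁ (domain f))
    (hF₂ : ContDiffOn ℝ ((⊤ : ℕ∞) : WithTop ℕ∞) F₂ (domain f))
    (hp₁ : ∀ z ∈ domain f, F₁ (z + ((2 * Real.pi : ℝ) : ℂ)) = F₁ z)
    (hp₂ : ∀ z ∈ domain f, F₂ (z + ((2 * Real.pi : ℝ) : ℂ)) = F₂ z)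
    (hR₁ : ∀ z, z.im < -R → F₁ z = 0) (hR₂ : ∀ z, z.im < -R → F₂ z = 0)
    (hdiv : ∀ z ∈ domain f, fderiv ℝ F₁ z 1 + fderiv ℝ F₂ z Complex.I = 0) :
    ∫ z in cell f, v z * (F₁ z * fderiv ℝ χ z 1 + F₂ z * fderiv ℝ χ z Complex.I) =
      -∫ z in cell f, χ z * (F₁ z * (V z).re + F₂ z * (V z).im) := by
  set τ : ℂ := ((2 * Real.pi : ℝ) : ℂ) with hτ
  have hU := isOpen_domain hf
  have hpi := Real.two_pi_pos
  have hpi3 := Real.pi_gt_three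
  -- Test functions must have compact support in the domain, so the periodic integral is localized
  -- by θ in the abscissa and recovered at the end by summing translates.
  set θ := periodCutoff with hθ
  have hθs : ContDiff ℝ ((⊤ : ℕ∞) : WithTop ℕ∞) θ := contDiff_periodCutoff
  have hθ's : ContDiff ℝ ((⊤ : ℕ∞) : WithTop ℕ∞) (deriv θ) :=
    (contDiff_infty_iff_deriv.1 hθs).2
  have hθ0 : ∀ x, x < 0 → θ x = 0 := fun x hx => periodCutoff_of_nonpos hx.le
  have hθ1 : ∀ x, 2 * Real.pi + 1 < x → θ x = 0 := fun x hx => periodCutoff_of_le hx.le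
  obtain ⟨s1, c1, t1⟩ := test_mul hf hper hη hχ hχ0 hθs hθ0 hθ1 hF₁ hR₁
  obtain ⟨s2, c2, t2⟩ := test_mul hf hper hη hχ hχ0 hθs hθ0 hθ1 hF₂ hR₂
  obtain ⟨s3, c3, t3⟩ := test_mul hf hper hη hχ hχ0 hθ's (fun x => deriv_periodCutoff_of_neg)
    (fun x => deriv_periodCutoff_of_lt) hF₁ hR₁
  have w1 := hv.weakGradient.integral_eq _ s1 c1 t1 1
  have w2 := hv.weakGradient.integral_eq _ s2 c2 t2 Complex.I
  have i1 := (hv.weakGradient.integrable_mul (continuous_fderiv_apply s1 1)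
    (hasCompactSupport_fderiv_apply c1 1) ((tsupport_fderiv_apply 1).trans t1)).integrableOn
    (s := domain f)
  have i2 := (hv.weakGradient.integrable_mul (continuous_fderiv_apply s2 Complex.I)
    (hasCompactSupport_fderiv_apply c2 Complex.I)
    ((tsupport_fderiv_apply Complex.I).trans t2)).integrableOn (s := domain f)
  have i3 := (hv.weakGradient.integrable_mul s3.continuous c3 t3).integrableOn (s := domain f)
  have j1 := (hv.weakGradient.integrable_mul_inner s1.continuous c1 t1 1).integrableOn
    (s := domain f)
  have j2 := (hv.weakGradient.integrable_mul_inner s2.continuous c2 t2 Complex.I).integrableOn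
    (s := domain f)
  have hχd : ∀ z, DifferentiableAt ℝ χ z := fun z => (hχ.differentiable (by simp)) z
  have hθd : ∀ z : ℂ, HasFDerivAt (fun z : ℂ => θ z.re) (deriv θ z.re • Complex.reCLM) z :=
    fun z => ((hθs.differentiable (by simp)) z.re).hasDerivAt.comp_hasFDerivAt z
      Complex.reCLM.hasFDerivAt
  have hF₁d : ∀ z ∈ domain f, DifferentiableAt ℝ F₁ z := fun z hz =>
    (hF₁.contDiffAt (hU.mem_nhds hz)).differentiableAt (by simp)
  have hF₂d : ∀ z ∈ domain f, DifferentiableAt ℝ F₂ z := fun z hz =>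
    (hF₂.contDiffAt (hU.mem_nhds hz)).differentiableAt (by simp)
  have hder : ∀ (F : ℂ → ℝ) (e z : ℂ), DifferentiableAt ℝ F z →
      fderiv ℝ (fun z => χ z * θ z.re * F z) z e =
        χ z * θ z.re * fderiv ℝ F z e +
          F z * (χ z * (deriv θ z.re * e.re) + θ z.re * fderiv ℝ χ z e) := by
    intro F e z hF
    rw [(((hχd z).hasFDerivAt.fun_mul (hθd z)).fun_mul hF.hasFDerivAt).fderiv]
    simp
    ring
  -- In the product rule the divergence of the field drops out. What remains is the wanted term
  -- weighted by θ and one term containing θ'.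
  have key : ∀ z ∈ domain f,
      v z * fderiv ℝ (fun z => χ z * θ z.re * F₁ z) z 1 +
        v z * fderiv ℝ (fun z => χ z * θ z.re * F₂ z) z Complex.I =
      θ z.re * (v z * (F₁ z * fderiv ℝ χ z 1 + F₂ z * fderiv ℝ χ z Complex.I)) +
        v z * (χ z * deriv θ z.re * F₁ z) := by
    intro z hz
    rw [hder F₁ 1 z (hF₁d z hz), hder F₂ Complex.I z (hF₂d z hz), Complex.one_re, Complex.I_re]
    linear_combination v z * χ z * θ z.re * hdiv z hz
  have i4 : IntegrableOn (fun z => θ z.re *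
      (v z * (F₁ z * fderiv ℝ χ z 1 + F₂ z * fderiv ℝ χ z Complex.I))) (domain f) := by
    refine ((i1.add i2).sub i3).congr_fun (fun z hz => ?_) hU.measurableSet
    have := key z hz
    simp only [Pi.add_apply, Pi.sub_apply]
    linarith
  have e1 : (∫ z in domain f, θ z.re *
      (v z * (F₁ z * fderiv ℝ χ z 1 + F₂ z * fderiv ℝ χ z Complex.I))) +
      ∫ z in domain f, deriv θ z.re * (v z * (χ z * F₁ z)) =
      -∫ z in domain f, θ z.re * (χ z * (F₁ z * (V z).re + F₂ z * (V z).im)) := by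
    have e2 : ∫ z in domain f, deriv θ z.re * (v z * (χ z * F₁ z)) =
        ∫ z in domain f, v z * (χ z * deriv θ z.re * F₁ z) :=
      integral_congr_ae (Eventually.of_forall fun z => by ring)
    rw [e2, ← integral_add i4 i3, ← setIntegral_congr_fun hU.measurableSet key,
      integral_add i1 i2, w1, w2, ← neg_add, ← integral_add j1 j2]
    congr 1
    refine integral_congr_ae (Eventually.of_forall fun z => ?_)
    simp only [Complex.inner]
    simp
    ring
  have hcont : ∀ e : ℂ, Continuous fun z => fderiv ℝ χ z e := fun e => continuous_fderiv_apply hχ e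
  have hK := isCompact_testRegion hf hper R η
  have hKU := testRegion_subset_domain (f := f) (R := R) hη
  have hvK := hv.weakGradient.locallyIntegrable.integrableOn_compact_subset hKU hK
  have hVK := hv.weakGradient.locallyIntegrable_grad.integrableOn_compact_subset hKU hK
  have hF₁c := hF₁.continuousOn.mono hKU
  have hF₂c := hF₂.continuousOn.mono hKU
  have hχ' : ∀ (e z : ℂ), f z.re - η < z.im → fderiv ℝ χ z e = 0 := by
    intro e z hz
    have hop : IsOpen {z : ℂ | f z.re - η < z.im} :=
      isOpen_lt ((hf.comp Complex.continuous_re).sub continuous_const) Complex.continuous_im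
    have : χ =ᶠ[𝓝 z] fun _ => 0 := by
      filter_upwards [hop.mem_nhds hz] with w hw using hχ0 w (le_of_lt hw)
    rw [this.fderiv_eq]
    simp
  have ga : IntegrableOn (fun z => v z * (F₁ z * fderiv ℝ χ z 1 + F₂ z * fderiv ℝ χ z Complex.I))
      (cell f) := by
    refine integrableOn_cell_of_testRegion (R := R) hf (hvK.mul_continuousOn
      ((hF₁c.mul (hcont _).continuousOn).add (hF₂c.mul (hcont _).continuousOn)) hK) ?_ ?_
    · intro z _ hz
      rw [hχ' _ z hz, hχ' _ z hz]; ring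
    · intro z hz
      rw [hR₁ z hz, hR₂ z hz]; ring
  have gb : IntegrableOn (fun z => v z * (χ z * F₁ z)) (cell f) := by
    refine integrableOn_cell_of_testRegion (R := R) hf (hvK.mul_continuousOn
      (hχ.continuous.continuousOn.mul hF₁c) hK) ?_ ?_
    · intro z _ hz
      rw [hχ0 z hz.le]; ring
    · intro z hz
      rw [hR₁ z hz]; ring
  have gc : IntegrableOn (fun z => χ z * (F₁ z * (V z).re + F₂ z * (V z).im)) (cell f) := by
    refine integrableOn_cell_of_testRegion (R := R) hf (IntegrableOn.continuousOn_mul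
      hχ.continuous.continuousOn (Integrable.add
        (IntegrableOn.continuousOn_mul hF₁c hVK.re hK)
        (IntegrableOn.continuousOn_mul hF₂c hVK.im hK)) hK) ?_ ?_
    · intro z _ hz
      rw [hχ0 z hz.le]; ring
    · intro z hz
      rw [hR₁ z hz, hR₂ z hz]; ring
  have hχfp : ∀ z, fderiv ℝ χ (z + τ) = fderiv ℝ χ z := by
    intro z
    rw [← fderiv_comp_add_right]
    congr 1
    ext w
    exact hχp w
  have hq1 : ∀ x, 2 * (2 * Real.pi) ≤ x → θ x = 0 := fun x hx => hθ1 x (by linarith)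
  have hq2 : ∀ x, 2 * (2 * Real.pi) ≤ x → deriv θ x = 0 :=
    fun x hx => deriv_periodCutoff_of_lt (by linarith)
  -- Unfolding replaces the weight θ by 1 and the weight θ' by 0.
  rw [setIntegral_domain_eq_cell hf hper hθs.continuous hθ0 hq1 _ ga,
    setIntegral_domain_eq_cell hf hper hθ's.continuous (fun x => deriv_periodCutoff_of_neg) hq2 _ gb,
    setIntegral_domain_eq_cell hf hper hθs.continuous hθ0 hq1 _ gc] at e1
  · have hmc := measurableSet_cell hf
    have u1 : ∀ G : ℂ → ℝ, ∫ z in cell f, (θ z.re + θ (z.re + 2 * Real.pi)) * G z =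
        ∫ z in cell f, G z := fun G => setIntegral_congr_fun hmc fun z hz => by
      rw [periodCutoff_add hz.2.1 hz.2.2, one_mul]
    have u2 : ∀ G : ℂ → ℝ, ∫ z in cell f, (deriv θ z.re + deriv θ (z.re + 2 * Real.pi)) * G z =
        0 := fun G => setIntegral_eq_zero_of_forall_eq_zero fun z hz => by
      rw [deriv_periodCutoff_add hz.2.1 hz.2.2, zero_mul]
    rwa [u1, u1, u2, add_zero] at e1
  · filter_upwards [hv.ae_periodic hf hper] with z hz hzd
    rw [hz hzd, hχp, hp₁ z hzd, hp₂ z hzd]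
  · exact Eventually.of_forall fun z hzd => by rw [hv.periodic z hzd, hχp, hp₁ z hzd]
  · exact Eventually.of_forall fun z hzd => by
      rw [hv.periodic z hzd, hχfp, hp₁ z hzd, hp₂ z hzd]

end

/-! ### Orthogonality of divergence-free fields to zero-trace gradients -/

section

variable {f : ℝ → ℝ}

theorem volume_cell_inter_lt_top (hf : Continuous f) (hper : Function.Periodic f (2 * Real.pi))
    (R : ℝ) : volume (cell f ∩ {z | -R ≤ z.im}) < ∞ := by
  refine lt_of_le_of_lt (measure_mono ?_) (isCompact_testRegion hf hper R 0).measure_lt_top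
  rintro z ⟨⟨hz, hz0, hz1⟩, hzR⟩
  have h1 : z.im < f z.re := hz
  exact ⟨⟨⟨hz0, by linarith⟩, hzR⟩, by change z.im ≤ f z.re - 0; linarith⟩

/-- A divergence-free periodic field that vanishes far down is orthogonal to gradients of functions
with zero trace. -/
theorem integral_cell_eq_zero_of_div_eq_zero {K : NNReal} (hK : LipschitzWith K f)
    (hper : Function.Periodic f (2 * Real.pi))
    {v : ℂ → ℝ} {V : ℂ → ℂ} (hv : MemHdot1 f v V) (hv0 : HasTrace f v 0) {R B : ℝ}
    {F₁ F₂ : ℂ → ℝ}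
    (hF₁ : ContDiffOn ℝ ((⊤ : ℕ∞) : WithTop ℕ∞) F₁ (domain f))
    (hF₂ : ContDiffOn ℝ ((⊤ : ℕ∞) : WithTop ℕ∞) F₂ (domain f))
    (hp₁ : ∀ z ∈ domain f, F₁ (z + ((2 * Real.pi : ℝ) : ℂ)) = F₁ z)
    (hp₂ : ∀ z ∈ domain f, F₂ (z + ((2 * Real.pi : ℝ) : ℂ)) = F₂ z)
    (hR₁ : ∀ z, z.im < -R → F₁ z = 0) (hR₂ : ∀ z, z.im < -R → F₂ z = 0)
    (hB₁ : ∀ z ∈ domain f, |F₁ z| ≤ B) (hB₂ : ∀ z ∈ domain f, |F₂ z| ≤ B)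
    (hdiv : ∀ z ∈ domain f, fderiv ℝ F₁ z 1 + fderiv ℝ F₂ z Complex.I = 0) :
    ∫ z in cell f, (F₁ z * (V z).re + F₂ z * (V z).im) = 0 := by
  have hf := hK.continuous
  have hmc := measurableSet_cell hf
  have hB0 : 0 ≤ B := by
    obtain ⟨M, hM⟩ := exists_bounds hf hper
    have h1 : (⟨0, -M - 1⟩ : ℂ) ∈ domain f := by
      change -M - 1 < f 0
      linarith [(abs_le.1 (hM 0)).1]
    exact (abs_nonneg _).trans (hB₁ _ h1)
  obtain ⟨C, hC, hχ⟩ := exists_cutoff hK hper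
  choose! χ hχs hχp hχn hχl hχ0 hχ1 hχd using hχ
  set G : ℂ → ℝ := fun z => F₁ z * (V z).re + F₂ z * (V z).im with hG
  have hGb : ∀ z ∈ cell f, ‖G z‖ ≤ 2 * B * ‖V z‖ := by
    intro z hz
    calc ‖G z‖ ≤ |F₁ z * (V z).re| + |F₂ z * (V z).im| := abs_add_le _ _
      _ ≤ B * ‖V z‖ + B * ‖V z‖ := by
          rw [abs_mul, abs_mul]
          exact add_le_add
            (mul_le_mul (hB₁ z hz.1) (Complex.abs_re_le_norm _) (abs_nonneg _) hB0)
            (mul_le_mul (hB₂ z hz.1) (Complex.abs_im_le_norm _) (abs_nonneg _) hB0)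
      _ = _ := by ring
  have hmR : MeasurableSet {z : ℂ | -R ≤ z.im} :=
    (isClosed_le continuous_const Complex.continuous_im).measurableSet
  have hVm : AEStronglyMeasurable V (volume.restrict (cell f)) := hv.memLp_grad.1
  have hF₁m : AEStronglyMeasurable F₁ (volume.restrict (cell f)) :=
    (hF₁.continuousOn.mono cell_subset_domain).aestronglyMeasurable hmc
  have hF₂m : AEStronglyMeasurable F₂ (volume.restrict (cell f)) :=
    (hF₂.continuousOn.mono cell_subset_domain).aestronglyMeasurable hmc
  have hVre : AEStronglyMeasurable (fun z => (V z).re) (volume.restrict (cell f)) :=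
    Complex.continuous_re.comp_aestronglyMeasurable hVm
  have hVim : AEStronglyMeasurable (fun z => (V z).im) (volume.restrict (cell f)) :=
    Complex.continuous_im.comp_aestronglyMeasurable hVm
  have hGm : AEStronglyMeasurable G (volume.restrict (cell f)) :=
    (hF₁m.mul hVre).add (hF₂m.mul hVim)
  have hVi : IntegrableOn V (cell f ∩ {z | -R ≤ z.im}) := by
    have : IsFiniteMeasure (volume.restrict (cell f ∩ {z : ℂ | -R ≤ z.im})) :=
      ⟨by rw [Measure.restrict_apply_univ]; exact volume_cell_inter_lt_top hf hper R⟩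
    exact (hv.memLp_grad.mono_measure (Measure.restrict_mono inter_subset_left le_rfl)).integrable
      (by norm_num)
  have hGi : IntegrableOn G (cell f) := by
    have h1 : IntegrableOn G (cell f ∩ {z | -R ≤ z.im}) := by
      refine Integrable.mono' (hVi.norm.const_mul (2 * B))
        (hGm.mono_measure (Measure.restrict_mono inter_subset_left le_rfl)) ?_
      filter_upwards [ae_restrict_mem (hmc.inter hmR)] with z hz using hGb z hz.1
    refine h1.of_forall_sdiff_eq_zero hmc ?_
    rintro z ⟨hz, hzn⟩
    have : z.im < -R := not_le.1 fun h => hzn ⟨hz, h⟩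
    simp [hG, hR₁ z this, hR₂ z this]
  have hlim1 : Tendsto (fun h => ∫ z in cell f, χ h z * G z) (𝓝[>] 0) (𝓝 (∫ z in cell f, G z)) := by
    refine tendsto_integral_filter_of_dominated_convergence (fun z => ‖G z‖) ?_ ?_ hGi.norm ?_
    · filter_upwards [self_mem_nhdsWithin] with h hh
      exact (hχs h hh).continuous.aestronglyMeasurable.mul hGm
    · filter_upwards [self_mem_nhdsWithin] with h hh
      refine Eventually.of_forall fun z => ?_
      rw [norm_mul, Real.norm_of_nonneg (hχn h hh z)]
      exact mul_le_of_le_one_left (norm_nonneg _) (hχl h hh z)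
    · filter_upwards [ae_restrict_mem hmc] with z hz
      have hz1 : z.im < f z.re := hz.1
      refine tendsto_const_nhds.congr' ?_
      filter_upwards [Ioo_mem_nhdsGT (sub_pos.2 hz1)] with h hh
      rw [hχ1 h hh.1 z (by linarith [hh.2]), one_mul]
  -- The derivative of the cutoff is O(1/h) and is supported in the strip of thickness h, so the
  -- error is bounded by the very mean of |v| that zero trace sends to 0.
  have hlim2 : Tendsto (fun h => ∫ z in cell f, v z * (F₁ z * fderiv ℝ (χ h) z 1 +
      F₂ z * fderiv ℝ (χ h) z Complex.I)) (𝓝[>] 0) (𝓝 0) := by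
    rw [tendsto_zero_iff_enorm_tendsto_zero]
    have hv0' : Tendsto (fun h : ℝ => ENNReal.ofReal (2 * B * C) *
        ((∫⁻ z in strip f h, ‖v z - (0 : ℝ → ℝ) z.re‖ₑ) / ENNReal.ofReal h)) (𝓝[>] 0) (𝓝 0) := by
      have := ENNReal.Tendsto.const_mul hv0 (a := ENNReal.ofReal (2 * B * C))
        (Or.inr ENNReal.ofReal_ne_top)
      rwa [mul_zero] at this
    refine tendsto_of_tendsto_of_tendsto_of_le_of_le' tendsto_const_nhds hv0'
      (Eventually.of_forall fun _ => zero_le) ?_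
    filter_upwards [self_mem_nhdsWithin] with h hh
    have hh0 : (0 : ℝ) < h := hh
    have hzero : ∀ z, z.im ≤ f z.re - h → fderiv ℝ (χ h) z = 0 := by
      intro z hz
      -- Below the strip the cutoff attains its maximum 1, so its derivative vanishes, also on the
      -- edge of the strip.
      have : IsLocalMax (χ h) z := Eventually.of_forall fun w => by
        rw [hχ1 h hh z hz]
        exact hχl h hh w
      exact this.fderiv_eq_zero
    calc ‖∫ z in cell f, v z * (F₁ z * fderiv ℝ (χ h) z 1 + F₂ z * fderiv ℝ (χ h) z Complex.I)‖ₑ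
        ≤ ∫⁻ z in cell f,
          ‖v z * (F₁ z * fderiv ℝ (χ h) z 1 + F₂ z * fderiv ℝ (χ h) z Complex.I)‖ₑ :=
          enorm_integral_le_lintegral_enorm _
      _ ≤ ∫⁻ z in cell f, (strip f h).indicator
          (fun z => ENNReal.ofReal (2 * B * C / h) * ‖v z‖ₑ) z := by
          refine setLIntegral_mono' hmc fun z hz => ?_
          by_cases hzs : z ∈ strip f h
          · rw [indicator_of_mem hzs, enorm_mul, mul_comm]
            gcongr
            rw [← ofReal_norm]
            refine ENNReal.ofReal_le_ofReal ?_
            have hd : ∀ e : ℂ, ‖e‖ = 1 → |fderiv ℝ (χ h) z e| ≤ C / h := by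
              intro e he
              have := (fderiv ℝ (χ h) z).le_opNorm e
              rw [he, mul_one] at this
              exact this.trans (hχd h hh z)
            calc ‖F₁ z * fderiv ℝ (χ h) z 1 + F₂ z * fderiv ℝ (χ h) z Complex.I‖
                ≤ |F₁ z * fderiv ℝ (χ h) z 1| + |F₂ z * fderiv ℝ (χ h) z Complex.I| :=
                  abs_add_le _ _
              _ ≤ B * (C / h) + B * (C / h) := by
                  rw [abs_mul, abs_mul]
                  exact add_le_add
                    (mul_le_mul (hB₁ z hz.1) (hd 1 norm_one) (abs_nonneg _) hB0)
                    (mul_le_mul (hB₂ z hz.1) (hd _ Complex.norm_I) (abs_nonneg _) hB0)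
              _ = 2 * B * C / h := by ring
          · have : z.im ≤ f z.re - h := not_lt.1 fun h' => hzs ⟨hz, h'⟩
            rw [hzero z this, indicator_of_notMem hzs]
            simp
      _ = ∫⁻ z in strip f h, ENNReal.ofReal (2 * B * C / h) * ‖v z‖ₑ := by
          rw [setLIntegral_indicator (measurableSet_strip hf h),
            inter_eq_self_of_subset_left (strip_subset_cell h)]
      _ = _ := by
          rw [lintegral_const_mul' _ _ ENNReal.ofReal_ne_top, ENNReal.ofReal_div_of_pos hh0]
          simp only [Pi.zero_apply, sub_zero, div_eq_mul_inv]
          ring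
  have heq : ∀ᶠ h in 𝓝[>] (0 : ℝ), ∫ z in cell f, χ h z * G z =
      -∫ z in cell f, v z * (F₁ z * fderiv ℝ (χ h) z 1 + F₂ z * fderiv ℝ (χ h) z Complex.I) := by
    filter_upwards [self_mem_nhdsWithin] with h hh
    have hh0 : (0 : ℝ) < h := hh
    rw [integral_cell_cutoff hf hper hv (η := h / 4) (by positivity) (hχs h hh) (hχp h hh)
      (hχ0 h hh) hF₁ hF₂ hp₁ hp₂ hR₁ hR₂ hdiv, neg_neg]
  have := tendsto_nhds_unique (hlim1.congr' heq) hlim2.neg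
  rwa [neg_zero] at this

end

/-! ### The variational identity for the potential -/

section

variable {f : ℝ → ℝ} {g L : ℂ → ℂ}

/-- The rotated gradient of the stream function `η (im z) * im (K z)`. -/
noncomputable def streamField₁ (η : ℝ → ℝ) (K : ℂ → ℂ) (z : ℂ) : ℝ :=
  η z.im * (deriv K z).re + deriv η z.im * (K z).im

/-- The second component of the rotated gradient of `η (im z) * im (K z)`. -/
noncomputable def streamField₂ (η : ℝ → ℝ) (K : ℂ → ℂ) (z : ℂ) : ℝ :=
  -(η z.im * (deriv K z).im)

theorem contDiffOn_re_im {U : Set ℂ} (hU : IsOpen U) {K : ℂ → ℂ} (hK : DifferentiableOn ℂ K U) :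
    ContDiffOn ℝ ((⊤ : ℕ∞) : WithTop ℕ∞) (fun z => (K z).re) U ∧
      ContDiffOn ℝ ((⊤ : ℕ∞) : WithTop ℕ∞) (fun z => (K z).im) U := by
  have h : ContDiffOn ℝ ((⊤ : ℕ∞) : WithTop ℕ∞) K U := (hK.contDiffOn hU).restrict_scalars ℝ
  exact ⟨Complex.reCLM.contDiff.comp_contDiffOn h, Complex.imCLM.contDiff.comp_contDiffOn h⟩

theorem contDiffOn_streamField {U : Set ℂ} (hU : IsOpen U) {K : ℂ → ℂ}
    (hK : DifferentiableOn ℂ K U) {η : ℝ → ℝ} (hη : ContDiff ℝ ((⊤ : ℕ∞) : WithTop ℕ∞) η) :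
    ContDiffOn ℝ ((⊤ : ℕ∞) : WithTop ℕ∞) (streamField₁ η K) U ∧
      ContDiffOn ℝ ((⊤ : ℕ∞) : WithTop ℕ∞) (streamField₂ η K) U := by
  have h1 : ContDiff ℝ ((⊤ : ℕ∞) : WithTop ℕ∞) fun z : ℂ => η z.im :=
    hη.comp Complex.imCLM.contDiff
  have h2 : ContDiff ℝ ((⊤ : ℕ∞) : WithTop ℕ∞) fun z : ℂ => deriv η z.im :=
    (contDiff_infty_iff_deriv.1 hη).2.comp Complex.imCLM.contDiff
  obtain ⟨d1, d2⟩ := contDiffOn_re_im hU (hK.deriv hU)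
  exact ⟨(h1.contDiffOn.mul d1).add (h2.contDiffOn.mul (contDiffOn_re_im hU hK).2),
    (h1.contDiffOn.mul d2).neg⟩

/-- The field is (∂_y ψ, -∂_x ψ) for ψ = η(y) Im K, so its divergence vanishes by symmetry of second
derivatives. Where η = 1 it is the gradient of Re K; cutting off the stream function rather than the
gradient preserves zero divergence. -/
theorem div_streamField {U : Set ℂ} (hU : IsOpen U) {K : ℂ → ℂ} (hK : DifferentiableOn ℂ K U)
    {η : ℝ → ℝ} (hη : ContDiff ℝ ((⊤ : ℕ∞) : WithTop ℕ∞) η) {z : ℂ} (hz : z ∈ U) :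
    fderiv ℝ (streamField₁ η K) z 1 + fderiv ℝ (streamField₂ η K) z Complex.I = 0 := by
  have hη' := (contDiff_infty_iff_deriv.1 hη).2
  have a1 : HasFDerivAt (fun z : ℂ => η z.im) (deriv η z.im • Complex.imCLM) z :=
    ((hη.differentiable (by simp)) z.im).hasDerivAt.comp_hasFDerivAt z Complex.imCLM.hasFDerivAt
  have a2 : HasFDerivAt (fun z : ℂ => deriv η z.im) (deriv (deriv η) z.im • Complex.imCLM) z :=
    ((hη'.differentiable (by simp)) z.im).hasDerivAt.comp_hasFDerivAt z Complex.imCLM.hasFDerivAt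
  have k1 := (hK.differentiableAt (hU.mem_nhds hz)).hasDerivAt.complexToReal_fderiv
  have k2 := ((hK.deriv hU).differentiableAt (hU.mem_nhds hz)).hasDerivAt.complexToReal_fderiv
  have b1 : HasFDerivAt (fun z => (deriv K z).re) _ z := Complex.reCLM.hasFDerivAt.comp z k2
  have b2 : HasFDerivAt (fun z => (deriv K z).im) _ z := Complex.imCLM.hasFDerivAt.comp z k2
  have b3 : HasFDerivAt (fun z => (K z).im) _ z := Complex.imCLM.hasFDerivAt.comp z k1
  have e1 : HasFDerivAt (streamField₁ η K) _ z := (a1.fun_mul b1).fun_add (a2.fun_mul b3)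
  have e2 : HasFDerivAt (streamField₂ η K) _ z := (a1.fun_mul b2).fun_neg
  rw [e1.fderiv, e2.fderiv]
  simp
  ring

/-- The squared L² norm is the area of the image of the cell under `toDisc`, whose derivative has
modulus exp(Im z). -/
theorem memLp_exp_im (hf : Continuous f) (hper : Function.Periodic f (2 * Real.pi)) :
    MemLp (fun z : ℂ => Real.exp z.im) 2 (volume.restrict (cell f)) := by
  refine ⟨(Real.continuous_exp.comp Complex.continuous_im).aestronglyMeasurable, ?_⟩
  rw [eLpNorm_lt_top_iff_lintegral_rpow_enorm_lt_top (by norm_num) (by norm_num)]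
  have h1 := lintegral_image_eq_of_injOn (measurableSet_cell hf)
    (fun z _ => (hasDerivAt_toDisc z).differentiableAt) injOn_toDisc_cell (fun _ => 1)
  have h2 : ∀ z : ℂ, ‖deriv toDisc z‖ₑ = ‖Real.exp z.im‖ₑ := by
    intro z
    rw [(hasDerivAt_toDisc z).deriv, ← ofReal_norm, ← ofReal_norm, norm_mul, norm_neg,
      Complex.norm_I, one_mul, norm_toDisc, Real.norm_of_nonneg (Real.exp_pos _).le]
  simp only [h2, mul_one, lintegral_one, Measure.restrict_apply_univ] at h1
  simp only [ENNReal.toReal_ofNat, ENNReal.rpow_ofNat]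
  rw [← h1]
  refine (measure_mono ?_).trans_lt (isBounded_discDomain hf hper).measure_lt_top
  exact (image_mono cell_subset_domain).trans (subset_insert _ _)

namespace IsUniformization

/-- The shifted gradient of the potential is orthogonal to gradients of functions with zero
trace. -/
theorem integral_inner_shift (h : IsUniformization f g L) {K : NNReal} (hK : LipschitzWith K f)
    (hper : Function.Periodic f (2 * Real.pi)) {v : ℂ → ℝ} {V : ℂ → ℂ} (hv : MemHdot1 f v V)
    (hv0 : HasTrace f v 0) {δ : ℝ} (hδ : 0 < δ) :
    ∫ z in cell f, inner ℝ (conj (deriv (complexPotential L) (z - δ * Complex.I))) (V z) =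
      (0 : ℝ) := by
  have hf := hK.continuous
  have hU := isOpen_domain hf
  have hmc := measurableSet_cell hf
  obtain ⟨C, hC, hdecay⟩ := h.exists_decay hf hper hδ
  obtain ⟨C₀, hC₀⟩ := exists_lipschitzWith_smoothTransition
  set H := complexPotential L with hH
  -- The constant L 0 does not affect the gradient but makes k decay downwards, which controls the
  -- term of the stream field where η is differentiated.
  set k : ℂ → ℂ := fun z => H (z - δ * Complex.I) + L 0 with hk
  have hre : ∀ z : ℂ, (z - δ * Complex.I).re = z.re := fun z => by simp
  have him : ∀ z : ℂ, (z - δ * Complex.I).im = z.im - δ := fun z => by simp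
  have hmem : ∀ z ∈ domain f, (z - δ * Complex.I).im ≤ f (z - δ * Complex.I).re - δ := by
    intro z hz
    have hz1 : z.im < f z.re := hz
    rw [hre, him]
    linarith
  have hmem' : ∀ z ∈ domain f, z - δ * Complex.I ∈ domain f := by
    intro z hz
    have h1 := hmem z hz
    change (z - δ * Complex.I).im < f (z - δ * Complex.I).re
    linarith
  have hHd := h.differentiableOn_complexPotential hf hper
  have hkder : ∀ z ∈ domain f, HasDerivAt k (deriv H (z - δ * Complex.I)) z := by
    intro z hz
    exact ((hHd.differentiableAt (hU.mem_nhds (hmem' z hz))).hasDerivAt.comp_sub_const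
      z (δ * Complex.I)).add_const (L 0)
  have hkd : DifferentiableOn ℂ k (domain f) := fun z hz =>
    (hkder z hz).differentiableAt.differentiableWithinAt
  have hexp : ∀ z : ℂ, C * Real.exp (z - δ * Complex.I).im ≤ C * Real.exp z.im := by
    intro z
    gcongr
    rw [him]
    linarith
  have hkb : ∀ z ∈ domain f, ‖k z‖ ≤ C * Real.exp z.im := fun z hz =>
    (hdecay _ (hmem z hz)).1.trans (hexp z)
  have hk'b : ∀ z ∈ domain f, ‖deriv k z‖ ≤ C * Real.exp z.im := fun z hz => by
    rw [(hkder z hz).deriv]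
    exact (hdecay _ (hmem z hz)).2.trans (hexp z)
  obtain ⟨M, hM⟩ := exists_bounds hf hper
  have hexpM : ∀ z ∈ domain f, Real.exp z.im ≤ Real.exp M := by
    intro z hz
    have hz1 : z.im < f z.re := hz
    exact Real.exp_le_exp.2 (hz1.le.trans ((le_abs_self _).trans (hM _)))
  have hkp : ∀ z, k (z + ((2 * Real.pi : ℝ) : ℂ)) = k z := by
    intro z
    simp only [hk]
    rw [show z + ((2 * Real.pi : ℝ) : ℂ) - δ * Complex.I =
      z - δ * Complex.I + ((2 * Real.pi : ℝ) : ℂ) by ring, hH, complexPotential_add_period]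
  have hk'p : ∀ z, deriv k (z + ((2 * Real.pi : ℝ) : ℂ)) = deriv k z := by
    intro z
    rw [← deriv_comp_add_const]
    congr 1
    ext w
    exact hkp w
  -- The argument runs from 0 at y = -2R to 1 at y = -R.
  set η : ℝ → ℝ → ℝ := fun R y => Real.smoothTransition (y / R + 2) with hη
  have hηs : ∀ R, ContDiff ℝ ((⊤ : ℕ∞) : WithTop ℕ∞) (η R) := fun R =>
    Real.smoothTransition.contDiff.comp ((contDiff_id.div_const R).add contDiff_const)
  have hη1 : ∀ R y, |η R y| ≤ 1 := fun R y => by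
    rw [abs_of_nonneg (Real.smoothTransition.nonneg _)]
    exact Real.smoothTransition.le_one _
  have hη'1 : ∀ R, 1 ≤ R → ∀ y, |deriv (η R) y| ≤ C₀ := by
    intro R hR y
    have hL : LipschitzWith C₀ (η R) := by
      refine LipschitzWith.of_dist_le_mul fun x y => ?_
      refine (hC₀.dist_le_mul _ _).trans ?_
      gcongr
      rw [dist_add_right, Real.dist_eq, Real.dist_eq, ← sub_div, abs_div,
        abs_of_pos (by linarith : 0 < R)]
      exact div_le_self (abs_nonneg _) hR
    exact norm_deriv_le_of_lipschitz hL
  have hη0 : ∀ R, 1 ≤ R → ∀ y, y < -(2 * R) → η R y = 0 := by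
    intro R hR y hy
    refine Real.smoothTransition.zero_of_nonpos ?_
    have : y / R ≤ -2 := by rw [div_le_iff₀ (by linarith)]; linarith
    linarith
  have hη'0 : ∀ R, 1 ≤ R → ∀ y, y < -(2 * R) → deriv (η R) y = 0 := by
    intro R hR y hy
    have : η R =ᶠ[𝓝 y] fun _ => 0 := by
      filter_upwards [Iio_mem_nhds hy] with x hx using hη0 R hR x hx
    rw [this.deriv_eq, deriv_const]
  have hηone : ∀ R, 1 ≤ R → ∀ y, -R < y → η R y = 1 := by
    intro R hR y hy
    refine Real.smoothTransition.one_of_one_le ?_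
    have : -1 ≤ y / R := by rw [le_div_iff₀ (by linarith)]; linarith
    linarith
  have hη'one : ∀ R, 1 ≤ R → ∀ y, -R < y → deriv (η R) y = 0 := by
    intro R hR y hy
    have : η R =ᶠ[𝓝 y] fun _ => 1 := by
      filter_upwards [Ioi_mem_nhds hy] with x hx using hηone R hR x hx
    rw [this.deriv_eq, deriv_const]
  have hb₁ : ∀ R, 1 ≤ R → ∀ z ∈ domain f,
      |streamField₁ (η R) k z| ≤ (C + C₀ * C) * Real.exp z.im := by
    intro R hR z hz
    calc |streamField₁ (η R) k z|
        ≤ |η R z.im * (deriv k z).re| + |deriv (η R) z.im * (k z).im| := abs_add_le _ _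
      _ ≤ 1 * (C * Real.exp z.im) + C₀ * (C * Real.exp z.im) := by
          rw [abs_mul, abs_mul]
          gcongr
          · exact hη1 _ _
          · exact (Complex.abs_re_le_norm _).trans (hk'b z hz)
          · exact hη'1 R hR _
          · exact (Complex.abs_im_le_norm _).trans (hkb z hz)
      _ = _ := by ring
  have hb₂ : ∀ R z, z ∈ domain f → |streamField₂ (η R) k z| ≤ (C + C₀ * C) * Real.exp z.im := by
    intro R z hz
    rw [streamField₂, abs_neg, abs_mul]
    calc |η R z.im| * |(deriv k z).im| ≤ 1 * (C * Real.exp z.im) := by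
          gcongr
          · exact hη1 _ _
          · exact (Complex.abs_im_le_norm _).trans (hk'b z hz)
      _ ≤ _ := by
          rw [one_mul]
          gcongr
          have : 0 ≤ C₀ * C := by positivity
          linarith
  have hzero : ∀ R, 1 ≤ R → ∫ z in cell f, (streamField₁ (η R) k z * (V z).re +
      streamField₂ (η R) k z * (V z).im) = 0 := by
    intro R hR
    obtain ⟨s1, s2⟩ := contDiffOn_streamField hU hkd (hηs R)
    refine integral_cell_eq_zero_of_div_eq_zero hK hper hv hv0 (R := 2 * R)
      (B := (C + C₀ * C) * Real.exp M) s1 s2 ?_ ?_ ?_ ?_ ?_ ?_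
      fun z hz => div_streamField hU hkd (hηs R) hz
    · intro z _
      simp only [streamField₁, hkp, hk'p]
      simp
    · intro z _
      simp only [streamField₂, hk'p]
      simp
    · intro z hz
      rw [streamField₁, hη0 R hR _ hz, hη'0 R hR _ hz]
      ring
    · intro z hz
      rw [streamField₂, hη0 R hR _ hz]
      ring
    · intro z hz
      refine (hb₁ R hR z hz).trans ?_
      exact mul_le_mul_of_nonneg_left (hexpM z hz) (by positivity)
    · intro z hz
      refine (hb₂ R z hz).trans ?_
      exact mul_le_mul_of_nonneg_left (hexpM z hz) (by positivity)
  have hVm : AEStronglyMeasurable V (volume.restrict (cell f)) := hv.memLp_grad.1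
  -- Dominated by a multiple of exp(Im z)|V|, a product of two L² functions. At each fixed point the
  -- field equals the shifted gradient once R is large.
  have hlim : Tendsto (fun R : ℝ => ∫ z in cell f, (streamField₁ (η R) k z * (V z).re +
      streamField₂ (η R) k z * (V z).im)) atTop
      (𝓝 (∫ z in cell f, inner ℝ (conj (deriv H (z - δ * Complex.I))) (V z))) := by
    refine tendsto_integral_filter_of_dominated_convergence
      (fun z => (2 * (C + C₀ * C)) * (Real.exp z.im * ‖V z‖)) ?_ ?_ ?_ ?_
    · refine Eventually.of_forall fun R => ?_
      obtain ⟨s1, s2⟩ := contDiffOn_streamField hU hkd (hηs R)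
      exact (((s1.continuousOn.mono cell_subset_domain).aestronglyMeasurable hmc).mul
        (Complex.continuous_re.comp_aestronglyMeasurable hVm)).add
        (((s2.continuousOn.mono cell_subset_domain).aestronglyMeasurable hmc).mul
        (Complex.continuous_im.comp_aestronglyMeasurable hVm))
    · filter_upwards [eventually_ge_atTop 1] with R hR
      filter_upwards [ae_restrict_mem hmc] with z hz
      calc ‖streamField₁ (η R) k z * (V z).re + streamField₂ (η R) k z * (V z).im‖
          ≤ |streamField₁ (η R) k z * (V z).re| + |streamField₂ (η R) k z * (V z).im| :=
            abs_add_le _ _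
        _ ≤ (C + C₀ * C) * Real.exp z.im * ‖V z‖ + (C + C₀ * C) * Real.exp z.im * ‖V z‖ := by
            rw [abs_mul, abs_mul]
            gcongr
            · exact hb₁ R hR z hz.1
            · exact Complex.abs_re_le_norm _
            · exact hb₂ R z hz.1
            · exact Complex.abs_im_le_norm _
        _ = _ := by ring
    · exact ((memLp_exp_im hf hper).integrable_mul hv.memLp_grad.norm).const_mul _
    · filter_upwards [ae_restrict_mem hmc] with z hz
      refine tendsto_const_nhds.congr' ?_
      filter_upwards [eventually_ge_atTop 1, eventually_gt_atTop (-z.im)] with R hR hRz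
      have hRz' : -R < z.im := by linarith
      rw [streamField₁, streamField₂, hηone R hR _ hRz', hη'one R hR _ hRz',
        (hkder z hz.1).deriv, Complex.inner]
      simp
      ring
  refine tendsto_nhds_unique hlim (tendsto_const_nhds.congr' ?_)
  filter_upwards [eventually_ge_atTop 1] with R hR using (hzero R hR).symm

/-- The potential satisfies the variational identity. -/
theorem integral_inner_eq_zero (h : IsUniformization f g L) {K : NNReal} (hK : LipschitzWith K f)
    (hper : Function.Periodic f (2 * Real.pi)) {v : ℂ → ℝ} {V : ℂ → ℂ} (hv : MemHdot1 f v V)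
    (hv0 : HasTrace f v 0) :
    ∫ z in cell f, inner ℝ (conj (deriv (complexPotential L) z)) (V z) = (0 : ℝ) := by
  have hf := hK.continuous
  have hmc := measurableSet_cell hf
  set W : ℂ → ℂ := fun z => conj (deriv (complexPotential L) z) with hW
  have hWL : MemLp ((cell f).indicator W) 2 volume :=
    (memLp_indicator_iff_restrict hmc).2 (h.memHdot1_potential hf hper).memLp_grad
  have hVL : MemLp ((cell f).indicator V) 2 volume :=
    (memLp_indicator_iff_restrict hmc).2 hv.memLp_grad
  have hind : ∀ c : ℂ, ∫ z, inner ℝ ((cell f).indicator W (c + z)) ((cell f).indicator V z) =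
      ∫ z in cell f, (inner ℝ ((cell f).indicator W (c + z)) (V z) : ℝ) := by
    intro c
    rw [← integral_indicator hmc]
    refine integral_congr_ae (Eventually.of_forall fun z => ?_)
    by_cases hz : z ∈ cell f
    · simp only [indicator_of_mem hz]
    · simp only [indicator_of_notMem hz, inner_zero_right]
  have hip : ∀ c : ℂ, inner ℝ (DomAddAct.mk c +ᵥ hWL.toLp _) (hVL.toLp _) =
      ∫ z in cell f, (inner ℝ ((cell f).indicator W (c + z)) (V z) : ℝ) := by
    intro c
    rw [← hind, DomAddAct.mk_vadd_toLp, L2.inner_def]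
    refine integral_congr_ae ?_
    filter_upwards [MemLp.coeFn_toLp (hWL.comp_measurePreserving
      (measurePreserving_vadd c volume)), hVL.coeFn_toLp] with z h1 h2
    exact congrArg₂ (inner ℝ) h1 h2
  have : Fact ((2 : ℝ≥0∞) ≠ ∞) := ⟨by norm_num⟩
  -- Translation acts continuously on L². The gradient is extended by zero outside the cell; only
  -- downward shifts occur, and these keep the cell inside itself.
  have hcont : Continuous fun t : ℝ => (inner ℝ
      (DomAddAct.mk (-(t * Complex.I)) +ᵥ hWL.toLp _) (hVL.toLp _) : ℝ) := by
    refine Continuous.inner ?_ continuous_const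
    have h1 : Continuous fun t : ℝ => DomAddAct.mk (-(t * Complex.I)) :=
      DomAddAct.continuous_mk.comp (by fun_prop)
    exact h1.vadd continuous_const
  have hz : ∀ t : ℝ, 0 < t → (inner ℝ
      (DomAddAct.mk (-(t * Complex.I)) +ᵥ hWL.toLp _) (hVL.toLp _) : ℝ) = 0 := by
    intro t ht
    rw [hip, ← h.integral_inner_shift hK hper hv hv0 ht]
    refine setIntegral_congr_fun hmc fun z hz => ?_
    have hz1 : z.im < f z.re := hz.1
    have hmem : -(t * Complex.I) + z ∈ cell f := by
      refine ⟨?_, ?_, ?_⟩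
      · change (-(t * Complex.I) + z).im < f (-(t * Complex.I) + z).re
        simp
        linarith
      · simpa using hz.2.1
      · simpa using hz.2.2
    rw [indicator_of_mem hmem, hW, neg_add_eq_sub]
  have hlim := (hcont.tendsto 0).mono_left (nhdsWithin_le_nhds (s := Ioi 0))
  have hlim' := tendsto_nhds_unique hlim (tendsto_const_nhds.congr' (by
    filter_upwards [self_mem_nhdsWithin] with t ht using (hz t ht).symm))
  rw [hip] at hlim'
  rw [← hlim']
  refine setIntegral_congr_fun hmc fun z hz => ?_
  simp only [Complex.ofReal_zero, zero_mul, neg_zero, zero_add, indicator_of_mem hz, hW]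

end IsUniformization

end

/-! ### Uniqueness of the harmonic extension -/

section

open scoped Convolution in
/-- A continuous function whose weak gradient vanishes is locally constant. -/
theorem HasWeakGradientOn.eq_of_mem_ball {U : Set ℂ} {d : ℂ → ℝ} {V : ℂ → ℂ}
    (h : HasWeakGradientOn d V U) (hd : ContinuousOn d U)
    (hV : ∀ᵐ z, z ∈ U → V z = 0) {z₀ : ℂ} {r : ℝ} (hr : 0 < r)
    (hball : closedBall z₀ (2 * r) ⊆ U) {x y : ℂ} (hx : x ∈ ball z₀ r) (hy : y ∈ ball z₀ r) :
    d x = d y := by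
  set B := closedBall z₀ (2 * r) with hB
  set a : ℂ → ℝ := B.indicator d with ha
  have hai : Integrable a := by
    rw [ha, integrable_indicator_iff isClosed_closedBall.measurableSet]
    exact (hd.mono hball).integrableOn_compact (isCompact_closedBall _ _)
  -- A mollification at scale below r is constant on the ball of radius r: its derivative tests d
  -- against a bump supported in the ball of radius 2r, where the weak gradient vanishes.
  have key : ∀ φ : ContDiffBump (0 : ℂ), φ.rOut < r →
      (φ.normed volume ⋆[ContinuousLinearMap.lsmul ℝ ℝ] a : ℂ → ℝ) x =
      (φ.normed volume ⋆[ContinuousLinearMap.lsmul ℝ ℝ] a : ℂ → ℝ) y := by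
    intro φ hφ
    set ρ : ℂ → ℝ := φ.normed volume with hρ
    have hρd : ContDiff ℝ ((⊤ : ℕ∞) : WithTop ℕ∞) ρ := φ.contDiff_normed
    have hρc : HasCompactSupport ρ := φ.hasCompactSupport_normed
    have hder := fun z => hρc.hasFDerivAt_convolution_left (ContinuousLinearMap.lsmul ℝ ℝ)
      (hρd.of_le (by simp)) hai.locallyIntegrable z
    refine isOpen_ball.is_const_of_fderiv_eq_zero (𝕜 := ℝ)
      (convex_ball z₀ r).isPreconnected
      (fun z _ => (hder z).differentiableAt.differentiableWithinAt) (fun z hz => ?_) hx hy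
    rw [(hder z).fderiv]
    ext e
    rw [← convolution_flip]
    have h1 : ((ContinuousLinearMap.lsmul ℝ ℝ).precompL ℂ : (ℂ →L[ℝ] ℝ) →L[ℝ] ℝ →L[ℝ] ℂ →L[ℝ] ℝ).flip
        = ((ContinuousLinearMap.lsmul ℝ ℝ).flip.precompR ℂ) := rfl
    rw [h1, convolution_precompR_apply _ hai.locallyIntegrable (hρc.fderiv ℝ)
      (hρd.continuous_fderiv (by simp)), convolution_def]
    simp only [ContinuousLinearMap.flip_apply, ContinuousLinearMap.lsmul_apply, smul_eq_mul]
    set σ : ℂ → ℝ := fun w => ρ (z - w) with hσ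
    have hσd : ContDiff ℝ ((⊤ : ℕ∞) : WithTop ℕ∞) σ := hρd.comp (contDiff_const.sub contDiff_id)
    have hσc : HasCompactSupport σ := hρc.comp_homeomorph (Homeomorph.subLeft z)
    have hσB : tsupport σ ⊆ B := by
      have h2 : tsupport σ = (Homeomorph.subLeft z) ⁻¹' tsupport ρ :=
        tsupport_comp_eq_preimage ρ (Homeomorph.subLeft z)
      rw [h2, hρ, φ.tsupport_normed_eq]
      intro w hw
      have h3 : ‖z - w‖ ≤ φ.rOut := by simpa using hw
      have h4 : dist z z₀ < r := hz
      rw [hB, mem_closedBall]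
      calc dist w z₀ ≤ dist w z + dist z z₀ := dist_triangle _ _ _
        _ ≤ 2 * r := by rw [dist_comm w z, dist_eq_norm z w]; linarith
    have hfd : ∀ w, fderiv ℝ ρ (z - w) e = -fderiv ℝ σ w e := by
      intro w
      have h2 : HasFDerivAt σ ((fderiv ℝ ρ (z - w)).comp (-ContinuousLinearMap.id ℝ ℂ)) w :=
        ((hρd.differentiable (by simp)) (z - w)).hasFDerivAt.comp w
          ((hasFDerivAt_id w).const_sub z)
      rw [h2.fderiv]
      simp
    have h5 := h.integral_univ hσd hσc (hσB.trans hball) e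
    have h6 : ∫ w, σ w * inner ℝ (V w) e = 0 := by
      refine integral_eq_zero_of_ae ?_
      filter_upwards [hV] with w hw
      by_cases hwB : w ∈ tsupport σ
      · simp [hw (hball (hσB hwB))]
      · simp [image_eq_zero_of_notMem_tsupport hwB]
    rw [h6, neg_zero] at h5
    change ∫ t, fderiv ℝ ρ (z - t) e * a t = 0
    rw [← neg_zero, ← h5, ← integral_neg]
    refine integral_congr_ae (Eventually.of_forall fun w => ?_)
    simp only [hfd]
    by_cases hwB : w ∈ B
    · rw [ha, indicator_of_mem hwB]
      ring
    · have : fderiv ℝ σ w e = 0 := image_eq_zero_of_notMem_tsupport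
        (f := fun z => fderiv ℝ σ z e) fun h => hwB (hσB (tsupport_fderiv_apply e h))
      rw [this]
      simp
  have approx : ∀ z ∈ ball z₀ r, ∀ ε > 0, ∃ δ > 0, ∀ φ : ContDiffBump (0 : ℂ), φ.rOut ≤ δ →
      dist ((φ.normed volume ⋆[ContinuousLinearMap.lsmul ℝ ℝ] a : ℂ → ℝ) z) (d z) ≤ ε := by
    intro z hz ε hε
    have hzB : B ∈ 𝓝 z := mem_of_superset (isOpen_ball.mem_nhds hz)
      (ball_subset_closedBall.trans (closedBall_subset_closedBall (by linarith)))
    have hc : ContinuousAt a z := by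
      refine ContinuousAt.congr ((hd.mono hball).continuousAt hzB) ?_
      filter_upwards [hzB] with w hw
      rw [ha, indicator_of_mem hw]
    have hza : a z = d z := by rw [ha, indicator_of_mem (mem_of_mem_nhds hzB)]
    obtain ⟨δ, hδ, hd'⟩ := Metric.continuousAt_iff.1 hc ε hε
    refine ⟨δ, hδ, fun φ hφ => ?_⟩
    rw [← hza]
    exact φ.dist_normed_convolution_le hai.aestronglyMeasurable
      fun w hw => (hd' ((mem_ball.1 hw).trans_le hφ)).le
  refine eq_of_forall_dist_le fun ε hε => ?_
  obtain ⟨δ₁, hδ₁, h₁⟩ := approx x hx (ε / 2) (half_pos hε)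
  obtain ⟨δ₂, hδ₂, h₂⟩ := approx y hy (ε / 2) (half_pos hε)
  set δ := min (r / 2) (min δ₁ δ₂) with hδ
  have hδ0 : 0 < δ := lt_min (half_pos hr) (lt_min hδ₁ hδ₂)
  let φ : ContDiffBump (0 : ℂ) := ⟨δ / 2, δ, half_pos hδ0, half_lt_self hδ0⟩
  have e1 := h₁ φ ((min_le_right _ _).trans (min_le_left _ _))
  have e2 := h₂ φ ((min_le_right _ _).trans (min_le_right _ _))
  have e3 := key φ ((min_le_left _ _).trans_lt (half_lt_self hr))
  rw [← e3] at e2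
  calc dist (d x) (d y) ≤ _ := dist_triangle_left _ _ _
    _ ≤ ε / 2 + ε / 2 := add_le_add e1 e2
    _ = ε := add_halves ε

/-- A continuous function whose weak gradient vanishes on a domain is constant. -/
theorem HasWeakGradientOn.exists_const {U : Set ℂ} {d : ℂ → ℝ} {V : ℂ → ℂ}
    (h : HasWeakGradientOn d V U) (hU : IsOpen U) (hUc : IsPreconnected U) (hd : ContinuousOn d U)
    (hV : ∀ᵐ z, z ∈ U → V z = 0) : ∃ c, ∀ z ∈ U, d z = c := by
  have hloc : ∀ z ∈ U, HasFDerivAt d (0 : ℂ →L[ℝ] ℝ) z := by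
    intro z hz
    obtain ⟨r, hr, hb⟩ := Metric.nhds_basis_closedBall.mem_iff.1 (hU.mem_nhds hz)
    have hr2 : 0 < r / 2 := half_pos hr
    refine (hasFDerivAt_const (d z) z).congr_of_eventuallyEq ?_
    filter_upwards [ball_mem_nhds z hr2] with w hw
    exact h.eq_of_mem_ball hd hV hr2 (by rwa [mul_div_cancel₀ _ two_ne_zero]) hw
      (mem_ball_self hr2)
  exact hU.exists_is_const_of_fderiv_eq_zero hUc
    (fun z hz => (hloc z hz).differentiableAt.differentiableWithinAt) fun z hz => (hloc z hz).fderiv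

variable {f : ℝ → ℝ} {g L : ℂ → ℂ}

/-- The domain is the image of a half-plane under the vertical shear by f. -/
theorem isPreconnected_domain (hf : Continuous f) : IsPreconnected (domain f) := by
  have h1 : domain f = (fun z : ℂ => z + f z.re * Complex.I) '' {z : ℂ | z.im < 0} := by
    ext z
    refine ⟨fun hz => ⟨z - f z.re * Complex.I, ?_, ?_⟩, ?_⟩
    · change z.im < f z.re at hz
      simpa using hz
    · simp
    · rintro ⟨w, hw, rfl⟩
      change w.im < 0 at hw
      change (w + f w.re * Complex.I).im < f (w + f w.re * Complex.I).re
      simpa using hw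
  rw [h1]
  refine (convex_halfSpace_im_lt 0).isPreconnected.image _ (Continuous.continuousOn ?_)
  fun_prop

theorem exists_add_period_mem_cell (hper : Function.Periodic f (2 * Real.pi)) {z : ℂ}
    (hz : z ∈ domain f) : ∃ n : ℤ, z + n * ((2 * Real.pi : ℝ) : ℂ) ∈ cell f := by
  obtain ⟨n, hn, -⟩ := existsUnique_add_zsmul_mem_Ico Real.two_pi_pos z.re 0
  refine ⟨n, (add_int_period_mem_domain hper z n).2 hz, ?_⟩
  simpa using hn

namespace MemHdot1

variable {u u' : ℂ → ℝ} {V V' : ℂ → ℂ}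

theorem sub (h : MemHdot1 f u V) (h' : MemHdot1 f u' V') :
    MemHdot1 f (fun z => u z - u' z) (fun z => V z - V' z) :=
  ⟨fun z hz => by rw [h.periodic z hz, h'.periodic z hz], h.weakGradient.sub h'.weakGradient,
    h.memLp_grad.sub h'.memLp_grad⟩

theorem add_int_period (h : MemHdot1 f u V) (hper : Function.Periodic f (2 * Real.pi)) (n : ℤ) :
    ∀ z ∈ domain f, u (z + n * ((2 * Real.pi : ℝ) : ℂ)) = u z := by
  induction n using Int.induction_on with
  | zero => simp
  | succ n ih =>
    intro z hz
    rw [← ih z hz, ← h.periodic _ ((add_int_period_mem_domain hper z n).2 hz)]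
    congr 1
    push_cast
    ring
  | pred n ih =>
    intro z hz
    rw [← ih z hz, ← h.periodic _ ((add_int_period_mem_domain hper z (-n - 1)).2 hz)]
    congr 1
    push_cast
    ring

/-- Uniqueness of the weak gradient makes it periodic almost everywhere; countably many translates
of the cell cover the domain. -/
theorem ae_eq_zero (h : MemHdot1 f u V) (hf : Continuous f)
    (hper : Function.Periodic f (2 * Real.pi)) (hV : ∀ᵐ z, z ∈ cell f → V z = 0) :
    ∀ᵐ z, z ∈ domain f → V z = 0 := by
  have h1 : ∀ᵐ z, ∀ n : ℤ, z ∈ domain f → V (z + n * ((2 * Real.pi : ℝ) : ℂ)) = V z := by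
    refine ae_all_iff.2 fun n => ?_
    exact ((h.weakGradient.comp_add fun z => add_int_period_mem_domain hper z n).congr
      (isOpen_domain hf) fun z hz => (h.add_int_period hper n z hz).symm).ae_eq h.weakGradient
      (isOpen_domain hf)
  have h2 : ∀ᵐ z, ∀ n : ℤ, z + n * ((2 * Real.pi : ℝ) : ℂ) ∈ cell f →
      V (z + n * ((2 * Real.pi : ℝ) : ℂ)) = 0 :=
    ae_all_iff.2 fun n => (measurePreserving_add_right volume
      (n * ((2 * Real.pi : ℝ) : ℂ))).quasiMeasurePreserving.ae hV
  filter_upwards [h1, h2] with z hz1 hz2 hz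
  obtain ⟨n, hn⟩ := exists_add_period_mem_cell hper hz
  rw [← hz1 n hz, hz2 n hn]

end MemHdot1

theorem integrable_inner_of_memLp {μ : Measure ℂ} {V W : ℂ → ℂ} (hV : MemLp V 2 μ)
    (hW : MemLp W 2 μ) : Integrable (fun z => (inner ℝ (V z) (W z) : ℝ)) μ := by
  refine (L2.integrable_inner (𝕜 := ℝ) (hV.toLp V) (hW.toLp W)).congr ?_
  filter_upwards [hV.coeFn_toLp, hW.coeFn_toLp] with z h1 h2
  rw [h1, h2]

/-- The triangle inequality. Continuity serves to make one integrand measurable, as additivity of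
the lower integral requires. -/
theorem HasTrace.sub {u u' : ℂ → ℝ} {b : ℝ → ℝ} (h : HasTrace f u b) (h' : HasTrace f u' b)
    (hb : Continuous b) (hu : Continuous u) : HasTrace f (fun z => u z - u' z) 0 := by
  have h1 := h.add h'
  rw [add_zero] at h1
  refine tendsto_of_tendsto_of_tendsto_of_le_of_le tendsto_const_nhds h1
    (fun _ => bot_le) fun t => ?_
  simp only
  rw [← ENNReal.add_div, ← lintegral_add_left]
  · refine ENNReal.div_le_div_right (lintegral_mono fun z => ?_) _
    have h2 : u z - u' z - (0 : ℝ → ℝ) z.re = (u z - b z.re) - (u' z - b z.re) := by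
      simp
    rw [h2]
    exact enorm_sub_le
  · exact ((hu.sub (hb.comp Complex.continuous_re)).measurable).enorm

/-- The normalized strip integral of |c| is 2π|c| at every thickness. -/
theorem HasTrace.const_eq_zero {u : ℂ → ℝ} {c : ℝ} (h : HasTrace f u 0) (hf : Continuous f)
    (hu : ∀ z ∈ domain f, u z = c) : c = 0 := by
  have h1 : Tendsto (fun _ : ℝ => ‖c‖ₑ * ENNReal.ofReal (2 * Real.pi)) (𝓝[>] (0 : ℝ)) (𝓝 0) := by
    refine h.congr' ?_
    filter_upwards [self_mem_nhdsWithin] with t ht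
    have h2 : ∫⁻ z in strip f t, ‖u z - (0 : ℝ → ℝ) z.re‖ₑ = ∫⁻ _ in strip f t, ‖c‖ₑ :=
      setLIntegral_congr_fun (measurableSet_strip hf t) fun z hz => by
        simp only [Pi.zero_apply, sub_zero]
        rw [hu z (cell_subset_domain (strip_subset_cell t hz))]
    have ht0 : ENNReal.ofReal t ≠ 0 := (ENNReal.ofReal_pos.2 ht).ne'
    rw [h2, setLIntegral_const, volume_strip hf, ← mul_assoc,
      ENNReal.mul_div_cancel_right ht0 ENNReal.ofReal_ne_top]
  have h2 := tendsto_nhds_unique h1 tendsto_const_nhds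
  rw [eq_comm, mul_eq_zero, enorm_eq_zero, ENNReal.ofReal_eq_zero] at h2
  exact h2.resolve_right (not_le.2 Real.two_pi_pos)

namespace IsUniformization

theorem isHarmonicExtension (h : IsUniformization f g L) {K : NNReal} (hK : LipschitzWith K f)
    (hper : Function.Periodic f (2 * Real.pi)) : IsHarmonicExtension f f (potential f g) := by
  have hf := hK.continuous
  refine ⟨(h.continuous_potential hf hper).continuousOn, fun x => ?_, h.hasTrace_potential hf hper,
    _, h.memHdot1_potential hf hper, fun u V hu h0 => h.integral_inner_eq_zero hK hper hu h0⟩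
  rw [potential, green_of_notMem, zero_add]
  exact lt_irrefl (f x)

/-- The harmonic extension is unique. -/
theorem eq_potential (h : IsUniformization f g L) {K : NNReal} (hK : LipschitzWith K f)
    (hper : Function.Periodic f (2 * Real.pi)) {φ : ℂ → ℝ} (hφ : IsHarmonicExtension f f φ)
    {z : ℂ} (hz : z ∈ domain f) : φ z = potential f g z := by
  have hf := hK.continuous
  have hp := h.isHarmonicExtension hK hper
  have hP := h.memHdot1_potential hf hper
  obtain ⟨W, hW, hWo⟩ := hφ.variational
  set P : ℂ → ℂ := fun z => conj (deriv (complexPotential L) z) with hPdef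
  have hd := hP.sub hW
  have hd0 := hp.trace_eq.sub hφ.trace_eq hf (h.continuous_potential hf hper)
  -- The difference of the two solutions is itself an admissible test function. Both gradients are
  -- orthogonal to its gradient, so that gradient has zero energy.
  have h1 : ∫ z in cell f, (inner ℝ (P z) (P z - W z) : ℝ) = 0 :=
    h.integral_inner_eq_zero hK hper hd hd0
  have h2 := hWo _ _ hd hd0
  have h3 : ∫ z in cell f, ‖P z - W z‖ ^ 2 = 0 := by
    have h4 := integral_sub (integrable_inner_of_memLp hP.memLp_grad hd.memLp_grad)
      (integrable_inner_of_memLp hW.memLp_grad hd.memLp_grad)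
    rw [h1, h2, sub_zero] at h4
    simpa only [← inner_sub_left, real_inner_self_eq_norm_sq] using h4
  have h5 : Integrable (fun z => ‖P z - W z‖ ^ 2) (volume.restrict (cell f)) := by
    simpa only [real_inner_self_eq_norm_sq] using
      integrable_inner_of_memLp hd.memLp_grad hd.memLp_grad
  have h6 : ∀ᵐ z, z ∈ cell f → P z - W z = 0 := by
    rw [← ae_restrict_iff' (measurableSet_cell hf)]
    filter_upwards [(integral_eq_zero_iff_of_nonneg (fun z => sq_nonneg _) h5).1 h3] with z hz
    simpa using hz
  obtain ⟨c, hc⟩ := hd.weakGradient.exists_const (isOpen_domain hf) (isPreconnected_domain hf)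
    ((h.continuous_potential hf hper).continuousOn.sub hφ.continuousOn) (hd.ae_eq_zero hf hper h6)
  have hc0 := hd0.const_eq_zero hf hc
  have := hc z hz
  linarith

end IsUniformization

end

/-! ### Tangent discs at a `C^{1,1}` point and the quadratic bound -/

section

variable {f : ℝ → ℝ} {g L : ℂ → ℂ} {x₀ : ℝ}

theorem IsC11At.exists_hasDerivAt (h : IsC11At f x₀) :
    ∃ v M γ : ℝ, 0 < M ∧ 0 < γ ∧ HasDerivAt f v x₀ ∧
      ∀ x : ℝ, |x - x₀| < γ → |f x - f x₀ - v * (x - x₀)| ≤ M * |x - x₀| ^ 2 := by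
  obtain ⟨v, M, γ, hM, hγ, hb⟩ := h
  refine ⟨v, M, γ, hM, hγ, ?_, hb⟩
  rw [hasDerivAt_iff_isLittleO]
  have h1 : (fun x => f x - f x₀ - (x - x₀) • v) =O[𝓝 x₀] fun x => |x - x₀| ^ 2 := by
    refine Asymptotics.IsBigO.of_bound M ?_
    filter_upwards [ball_mem_nhds x₀ hγ] with x hx
    have := hb x (by simpa [Real.dist_eq] using hx)
    rw [smul_eq_mul, mul_comm (x - x₀) v, Real.norm_eq_abs, Real.norm_eq_abs, abs_pow, abs_abs]
    exact this
  refine h1.trans_isLittleO ?_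
  have h2 : (fun x : ℝ => |x - x₀| ^ 2) =o[𝓝 x₀] fun x => (x - x₀) ^ 1 := by
    simp only [sq_abs]
    have h3 : Tendsto (fun x : ℝ => x - x₀) (𝓝 x₀) (𝓝 0) := by
      have := (continuous_sub_right x₀).tendsto x₀
      rwa [sub_self] at this
    exact (Asymptotics.isLittleO_pow_pow (by norm_num : 1 < 2)).comp_tendsto h3
  simpa using h2

theorem re_mul_conj_normal (v : ℝ) (ζ : ℂ) : (ζ * conj (⟨-v, 1⟩ : ℂ)).re = ζ.im - v * ζ.re := by
  simp
  ring

/-- Its sign locates q relative to the circle about -a through the origin; all tangent-disc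
conditions are read off from it. -/
theorem norm_add_sq_sub (q a : ℂ) : ‖q + a‖ ^ 2 - ‖a‖ ^ 2 = ‖q‖ ^ 2 + 2 * (q * conj a).re := by
  simp only [Complex.sq_norm, Complex.normSq_add]
  ring

theorem toDisc_add_sub (z₀ ζ a : ℂ) : toDisc (z₀ + ζ) - toDisc z₀ * (1 - a) =
    toDisc z₀ * ((Complex.exp (-(Complex.I * ζ)) - 1) + a) := by
  have : toDisc (z₀ + ζ) = toDisc z₀ * Complex.exp (-(Complex.I * ζ)) := by
    rw [toDisc, toDisc, ← Complex.exp_add]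
    ring_nf
  rw [this]
  ring

/-- The exterior disc condition for the disc domain. -/
theorem exists_exterior_disc (hper : Function.Periodic f (2 * Real.pi)) {v M γ : ℝ} (hM : 0 < M)
    (hγ : 0 < γ) (hb : ∀ x : ℝ, |x - x₀| < γ → |f x - f x₀ - v * (x - x₀)| ≤ M * |x - x₀| ^ 2) :
    ∃ ρ : ℝ, 0 < ρ ∧ ∀ w ∈ discDomain f,
      ‖toDisc ⟨x₀, f x₀⟩‖ * (ρ * ‖(⟨-v, 1⟩ : ℂ)‖) <
        ‖w - toDisc ⟨x₀, f x₀⟩ * (1 - Complex.I * ⟨-v, 1⟩ * ρ)‖ := by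
  set N : ℂ := ⟨-v, 1⟩ with hN
  set z₀ : ℂ := ⟨x₀, f x₀⟩ with hz₀
  set w₀ := toDisc z₀ with hw₀
  have hw0 : w₀ ≠ 0 := toDisc_ne_zero _
  have hw0' : 0 < ‖w₀‖ := norm_pos_iff.2 hw0
  have hN1 : 1 ≤ ‖N‖ := by
    have := Complex.abs_im_le_norm N
    simpa [hN] using this
  -- The three smallness conditions keep |q| ≤ 1/2 for the logarithm, keep |ζ| < γ for the `C^{1,1}`
  -- bound, and let curvature and logarithm errors be absorbed by |q|². The reciprocal of a sum of
  -- all the requirements satisfies each of them.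
  obtain ⟨ρ, hρ, h1, h2, h3⟩ : ∃ ρ : ℝ, 0 < ρ ∧ 2 * (ρ * ‖N‖) < 1 / 2 ∧
      3 * (ρ * ‖N‖) < γ ∧ 2 * ρ * (9 / 4 * M + ‖N‖) ≤ 1 := by
    have hpos : 0 < 4 * ‖N‖ + 3 * ‖N‖ / γ + 2 * (9 / 4 * M + ‖N‖) + 1 := by positivity
    set D := 4 * ‖N‖ + 3 * ‖N‖ / γ + 2 * (9 / 4 * M + ‖N‖) + 1 with hD
    have h3 : 0 < 3 * ‖N‖ / γ := by positivity
    refine ⟨1 / D, by positivity, ?_, ?_, ?_⟩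
    · rw [← mul_assoc, mul_one_div, div_mul_eq_mul_div, div_lt_iff₀ hpos]
      nlinarith
    · have h4 : 3 * ‖N‖ / γ * γ = 3 * ‖N‖ := div_mul_cancel₀ _ hγ.ne'
      have h5 : 3 * (1 / D * ‖N‖) = 3 * ‖N‖ / D := by ring
      rw [h5, div_lt_iff₀ hpos]
      nlinarith
    · have h5 : 2 * (1 / D) * (9 / 4 * M + ‖N‖) = 2 * (9 / 4 * M + ‖N‖) / D := by ring
      rw [h5, div_le_one hpos]
      nlinarith
  have hIN : ‖Complex.I * N * ρ‖ = ρ * ‖N‖ := by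
    rw [norm_mul, norm_mul, Complex.norm_I, one_mul, Complex.norm_of_nonneg hρ.le, mul_comm]
  refine ⟨ρ, hρ, fun w hw => ?_⟩
  by_contra hcon
  rw [not_lt] at hcon
  set q := w / w₀ - 1 with hq
  have hwq : w = w₀ * (1 + q) := by
    rw [hq]
    field_simp
    ring
  have e1 : w - w₀ * (1 - Complex.I * N * ρ) = w₀ * (q + Complex.I * N * ρ) := by
    rw [hwq]
    ring
  rw [e1, norm_mul] at hcon
  have e2 : ‖q + Complex.I * N * ρ‖ ≤ ρ * ‖N‖ := le_of_mul_le_mul_left hcon hw0'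
  have hqn : ‖q‖ ≤ 2 * (ρ * ‖N‖) := by
    have := norm_sub_le (q + Complex.I * N * ρ) (Complex.I * N * ρ)
    rw [add_sub_cancel_right, hIN] at this
    linarith
  have hq2 : ‖q‖ ≤ 1 / 2 := by linarith
  have hdisc : ‖q‖ ^ 2 + 2 * (q * conj (Complex.I * N * ρ)).re ≤ 0 := by
    rw [← norm_add_sq_sub, hIN, sub_nonpos]
    gcongr
  have h1q : 1 + q ≠ 0 := by
    intro h0
    have : q = -1 := by linear_combination h0
    rw [this] at hq2
    norm_num at hq2
  -- Local inverse of `toDisc` at the boundary point: a point of the forbidden disc is pulled back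
  -- to z₀ + ζ.
  set ζ := Complex.I * Complex.log (1 + q) with hζ
  have hζw : toDisc (z₀ + ζ) = w := by
    have h4 := toDisc_add_sub z₀ ζ 1
    rw [sub_self, mul_zero, sub_zero, sub_add_cancel] at h4
    have h5 : -(Complex.I * ζ) = Complex.log (1 + q) := by
      rw [hζ, ← mul_assoc, Complex.I_mul_I]
      ring
    rw [h4, h5, Complex.exp_log h1q, hwq]
  rw [← hζw, toDisc_mem_discDomain hper] at hw
  have hζn : ‖ζ‖ ≤ 3 / 2 * ‖q‖ := by
    rw [hζ, norm_mul, Complex.norm_I, one_mul]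
    exact Complex.norm_log_one_add_half_le_self hq2
  have hre : |ζ.re| ≤ ‖ζ‖ := Complex.abs_re_le_norm ζ
  have hw' : f x₀ + ζ.im < f (x₀ + ζ.re) := hw
  have hbb := hb (x₀ + ζ.re) (by rw [add_sub_cancel_left]; linarith)
  rw [add_sub_cancel_left] at hbb
  have h6 := (abs_le.1 hbb).2
  have h7 : |ζ.re| ^ 2 ≤ 9 / 4 * ‖q‖ ^ 2 := by
    calc |ζ.re| ^ 2 ≤ (3 / 2 * ‖q‖) ^ 2 := by gcongr; exact hre.trans hζn
      _ = _ := by ring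
  have h8 : (ζ * conj N).re < M * (9 / 4 * ‖q‖ ^ 2) := by
    rw [hN, re_mul_conj_normal]
    have := mul_le_mul_of_nonneg_left h7 hM.le
    linarith
  have h9 : ‖Complex.log (1 + q) - q‖ ≤ ‖q‖ ^ 2 := by
    refine (Complex.norm_log_one_add_sub_self_le (by linarith)).trans ?_
    have : (1 - ‖q‖)⁻¹ ≤ 2 := by
      rw [inv_le_comm₀ (by linarith) (by norm_num)]
      linarith
    nlinarith [sq_nonneg ‖q‖]
  -- To first order q is -iζ. Lying in the disc forces |q|² ≤ 2ρ Re(ζ conj N) up to 2ρ‖N‖|q|², while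
  -- lying below the graph gives Re(ζ conj N) < (9/4)M|q|²; the choice of ρ makes these
  -- incompatible.
  have h10 : (q * conj (Complex.I * N * ρ)).re =
      -(ρ * (ζ * conj N).re) + ρ * (Complex.I * (Complex.log (1 + q) - q) * conj N).re := by
    rw [hζ, ← Complex.re_ofReal_mul, ← Complex.re_ofReal_mul, ← Complex.neg_re, ← Complex.add_re]
    congr 1
    simp only [map_mul, Complex.conj_I, Complex.conj_ofReal]
    ring
  have h11 : -(‖q‖ ^ 2 * ‖N‖) ≤ (Complex.I * (Complex.log (1 + q) - q) * conj N).re := by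
    refine (neg_le_neg ?_).trans (neg_abs_le _)
    refine (Complex.abs_re_le_norm _).trans ?_
    rw [norm_mul, norm_mul, Complex.norm_I, one_mul, Complex.norm_conj]
    gcongr
  rw [h10] at hdisc
  have h12 := mul_le_mul_of_nonneg_left h11 hρ.le
  have h13 := mul_lt_mul_of_pos_left h8 hρ
  have h14 := mul_le_mul_of_nonneg_right h3 (sq_nonneg ‖q‖)
  nlinarith

/-- The interior disc condition. -/
theorem ball_subset_domain {v M γ r : ℝ} (hr : 0 < r) (hrM : 2 * r * M ≤ 1)
    (hrγ : 2 * (r * ‖(⟨-v, 1⟩ : ℂ)‖) ≤ γ)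
    (hb : ∀ x : ℝ, |x - x₀| < γ → |f x - f x₀ - v * (x - x₀)| ≤ M * |x - x₀| ^ 2) :
    ball ((⟨x₀, f x₀⟩ : ℂ) - r * ⟨-v, 1⟩) (r * ‖(⟨-v, 1⟩ : ℂ)‖) ⊆ domain f := by
  intro z hz
  set N : ℂ := ⟨-v, 1⟩ with hN
  set z₀ : ℂ := ⟨x₀, f x₀⟩ with hz₀
  obtain ⟨ζ, rfl⟩ : ∃ ζ, z = z₀ + ζ := ⟨z - z₀, by ring⟩
  have hrN : ‖(r : ℂ) * N‖ = r * ‖N‖ := by rw [norm_mul, Complex.norm_of_nonneg hr.le]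
  have h1 : ‖ζ + r * N‖ < r * ‖N‖ := by
    have h0 : z₀ + ζ - (z₀ - r * N) = ζ + r * N := by ring
    rwa [mem_ball, dist_eq_norm, h0] at hz
  -- In the disc the height of ζ relative to the tangent line is below -|ζ|²/(2r), which 2rM ≤ 1
  -- puts under the parabola -M(Re ζ)².
  have h2 : ‖ζ‖ ^ 2 + 2 * (ζ * conj (r * N)).re < 0 := by
    rw [← norm_add_sq_sub, hrN, sub_neg]
    gcongr
  have h3 : (ζ * conj (r * N)).re = r * (ζ.im - v * ζ.re) := by
    rw [← re_mul_conj_normal, ← hN, ← Complex.re_ofReal_mul, map_mul, Complex.conj_ofReal]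
    ring_nf
  have h4 : ‖ζ‖ < γ := by
    have := norm_sub_le (ζ + r * N) (r * N)
    rw [add_sub_cancel_right, hrN] at this
    linarith
  have hre : |ζ.re| ≤ ‖ζ‖ := Complex.abs_re_le_norm ζ
  have hbb := hb (x₀ + ζ.re) (by rw [add_sub_cancel_left]; linarith)
  rw [add_sub_cancel_left] at hbb
  have h6 := (abs_le.1 hbb).1
  have h7 : |ζ.re| ^ 2 ≤ ‖ζ‖ ^ 2 := by gcongr
  change f x₀ + ζ.im < f (x₀ + ζ.re)
  rw [h3] at h2
  have h8 : 2 * r * M * |ζ.re| ^ 2 ≤ 1 * ‖ζ‖ ^ 2 := by gcongr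
  nlinarith

/-- A domain that avoids a disc has a Green function that is controlled by the distance to it. -/
theorem IsUniformization.exists_green_le_of_exterior_disc (h : IsUniformization f g L)
    (hf : Continuous f) (hper : Function.Periodic f (2 * Real.pi)) {c : ℂ} {R : ℝ} (hR : 0 < R)
    (hd : ∀ w ∈ discDomain f, R < ‖w - c‖) :
    ∃ K, 0 < K ∧ ∀ z ∈ domain f, K * (‖toDisc z - c‖ ^ 2 - R ^ 2) ≤ 1 / 2 →
      green f g z ≤ K * (‖toDisc z - c‖ ^ 2 - R ^ 2) := by
  have h0 := zero_mem_discDomain f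
  -- Inversion sends the exterior of the disc into the unit disc. Composed with the Möbius map that
  -- moves m(0) to 0, it competes with g in the Schwarz lemma.
  set m : ℂ → ℂ := fun w => R / (w - c) with hm
  have hne : ∀ w ∈ discDomain f, w - c ≠ 0 := fun w hw =>
    norm_pos_iff.1 (hR.trans (hd w hw))
  have hmn : ∀ w, ‖m w‖ = R / ‖w - c‖ := fun w => by
    rw [hm, norm_div, Complex.norm_of_nonneg hR.le]
  have hm1 : ∀ w ∈ discDomain f, ‖m w‖ < 1 := fun w hw => by
    rw [hmn, div_lt_one (hR.trans (hd w hw))]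
    exact hd w hw
  set a := m 0 with ha
  have ha1 : ‖a‖ < 1 := hm1 0 h0
  have hmd : DifferentiableOn ℂ m (discDomain f) :=
    (differentiableOn_const _).div (differentiableOn_id.sub_const c) hne
  have hS : ∀ w ∈ discDomain f, ‖moebius a (m w)‖ ≤ ‖g w‖ := fun w hw => by
    refine h.riemann.norm_le_norm (isOpen_discDomain hf hper) isPreconnected_discDomain
      (isBounded_discDomain hf hper) h0 (k := fun w => moebius a (m w)) ?_ ?_ ?_ hw
    · intro w hw
      exact ((hasDerivAt_moebius ha1 (hm1 w hw).le).differentiableAt.comp_differentiableWithinAt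
        w (hmd w hw))
    · exact fun w hw => (norm_moebius_lt_one ha1 (hm1 w hw)).le
    · exact moebius_self a
  have ha2 : 0 < 1 - ‖a‖ := by linarith
  have ha3 : 0 < 1 - ‖a‖ ^ 2 := by nlinarith [norm_nonneg a]
  refine ⟨(1 - ‖a‖ ^ 2) / (1 - ‖a‖) ^ 2 / R ^ 2, by positivity, fun z hz hs => ?_⟩
  set s := (1 - ‖a‖ ^ 2) / (1 - ‖a‖) ^ 2 / R ^ 2 * (‖toDisc z - c‖ ^ 2 - R ^ 2) with hsdef
  have hw : toDisc z ∈ discDomain f := (toDisc_mem_discDomain hper).2 hz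
  set w := toDisc z with hwdef
  have hdw := hd w hw
  have hwp : 0 < ‖w - c‖ := hR.trans hdw
  have e1 : 1 - ‖moebius a (m w)‖ ^ 2 ≤ s := by
    rw [one_sub_norm_moebius_sq ha1 (hm1 w hw).le]
    have e2 : 1 - ‖m w‖ ^ 2 ≤ (‖w - c‖ ^ 2 - R ^ 2) / R ^ 2 := by
      rw [hmn, div_pow, one_sub_div (by positivity)]
      have : 0 ≤ ‖w - c‖ ^ 2 - R ^ 2 := by nlinarith
      gcongr
    have e3 : 1 - ‖a‖ ≤ ‖1 - conj a * m w‖ := by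
      have e4 := norm_sub_norm_le (1 : ℂ) (conj a * m w)
      rw [norm_one, norm_mul, Complex.norm_conj] at e4
      nlinarith [norm_nonneg a, (hm1 w hw).le]
    have e5 : 0 ≤ 1 - ‖m w‖ ^ 2 := by nlinarith [norm_nonneg (m w), hm1 w hw]
    calc (1 - ‖a‖ ^ 2) * (1 - ‖m w‖ ^ 2) / ‖1 - conj a * m w‖ ^ 2
        ≤ (1 - ‖a‖ ^ 2) * (1 - ‖m w‖ ^ 2) / (1 - ‖a‖) ^ 2 := by gcongr
      _ ≤ (1 - ‖a‖ ^ 2) * ((‖w - c‖ ^ 2 - R ^ 2) / R ^ 2) / (1 - ‖a‖) ^ 2 := by gcongr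
      _ = s := by
        rw [hsdef]
        ring
  have e6 : 1 - s ≤ ‖g w‖ ^ 2 := by
    have := pow_le_pow_left₀ (norm_nonneg _) (hS w hw) 2
    linarith
  rw [green_of_mem hz]
  have e7 := Real.one_sub_inv_le_log_of_pos (x := ‖g w‖ ^ 2) (by linarith)
  rw [Real.log_pow] at e7
  -- This uses (1 - s)(1 + 2s) ≥ 1, valid for 0 ≤ s ≤ 1/2. Then 1 - 1/x ≤ log x at x = |g|² bounds
  -- -log|g| by s.
  have e8 : (‖g w‖ ^ 2)⁻¹ ≤ 1 + 2 * s := by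
    rw [inv_le_iff_one_le_mul₀ (by linarith)]
    have hs0 : 0 ≤ s := by
      refine le_trans ?_ e1
      nlinarith [norm_nonneg (moebius a (m w)), norm_moebius_lt_one ha1 (hm1 w hw)]
    nlinarith
  push_cast at e7
  linarith

/-- Near a point of the boundary with an exterior disc, the Green function is quadratically small
on the interior tangent circles. -/
theorem IsUniformization.exists_green_le_sq (h : IsUniformization f g L)
    (hf : Continuous f) (hper : Function.Periodic f (2 * Real.pi)) {v M γ r : ℝ} (hM : 0 < M)
    (hγ : 0 < γ) (hb : ∀ x : ℝ, |x - x₀| < γ → |f x - f x₀ - v * (x - x₀)| ≤ M * |x - x₀| ^ 2)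
    (hr : 0 < r) :
    ∃ C, 0 ≤ C ∧ ∀ ζ : ℂ, ‖ζ + r * ⟨-v, 1⟩‖ = r * ‖(⟨-v, 1⟩ : ℂ)‖ →
      green f g (⟨x₀, f x₀⟩ + ζ) ≤ C * ‖ζ‖ ^ 2 := by
  obtain ⟨ρ, hρ, hd⟩ := exists_exterior_disc hper hM hγ hb
  set N : ℂ := ⟨-v, 1⟩ with hN
  set z₀ : ℂ := ⟨x₀, f x₀⟩ with hz₀
  set w₀ := toDisc z₀ with hw₀
  have hw0' : 0 < ‖w₀‖ := norm_pos_iff.2 (toDisc_ne_zero _)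
  have hN1 : 1 ≤ ‖N‖ := by
    have := Complex.abs_im_le_norm N
    simpa [hN] using this
  obtain ⟨K, hK, hKb⟩ := h.exists_green_le_of_exterior_disc hf hper
    (R := ‖w₀‖ * (ρ * ‖N‖)) (by positivity) hd
  set R := ‖w₀‖ * (ρ * ‖N‖) with hR
  set c := w₀ * (1 - Complex.I * N * ρ) with hc
  have hIN : ‖Complex.I * N * ρ‖ = ρ * ‖N‖ := by
    rw [norm_mul, norm_mul, Complex.norm_I, one_mul, Complex.norm_of_nonneg hρ.le, mul_comm]
  have hrN : ‖(r : ℂ) * N‖ = r * ‖N‖ := by rw [norm_mul, Complex.norm_of_nonneg hr.le]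
  set C₁ := ‖w₀‖ ^ 2 * (4 + 2 * ρ * (1 / (2 * r) + ‖N‖)) with hC₁
  have hC₁0 : 0 < C₁ := by positivity
  -- The image of the interior circle and the exterior circle are tangent at the image of z₀: the
  -- first-order terms in ζ cancel and only O(|ζ|²) survives.
  have near : ∀ ζ : ℂ, ‖ζ + r * N‖ = r * ‖N‖ → ‖ζ‖ ≤ 1 →
      ‖toDisc (z₀ + ζ) - c‖ ^ 2 - R ^ 2 ≤ C₁ * ‖ζ‖ ^ 2 := by
    intro ζ hζ hζ1
    have h1 : ‖ζ‖ ^ 2 + 2 * (ζ * conj (r * N)).re = 0 := by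
      rw [← norm_add_sq_sub, hrN, hζ, sub_self]
    have h2 : (ζ * conj (r * N)).re = r * (ζ * conj N).re := by
      rw [← Complex.re_ofReal_mul, map_mul, Complex.conj_ofReal]
      ring_nf
    rw [h2] at h1
    set q := Complex.exp (-(Complex.I * ζ)) - 1 with hq
    have hIζ : ‖-(Complex.I * ζ)‖ = ‖ζ‖ := by rw [norm_neg, norm_mul, Complex.norm_I, one_mul]
    have hq1 : ‖q‖ ≤ 2 * ‖ζ‖ := by
      rw [← hIζ]
      exact Complex.norm_exp_sub_one_le (by rwa [hIζ])
    have hq2 : ‖q - -(Complex.I * ζ)‖ ≤ ‖ζ‖ ^ 2 := by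
      rw [← hIζ]
      exact Complex.norm_exp_sub_one_sub_id_le (by rwa [hIζ])
    have h3 : (q * conj (Complex.I * N * ρ)).re =
        -(ρ * (ζ * conj N).re) + ρ * ((q - -(Complex.I * ζ)) * conj (Complex.I * N)).re := by
      rw [← Complex.re_ofReal_mul, ← Complex.re_ofReal_mul, ← Complex.neg_re, ← Complex.add_re]
      congr 1
      simp only [map_mul, Complex.conj_I, Complex.conj_ofReal]
      linear_combination ((ρ : ℂ) * ζ * conj N) * Complex.I_mul_I
    have h4 : ((q - -(Complex.I * ζ)) * conj (Complex.I * N)).re ≤ ‖ζ‖ ^ 2 * ‖N‖ := by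
      refine (Complex.re_le_norm _).trans ?_
      rw [norm_mul, Complex.norm_conj, norm_mul, Complex.norm_I, one_mul]
      gcongr
    have h5 : -(ζ * conj N).re = ‖ζ‖ ^ 2 * (1 / (2 * r)) := by
      field_simp
      linarith
    rw [hc, toDisc_add_sub, norm_mul, hR, mul_pow, mul_pow _ (ρ * ‖N‖), ← mul_sub, ← hIN,
      norm_add_sq_sub, h3, hC₁, mul_assoc]
    gcongr
    have h6 := mul_le_mul_of_nonneg_left h4 hρ.le
    have h7 : ‖q‖ ^ 2 ≤ (2 * ‖ζ‖) ^ 2 := by gcongr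
    have h8 : -(ρ * (ζ * conj N).re) = ρ * (‖ζ‖ ^ 2 * (1 / (2 * r))) := by rw [← h5]; ring
    rw [h8]
    linarith
  -- Away from the contact point boundedness on the compact circle suffices, since there |ζ|² ≥ δ².
  obtain ⟨B, hB⟩ := (isCompact_sphere (z₀ - r * N) (r * ‖N‖)).exists_bound_of_continuousOn
    (h.continuous_green hf hper).continuousOn
  set δ := min 1 (1 / (2 * (K * C₁))) with hδ
  have hδ0 : 0 < δ := by positivity
  refine ⟨max (K * C₁) (|B| / δ ^ 2), le_max_of_le_left (by positivity), fun ζ hζ => ?_⟩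
  by_cases hζδ : ‖ζ‖ ≤ δ
  · refine le_trans ?_ (mul_le_mul_of_nonneg_right (le_max_left _ _) (sq_nonneg _))
    by_cases hz : z₀ + ζ ∈ domain f
    · have hζ1 : ‖ζ‖ ≤ 1 := hζδ.trans (min_le_left _ _)
      have h1 := mul_le_mul_of_nonneg_left (near ζ hζ hζ1) hK.le
      refine (hKb _ hz (h1.trans ?_)).trans (h1.trans_eq (by ring))
      have h2 : ‖ζ‖ ≤ 1 / (2 * (K * C₁)) := hζδ.trans (min_le_right _ _)
      have h3 : ‖ζ‖ ^ 2 ≤ 1 / (2 * (K * C₁)) := by nlinarith [norm_nonneg ζ]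
      calc K * (C₁ * ‖ζ‖ ^ 2) ≤ K * (C₁ * (1 / (2 * (K * C₁)))) := by gcongr
        _ = 1 / 2 := by field_simp
    · rw [green_of_notMem hz]
      positivity
  · refine le_trans ?_ (mul_le_mul_of_nonneg_right (le_max_right _ _) (sq_nonneg _))
    have h1 : green f g (z₀ + ζ) ≤ |B| := by
      refine (le_abs_self _).trans ((hB _ ?_).trans (le_abs_self B))
      rw [mem_sphere, dist_eq_norm, ← hζ]
      congr 1
      ring
    refine h1.trans ?_
    rw [div_mul_eq_mul_div, le_div_iff₀ (by positivity)]
    have : δ ^ 2 ≤ ‖ζ‖ ^ 2 := by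
      have := (not_le.1 hζδ).le
      gcongr
    gcongr

end

/-! ### Existence of the normal derivative and comparison -/

section

/-- A harmonic function in a disc that is quadratically small on the circle near a boundary point
has a normal derivative there. -/
theorem exists_tendsto_div_of_le_sq {u : ℂ → ℝ} {z₀ N : ℂ} {r C : ℝ} (hN : N ≠ 0) (hr : 0 < r)
    (huc : Continuous u) (hu0 : ∀ z, 0 ≤ u z)
    (hu : InnerProductSpace.HarmonicOnNhd u (ball (z₀ - r * N) (r * ‖N‖)))
    (hC : ∀ ζ : ℂ, ‖ζ + r * N‖ = r * ‖N‖ → u (z₀ + ζ) ≤ C * ‖ζ‖ ^ 2) :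
    ∃ A, Tendsto (fun h : ℝ => 1 / h * u (z₀ + h • N)) (𝓝[<] 0) (𝓝 A) := by
  have hN0 : 0 < ‖N‖ := norm_pos_iff.2 hN
  have hrN : ‖(r : ℂ) * N‖ = r * ‖N‖ := by rw [norm_mul, Complex.norm_of_nonneg hr.le]
  set p := z₀ - r * N with hp
  set y : ℝ → ℂ := circleMap p (r * ‖N‖) with hy
  have hyc : Continuous y := continuous_circleMap _ _
  have hyn : ∀ θ, ‖y θ - p‖ = r * ‖N‖ := fun θ => by
    rw [hy, circleMap_sub_center, norm_circleMap_zero, abs_of_nonneg (by positivity)]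
  have hyC : ∀ θ, u (y θ) ≤ C * ‖y θ - z₀‖ ^ 2 := fun θ => by
    have h1 := hC (y θ - z₀) (by rw [← hyn θ, hp]; congr 1; ring)
    rwa [add_sub_cancel] at h1
  have hu_z₀ : ∀ θ, y θ = z₀ → u (y θ) = 0 := fun θ hθ => by
    have h1 := hyC θ
    rw [hθ, sub_self] at h1
    rw [hθ]
    exact le_antisymm (by simpa using h1) (hu0 _)
  have hcl : InnerProductSpace.HarmonicContOnCl u (ball p (r * ‖N‖)) := ⟨hu, huc.continuousOn⟩
  -- The Poisson kernel at z₀ + hN divided by h, times u: its numerator r²‖N‖² - (r + h)²‖N‖² equals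
  -- -h(2r + h)‖N‖².
  set F : ℝ → ℝ → ℝ := fun h θ => -(2 * r + h) * ‖N‖ ^ 2 / ‖y θ - (z₀ + h • N)‖ ^ 2 * u (y θ)
    with hF
  have hq : ∀ h : ℝ, (z₀ + h • N) - p = ((h + r : ℝ) : ℂ) * N := fun h => by
    rw [hp, Complex.real_smul]
    push_cast
    ring
  have hqn : ∀ h : ℝ, -r ≤ h → ‖(z₀ + h • N) - p‖ = (h + r) * ‖N‖ := fun h hh => by
    rw [hq, norm_mul, Complex.norm_of_nonneg (by linarith)]
  have heq : ∀ h : ℝ, -r ≤ h → h < 0 →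
      1 / h * u (z₀ + h • N) = (2 * Real.pi)⁻¹ • ∫ θ in (0 : ℝ)..2 * Real.pi, F h θ := by
    intro h hh hh0
    have hw : z₀ + h • N ∈ ball p (r * ‖N‖) := by
      rw [mem_ball, dist_eq_norm, hqn h hh]
      nlinarith
    rw [← hcl.circleAverage_poissonKernel_smul hw, Real.circleAverage_def, smul_eq_mul,
      smul_eq_mul, mul_left_comm, ← intervalIntegral.integral_const_mul]
    congr 1
    refine intervalIntegral.integral_congr fun θ _ => ?_
    simp only [Pi.mul_apply, poissonKernel_def, hF]
    rw [hyn, hqn h hh, sub_sub_sub_cancel_right]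
    change _ * (_ * u (y θ)) = _
    generalize ‖y θ - (z₀ + h • N)‖ ^ 2 = b
    have hne : h ≠ 0 := hh0.ne
    rw [← mul_assoc, ← mul_div_assoc]
    congr 2
    field_simp
    ring
  have hbound : ∀ h : ℝ, -r ≤ h → h < 0 → ∀ θ, ‖F h θ‖ ≤ 2 * r * ‖N‖ ^ 2 * (4 * C) := by
    intro h hh hh0 θ
    -- The point z₀ + hN has distance |h|‖N‖ to the circle, attained at z₀. So the kernel's
    -- denominator is comparable to |y - z₀|², which the quadratic bound on u cancels.
    have h1 : ‖y θ - z₀‖ ≤ 2 * ‖y θ - (z₀ + h • N)‖ := by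
      have h2 := norm_sub_le_norm_sub_add_norm_sub (y θ) (z₀ + h • N) p
      rw [hyn, hqn h hh] at h2
      have h3 := norm_sub_le_norm_sub_add_norm_sub (y θ) (z₀ + h • N) z₀
      rw [add_sub_cancel_left, norm_smul, Real.norm_eq_abs, abs_of_neg hh0] at h3
      linarith
    by_cases hyz : y θ = z₀
    · have h2 := hC 0 (by rw [zero_add, hrN])
      have hC0 : 0 ≤ C := by
        -- The antipode of z₀ on the circle shows C ≥ 0.
        have h3 := hC (-(2 * r * N)) (by rw [← hrN, ← norm_neg]; congr 1; ring)
        have h4 := (hu0 _).trans h3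
        have h5 : 0 < ‖-(2 * r * N)‖ ^ 2 := pow_pos (norm_pos_iff.2 (neg_ne_zero.2 (mul_ne_zero
          (mul_ne_zero two_ne_zero (Complex.ofReal_ne_zero.2 hr.ne')) hN))) 2
        exact nonneg_of_mul_nonneg_left h4 h5
      simp only [hF, hu_z₀ θ hyz, mul_zero, norm_zero]
      positivity
    · have h4 : 0 < ‖y θ - z₀‖ := norm_pos_iff.2 (sub_ne_zero.2 hyz)
      have h5 : 0 < ‖y θ - (z₀ + h • N)‖ := by linarith
      have h6 : 0 ≤ 2 * r + h := by linarith
      have h7 := hyC θ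
      have hC0 : 0 ≤ C := nonneg_of_mul_nonneg_left ((hu0 _).trans h7) (by positivity)
      have h8 : u (y θ) ≤ 4 * C * ‖y θ - (z₀ + h • N)‖ ^ 2 := by
        refine h7.trans ?_
        calc C * ‖y θ - z₀‖ ^ 2 ≤ C * (2 * ‖y θ - (z₀ + h • N)‖) ^ 2 := by gcongr
          _ = _ := by ring
      rw [hF, Real.norm_eq_abs, abs_mul, abs_of_nonneg (hu0 _), abs_div, neg_mul, abs_neg,
        abs_of_nonneg (by positivity), abs_of_nonneg (by positivity), div_mul_eq_mul_div,
        div_le_iff₀ (by positivity)]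
      calc (2 * r + h) * ‖N‖ ^ 2 * u (y θ)
          ≤ (2 * r) * ‖N‖ ^ 2 * (4 * C * ‖y θ - (z₀ + h • N)‖ ^ 2) := by
            gcongr
            · exact hu0 _
            · linarith
        _ = _ := by ring
  have hnear : ∀ᶠ h : ℝ in 𝓝[<] 0, -r ≤ h ∧ h < 0 := by
    filter_upwards [Ioo_mem_nhdsLT (show -r < 0 by linarith)] with h hh using ⟨hh.1.le, hh.2⟩
  refine ⟨(2 * Real.pi)⁻¹ • ∫ θ in (0 : ℝ)..2 * Real.pi, F 0 θ, ?_⟩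
  have hlim : Tendsto (fun h => ∫ θ in (0 : ℝ)..2 * Real.pi, F h θ) (𝓝[<] 0)
      (𝓝 (∫ θ in (0 : ℝ)..2 * Real.pi, F 0 θ)) := by
    refine intervalIntegral.tendsto_integral_filter_of_dominated_convergence
      (fun _ => 2 * r * ‖N‖ ^ 2 * (4 * C)) (Eventually.of_forall fun h => ?_) ?_
      intervalIntegrable_const (Eventually.of_forall fun θ _ => ?_)
    · refine Measurable.aestronglyMeasurable ?_
      refine Measurable.mul ?_ (huc.comp hyc).measurable
      refine Measurable.div measurable_const ?_
      exact Continuous.measurable (by fun_prop)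
    · filter_upwards [hnear] with h hh
      exact Eventually.of_forall fun θ _ => hbound h hh.1 hh.2 θ
    · refine Tendsto.mono_left ?_ nhdsWithin_le_nhds
      -- At the contact point u is zero, so F vanishes for every h and the singular denominator at h
      -- = 0 does no harm.
      by_cases hyz : y θ = z₀
      · simp only [hF, hu_z₀ θ hyz, mul_zero]
        exact tendsto_const_nhds
      · refine ContinuousAt.tendsto ?_
        have h4 : ‖y θ - (z₀ + (0 : ℝ) • N)‖ ^ 2 ≠ 0 := by
          rw [zero_smul, add_zero]
          exact pow_ne_zero _ (norm_ne_zero_iff.2 (sub_ne_zero.2 hyz))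
        refine ContinuousAt.mul (ContinuousAt.div ?_ ?_ h4) continuousAt_const <;> fun_prop
  refine (hlim.const_smul _).congr' ?_
  filter_upwards [hnear] with h hh using (heq h hh.1 hh.2).symm

variable {f f₁ f₂ : ℝ → ℝ} {g L g₁ L₁ g₂ L₂ : ℂ → ℂ} {x₀ : ℝ}

/-- A disc inside the domain that touches the graph at a point where it is `C^{1,1}`. -/
theorem IsC11At.exists_interior_disc (hC : IsC11At f x₀) :
    ∃ v M γ r : ℝ, 0 < M ∧ 0 < γ ∧ 0 < r ∧ normal f x₀ = ⟨-v, 1⟩ ∧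
      (∀ x : ℝ, |x - x₀| < γ → |f x - f x₀ - v * (x - x₀)| ≤ M * |x - x₀| ^ 2) ∧
      ball ((⟨x₀, f x₀⟩ : ℂ) - r * ⟨-v, 1⟩) (r * ‖(⟨-v, 1⟩ : ℂ)‖) ⊆ domain f := by
  obtain ⟨v, M, γ, hM, hγ, hd, hb⟩ := hC.exists_hasDerivAt
  have hN1 : 0 < ‖(⟨-v, 1⟩ : ℂ)‖ :=
    norm_pos_iff.2 fun h => by simpa using congrArg Complex.im h
  set r := min (1 / (2 * M)) (γ / (2 * ‖(⟨-v, 1⟩ : ℂ)‖)) with hr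
  have hr0 : 0 < r := by positivity
  have hrM : 2 * r * M ≤ 1 := by
    calc 2 * r * M ≤ 2 * (1 / (2 * M)) * M := by gcongr; exact min_le_left _ _
      _ = 1 := by field_simp
  have hrγ : 2 * (r * ‖(⟨-v, 1⟩ : ℂ)‖) ≤ γ := by
    calc 2 * (r * ‖(⟨-v, 1⟩ : ℂ)‖) ≤
        2 * (γ / (2 * ‖(⟨-v, 1⟩ : ℂ)‖) * ‖(⟨-v, 1⟩ : ℂ)‖) := by gcongr; exact min_le_right _ _
      _ = γ := by field_simp
  exact ⟨v, M, γ, r, hM, hγ, hr0, by rw [normal, hd.deriv], hb,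
    ball_subset_domain hr0 hrM hrγ hb⟩

theorem normal_ne_zero : normal f x₀ ≠ 0 := fun h => by
  simpa [normal] using congrArg Complex.im h

/-- The start of the downward normal segment runs along a radius of the interior disc. -/
theorem IsC11At.eventually_mem_domain (hC : IsC11At f x₀) :
    ∀ᶠ t : ℝ in 𝓝[<] 0, (⟨x₀, f x₀⟩ : ℂ) + t • normal f x₀ ∈ domain f := by
  obtain ⟨v, M, γ, r, -, -, hr, hn, -, hball⟩ := hC.exists_interior_disc
  have hN0 := norm_pos_iff.2 (normal_ne_zero (f := f) (x₀ := x₀))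
  rw [← hn] at hball
  filter_upwards [Ioo_mem_nhdsLT (show -r < 0 by linarith)] with t ht
  have h1 : (⟨x₀, f x₀⟩ : ℂ) + t • normal f x₀ - ((⟨x₀, f x₀⟩ : ℂ) - r * normal f x₀) =
      ((t + r : ℝ) : ℂ) * normal f x₀ := by
    rw [Complex.real_smul]
    push_cast
    ring
  refine hball ?_
  rw [mem_ball, dist_eq_norm, h1, norm_mul, Complex.norm_of_nonneg (by linarith [ht.1])]
  exact mul_lt_mul_of_pos_right (by linarith [ht.2]) hN0

namespace IsUniformization

theorem exists_tendsto_green (h : IsUniformization f g L) (hf : Continuous f)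
    (hper : Function.Periodic f (2 * Real.pi)) (hC : IsC11At f x₀) :
    ∃ A, Tendsto (fun h : ℝ => 1 / h * green f g ((⟨x₀, f x₀⟩ : ℂ) + h • normal f x₀))
      (𝓝[<] 0) (𝓝 A) := by
  obtain ⟨v, M, γ, r, hM, hγ, hr, hn, hb, hball⟩ := hC.exists_interior_disc
  obtain ⟨C, -, hCb⟩ := h.exists_green_le_sq hf hper hM hγ hb hr
  rw [← hn] at hball hCb
  exact exists_tendsto_div_of_le_sq normal_ne_zero hr (h.continuous_green hf hper) h.green_nonneg
    (fun z hz => h.harmonicAt_green hf hper (hball hz)) hCb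

/-- Restricted to the smaller domain, g₂ still maps into the unit disc and fixes 0, so |g₂| ≤ |g₁|
by the Schwarz lemma. -/
theorem green_le_green (h₁ : IsUniformization f₁ g₁ L₁) (h₂ : IsUniformization f₂ g₂ L₂)
    (hf₁ : Continuous f₁) (hper₁ : Function.Periodic f₁ (2 * Real.pi)) (hle : ∀ x, f₁ x ≤ f₂ x)
    (z : ℂ) : green f₁ g₁ z ≤ green f₂ g₂ z := by
  by_cases hz : z ∈ domain f₁
  · have hsub : domain f₁ ⊆ domain f₂ := fun z hz => lt_of_lt_of_le hz (hle z.re)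
    have hsubD : discDomain f₁ ⊆ discDomain f₂ := insert_subset_insert (image_mono hsub)
    rw [green_of_mem hz, green_of_mem (hsub hz), neg_le_neg_iff]
    refine Real.log_le_log (h₂.norm_pos (hsub hz)) ?_
    exact h₁.riemann.norm_le_norm (isOpen_discDomain hf₁ hper₁) isPreconnected_discDomain
      (isBounded_discDomain hf₁ hper₁) (zero_mem_discDomain f₁)
      (h₂.riemann.differentiableOn.mono hsubD) (fun w hw => (h₂.riemann.norm_lt_one w (hsubD hw)).le)
      h₂.riemann.map_zero ((toDisc_mem_discDomain hper₁).2 hz)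
  · rw [green_of_notMem hz]
    exact h₂.green_nonneg z

/-- The summand y of the potential contributes exactly 1, the vertical component of the normal. -/
theorem normalQuotient_eq (h : IsUniformization f g L) {K : NNReal} (hK : LipschitzWith K f)
    (hper : Function.Periodic f (2 * Real.pi)) {φ : ℂ → ℝ} (hφ : IsHarmonicExtension f f φ)
    {t : ℝ} (ht : t ≠ 0) (hz : (⟨x₀, f x₀⟩ : ℂ) + t • normal f x₀ ∈ domain f) :
    normalQuotient f φ x₀ t = 1 / t * green f g ((⟨x₀, f x₀⟩ : ℂ) + t • normal f x₀) + 1 := by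
  rw [normalQuotient, h.eq_potential hK hper hφ hz, hφ.boundary_eq, potential]
  simp only [normal, Complex.add_im, Complex.smul_im, smul_eq_mul]
  field_simp
  ring

end IsUniformization

theorem IsC11At.hasDNValueAt (hC : IsC11At f x₀) (h : IsUniformization f g L) {K : NNReal}
    (hK : LipschitzWith K f) (hper : Function.Periodic f (2 * Real.pi)) {A : ℝ}
    (hA : Tendsto (fun h : ℝ => 1 / h * green f g ((⟨x₀, f x₀⟩ : ℂ) + h • normal f x₀))
      (𝓝[<] 0) (𝓝 A)) : HasDNValueAt f f x₀ (A + 1) := by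
  obtain ⟨v, -, -, -, -, hd, -⟩ := hC.exists_hasDerivAt
  refine ⟨hd.differentiableAt, ⟨_, h.isHarmonicExtension hK hper⟩, fun φ hφ => ?_⟩
  refine (hA.add_const 1).congr' ?_
  filter_upwards [hC.eventually_mem_domain, self_mem_nhdsWithin] with t hz ht
  exact (h.normalQuotient_eq hK hper hφ (ne_of_lt ht) hz).symm

/-- The difference f₂ - f₁ has a minimum at x₀, so the derivatives agree there. Both Green functions
are then evaluated at the same points. -/
theorem normal_eq_normal (hle : ∀ x, f₁ x ≤ f₂ x) (heq : f₁ x₀ = f₂ x₀)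
    (hd₁ : DifferentiableAt ℝ f₁ x₀) (hd₂ : DifferentiableAt ℝ f₂ x₀) :
    normal f₁ x₀ = normal f₂ x₀ := by
  have hmin : IsLocalMin (fun x => f₂ x - f₁ x) x₀ := Eventually.of_forall fun x => by
    simp only [heq, sub_self, sub_nonneg]
    exact hle x
  have h1 := hmin.hasDerivAt_eq_zero (hd₂.hasDerivAt.sub hd₁.hasDerivAt)
  rw [normal, normal, sub_eq_zero.1 h1]

end

end DirichletNeumann

theorem mainTheorem10 (f₁ f₂ : ℝ → ℝ) (x₀ : ℝ)
    (hper₁ : Function.Periodic f₁ (2 * Real.pi)) (hper₂ : Function.Periodic f₂ (2 * Real.pi))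
    (hLip₁ : ∃ K : NNReal, LipschitzWith K f₁) (hLip₂ : ∃ K : NNReal, LipschitzWith K f₂)
    (hC₁ : DirichletNeumann.IsC11At f₁ x₀) (hC₂ : DirichletNeumann.IsC11At f₂ x₀)
    (hle : ∀ x : ℝ, f₁ x ≤ f₂ x) (heq : f₁ x₀ = f₂ x₀) :
    ∃ a₁ a₂ : ℝ, DirichletNeumann.HasDNValueAt f₁ f₁ x₀ a₁ ∧
      DirichletNeumann.HasDNValueAt f₂ f₂ x₀ a₂ ∧ a₁ ≥ a₂ := by
  obtain ⟨K₁, hK₁⟩ := hLip₁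
  obtain ⟨K₂, hK₂⟩ := hLip₂
  obtain ⟨g₁, L₁, h₁⟩ := DirichletNeumann.exists_isUniformization hK₁.continuous hper₁
  obtain ⟨g₂, L₂, h₂⟩ := DirichletNeumann.exists_isUniformization hK₂.continuous hper₂
  obtain ⟨A₁, hA₁⟩ := h₁.exists_tendsto_green hK₁.continuous hper₁ hC₁
  obtain ⟨A₂, hA₂⟩ := h₂.exists_tendsto_green hK₂.continuous hper₂ hC₂
  have hD₁ := hC₁.hasDNValueAt h₁ hK₁ hper₁ hA₁
  have hD₂ := hC₂.hasDNValueAt h₂ hK₂ hper₂ hA₂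
  refine ⟨A₁ + 1, A₂ + 1, hD₁, hD₂, add_le_add_left (le_of_tendsto_of_tendsto hA₂ hA₁ ?_) 1⟩
  filter_upwards [self_mem_nhdsWithin] with t ht
  rw [heq, DirichletNeumann.normal_eq_normal hle heq hD₁.differentiableAt hD₂.differentiableAt]
  -- The approach is from below, t < 0, so dividing by t reverses the order of the Green functions.
  exact mul_le_mul_of_nonpos_left (h₁.green_le_green h₂ hK₁.continuous hper₁ hle _)
    (one_div_nonpos.2 (le_of_lt ht))
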